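/- Let $M$ be a smooth manifold (finite-dimensional, Hausdorff, $\sigma$-compact, without boundary), $(A,\rho_A,[\![\cdot,\cdot]\!])$ a Lie algebroid over $M$ and $E\to M$ a smooth real vector bundle, both of finite rank. *Forms and cohomology.* For $n\ge 0$ let $\mathrm{Alt}^n_{\mathbb R}(\Gamma(A);C^\infty(M))$ be the space of alternating $\mathbb R$-multilinear maps $\eta:\Gamma(A)^n\to C^\infty(M)$ ($C^\infty(M)$-linearity is not required), with the differential $$(d_{A,\mathbb R}\eta)(a_0,\dots,a_n)=\sum_i(-1)^i(\rho_A\circ a_i)\big(\eta(a_0,\dots,\widehat{a_i},\dots,a_n)\big)+\sum_{i<j}(-1)^{i+j}\eta([\![a_i,a_j]\!],a_0,\dots,\widehat{a_i},\dots,\widehat{a_j},\dots,a_n).$$ Its cohomology is denoted by $H^\bullet_{\rho_A,\mathbb R}(A)$. *Connections.* An $\mathbb R$-linear connection of $A$ on $E$ is an $\mathbb R$-linear map $a\mapsto\nabla_a$ from $\Gamma(A)$ to the $\mathbb R$-linear endomorphisms of $\Gamma(E)$ such that $\nabla_a(f\nu)=f\nabla_a\nu+(\rho_A\circ a)(f)\,\nu$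 for $f\in C^\infty(M)$, $\nu\in\Gamma(E)$. Its curvature is $R^\nabla_{a,b}=[\nabla_a,\nabla_b]-\nabla_{[\![a,b]\!]}\in\Gamma(\mathrm{End}\,E)$; $\nabla$ is flat if $R^\nabla=0$. For a (fibrewise, smooth, positive definite) metric $h$ on $E$, $\nabla^h$ denotes the $\mathbb R$-linear connection with $(\rho_A\circ a)(h(s,t))=h(\nabla_as,t)+h(s,\nabla^h_at)$, and $\nabla$ is metric with respect to $h$ if $\nabla^h=\nabla$. *Chern character forms.* For $p\ge1$, $\mathrm{ch}_p(\nabla)=\mathrm{Tr}\,(R^\nabla)^p$, where $$(R^\nabla)^p(a_1,\dots,a_{2p})=\frac1{2^p}\sum_{\tau\in S_{2p}}\mathrm{sgn}\,\tau\; R^\nabla_{a_{\tau(1)},a_{\tau(2)}}\circ\dots\circ R^\nabla_{a_{\tau(2p-1)},a_{\tau(2p)}}.$$ *Chern–Simons forms.* Let $\nabla^0,\nabla^1$ be $\mathbb R$-linear connections of $A$ on $E$. The Lie algebra $\mathbb R\,\partial_t\oplus\Gamma(A)$ acts on $C^\infty(\mathbb R\times M)$ by $c\,\partial_t+a\mapsto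 c\,\partial_t+\rho_A\circ a$, and on sections $\sigma$ of the pull-back $\mathrm{pr}_2^*E$ of $E$ to $\mathbb R\times M$ by $$(\nabla^{\mathrm{aff}}_{c\,\partial_t+a}\sigma)(t,\cdot)=(1-t)\,\nabla^0_a(\sigma(t,\cdot))+t\,\nabla^1_a(\sigma(t,\cdot))+c\,(\partial_t\sigma)(t,\cdot).$$ With $\mathrm{ch}_p(\nabla^{\mathrm{aff}})$ given by the formulas above, $\mathrm{cs}_p(\nabla^0,\nabla^1)\in\mathrm{Alt}^{2p-1}_{\mathbb R}(\Gamma(A);C^\infty(M))$ is $$\mathrm{cs}_p(\nabla^0,\nabla^1)(a_1,\dots,a_{2p-1})=\int_0^1\mathrm{ch}_p(\nabla^{\mathrm{aff}})(\partial_t,a_1,\dots,a_{2p-1})_{|(t,\cdot)}\,dt.$$ **Theorem.** Let $\nabla$ and $\nabla_m$ be $\mathbb R$-linear connections of $A$ on $E$, where $\nabla_m$ is metric with respect to some metric on $E$. Let $p\ge1$, let $h$ be any metric on $E$, and let $u_{2p-1}(A,E)=[\mathrm{cs}_p(\nabla,\nabla^h)]\in H^{2p-1}_{\rho_A,\mathbb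 R}(A)$ be the secondary characteristic class of $\nabla$, whenever $\mathrm{cs}_p(\nabla,\nabla^h)$ is closed. (a) If $p$ is even, then $\mathrm{cs}_p(\nabla,\nabla^h)$ is closed and $u_{2p-1}(A,E)=0$. (b) If $p$ is odd and $\nabla$ is flat, then $\mathrm{cs}_p(\nabla,\nabla^h)$ and $\mathrm{cs}_p(\nabla,\nabla_m)$ are closed and $u_{2p-1}(A,E)=[2\,\mathrm{cs}_p(\nabla,\nabla_m)]$. -/

import Mathlib

open Bundle Set Filter Topology MeasureTheory Manifold
open scoped ContDiff

set_option linter.unusedSectionVars false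

noncomputable section

namespace LieAlgd

/-! ### Smooth functions and smooth sections -/

section Sections

variable {EN : Type*} [NormedAddCommGroup EN] [NormedSpace ℝ EN]
  {H : Type*} [TopologicalSpace H] {I : ModelWithCorners ℝ EN H}
  {N : Type*} [TopologicalSpace N] [ChartedSpace H N]
  {F : Type*} [NormedAddCommGroup F] [NormedSpace ℝ F]
  {E : N → Type*} [TopologicalSpace (TotalSpace F E)] [∀ x, TopologicalSpace (E x)]
  [∀ x, AddCommGroup (E x)] [∀ x, Module ℝ (E x)] [FiberBundle F E] [VectorBundle ℝ F E]

/-- Multiplication of a smooth section by a smooth function. -/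
instance instSMulFn : SMul C^∞⟮I, N; ℝ⟯ Cₛ^∞⟮I; F, E⟯ where
  smul f s := ⟨fun x => f x • s x, f.contMDiff.smul_section s.contMDiff⟩

@[simp] theorem fn_smul_apply (f : C^∞⟮I, N; ℝ⟯) (s : Cₛ^∞⟮I; F, E⟯) (x : N) :
    (f • s) x = f x • s x := rfl

/-- `Γ(E)` is a module over `C^∞(N)`. -/
instance instModuleFn : Module C^∞⟮I, N; ℝ⟯ Cₛ^∞⟮I; F, E⟯ where
  one_smul s := by ext x; simp
  mul_smul f g s := by ext x; simp [mul_smul]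
  smul_zero f := by
    ext x
    exact smul_zero (f x)
  smul_add f s t := by
    ext x
    exact smul_add (f x) (s x) (t x)
  add_smul f g s := by
    ext x
    exact add_smul (f x) (g x) (s x)
  zero_smul s := by
    ext x
    exact zero_smul ℝ (s x)

instance instTowerFn : IsScalarTower ℝ C^∞⟮I, N; ℝ⟯ Cₛ^∞⟮I; F, E⟯ where
  smul_assoc c f s := by ext x; simp [mul_smul]

instance instCommFn : SMulCommClass C^∞⟮I, N; ℝ⟯ ℝ Cₛ^∞⟮I; F, E⟯ where
  smul_comm f c s := by
    ext x
    exact smul_comm (f x) c (s x)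

/-- The value of a section at a point. -/
def evalSec (x : N) : Cₛ^∞⟮I; F, E⟯ →ₗ[ℝ] E x where
  toFun s := s x
  map_add' _ _ := rfl
  map_smul' _ _ := rfl

@[simp] theorem evalSec_apply (x : N) (s : Cₛ^∞⟮I; F, E⟯) : evalSec x s = s x := rfl

theorem sec_sum_apply {ι : Type*} (t : Finset ι) (g : ι → Cₛ^∞⟮I; F, E⟯) (x : N) :
    (∑ i ∈ t, g i) x = ∑ i ∈ t, g i x := map_sum (evalSec x) g t

end Sections

/-! ### Vector fields as derivations -/
section VF
variable {EN : Type*} [NormedAddCommGroup EN] [NormedSpace ℝ EN]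
  {H : Type*} [TopologicalSpace H] {I : ModelWithCorners ℝ EN H}
  {N : Type*} [TopologicalSpace N] [ChartedSpace H N] [IsManifold I ∞ N]

/-- The derivative of a smooth function along a smooth vector field. -/
def dirDeriv (X : Cₛ^∞⟮I; EN, (TangentSpace I : N → Type _)⟯) (f : C^∞⟮I, N; ℝ⟯) :
    C^∞⟮I, N; ℝ⟯ :=
  ⟨fun x => mfderiv I 𝓘(ℝ, ℝ) f x (X x), by
    have h1 : ContMDiff I.tangent 𝓘(ℝ, ℝ).tangent ∞ (tangentMap I 𝓘(ℝ, ℝ) f) :=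
      f.contMDiff.contMDiff_tangentMap (by simp)
    have h2 := h1.comp X.contMDiff
    exact contMDiff_snd_tangentBundle_modelSpace ℝ 𝓘(ℝ, ℝ) |>.comp h2⟩

theorem dirDeriv_apply (X : Cₛ^∞⟮I; EN, (TangentSpace I : N → Type _)⟯) (f : C^∞⟮I, N; ℝ⟯)
    (x : N) : dirDeriv X f x = mfderiv I 𝓘(ℝ, ℝ) f x (X x) := rfl

/-- A smooth vector field, as a derivation of the algebra of smooth functions. -/
def vfDer (X : Cₛ^∞⟮I; EN, (TangentSpace I : N → Type _)⟯) :
    Derivation ℝ C^∞⟮I, N; ℝ⟯ C^∞⟮I, N; ℝ⟯ :=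
  Derivation.mk'
    { toFun := dirDeriv X
      map_add' := fun f g => by
        ext x
        have := mfderiv_add (f.mdifferentiableAt (x := x)) (g.mdifferentiableAt (x := x))
        simp only [dirDeriv_apply, ContMDiffMap.coe_add, Pi.add_apply]
        exact congr($this (X x))
      map_smul' := fun c f => by
        ext x
        have := const_smul_mfderiv (f.mdifferentiableAt (x := x)) c
        simp only [dirDeriv_apply, ContMDiffMap.coe_smul]
        exact congr($this (X x)) }
    (fun f g => by
      ext x
      have := ((f.mdifferentiableAt (x := x)).hasMFDerivAt.mul
        (g.mdifferentiableAt (x := x)).hasMFDerivAt).mfderiv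
      exact congr($this (X x)))

theorem vfDer_apply (X : Cₛ^∞⟮I; EN, (TangentSpace I : N → Type _)⟯) (f : C^∞⟮I, N; ℝ⟯)
    (x : N) : vfDer X f x = mfderiv I 𝓘(ℝ, ℝ) f x (X x) := rfl

end VF

/-! ### Local frames cut off to global sections -/
section Frames

variable {EN : Type*} [NormedAddCommGroup EN] [NormedSpace ℝ EN] [FiniteDimensional ℝ EN]
  {H : Type*} [TopologicalSpace H] {I : ModelWithCorners ℝ EN H}
  {N : Type*} [TopologicalSpace N] [ChartedSpace H N] [IsManifold I ∞ N] [T2Space N]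
  {F : Type*} [NormedAddCommGroup F] [NormedSpace ℝ F]
  {E : N → Type*} [TopologicalSpace (TotalSpace F E)] [∀ x, TopologicalSpace (E x)]
  [∀ x, AddCommGroup (E x)] [∀ x, Module ℝ (E x)] [FiberBundle F E] [VectorBundle ℝ F E]

theorem exists_cutoff (x₀ : N) {U : Set N} (hU : U ∈ 𝓝 x₀) :
    ∃ ψ : C^∞⟮I, N; ℝ⟯, (∀ᶠ x in 𝓝 x₀, ψ x = 1) ∧ tsupport ψ ⊆ U := by
  obtain ⟨f, -, hf⟩ := (SmoothBumpFunction.nhds_basis_tsupport (I := I) x₀).mem_iff.1 hU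
  exact ⟨⟨f, f.contMDiff⟩, f.eventuallyEq_one, hf⟩

variable (I F E) in
/-- A cut-off function at `x₀`, supported in the domain of the preferred trivialization at `x₀`. -/
def cutoff (x₀ : N) : C^∞⟮I, N; ℝ⟯ :=
  (exists_cutoff (I := I) x₀ ((trivializationAt F E x₀).open_baseSet.mem_nhds
    (mem_baseSet_trivializationAt F E x₀))).choose

theorem cutoff_eventually (x₀ : N) : ∀ᶠ x in 𝓝 x₀, cutoff I F E x₀ x = 1 :=
  (exists_cutoff (I := I) x₀ ((trivializationAt F E x₀).open_baseSet.mem_nhds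
    (mem_baseSet_trivializationAt F E x₀))).choose_spec.1

theorem cutoff_self (x₀ : N) : cutoff I F E x₀ x₀ = 1 := (cutoff_eventually x₀).self_of_nhds

theorem cutoff_tsupport (x₀ : N) :
    tsupport (cutoff I F E x₀) ⊆ (trivializationAt F E x₀).baseSet :=
  (exists_cutoff (I := I) x₀ ((trivializationAt F E x₀).open_baseSet.mem_nhds
    (mem_baseSet_trivializationAt F E x₀))).choose_spec.2

theorem cutoff_eq_zero {x₀ x : N} (hx : x ∉ (trivializationAt F E x₀).baseSet) :
    cutoff I F E x₀ x = 0 :=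
  image_eq_zero_of_notMem_tsupport fun h => hx (cutoff_tsupport x₀ h)

variable [ContMDiffVectorBundle ∞ F E I]

variable (I F E) in
/-- The section which is constant equal to `v` in the trivialization at `x₀`, near `x₀`. -/
def frameSec (x₀ : N) : F →ₗ[ℝ] Cₛ^∞⟮I; F, E⟯ where
  toFun v := ⟨fun x => cutoff I F E x₀ x • (trivializationAt F E x₀).symmL ℝ x v, by
    refine ContMDiffOn.smul_section_of_tsupport (u := (trivializationAt F E x₀).baseSet)
      (cutoff I F E x₀).contMDiff.contMDiffOn (trivializationAt F E x₀).open_baseSet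
      (cutoff_tsupport x₀) ?_
    rw [(trivializationAt F E x₀).contMDiffOn_section_baseSet_iff]
    refine (contMDiffOn_const (c := v)).congr fun y hy => ?_
    rw [Trivialization.symmL_apply, Trivialization.apply_mk_symm _ hy]
    exact hy⟩
  map_add' v w := by
    ext x
    simp only [map_add, smul_add]
    rfl
  map_smul' c v := by
    ext x
    simp only [map_smul]
    exact smul_comm _ _ _

theorem frameSec_apply (x₀ x : N) (v : F) : frameSec I F E x₀ v x =
    cutoff I F E x₀ x • (trivializationAt F E x₀).symmL ℝ x v := rfl

theorem frameSec_surj (x : N) (v : E x) :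
    frameSec I F E x ((trivializationAt F E x).continuousLinearMapAt ℝ x v) x = v := by
  rw [frameSec_apply, cutoff_self, one_smul,
    Trivialization.symmL_continuousLinearMapAt _ (mem_baseSet_trivializationAt F E x)]

variable [FiniteDimensional ℝ F]

variable (I F E) in
/-- A coordinate of a section in the trivialization at `x₀`, cut off to a global function. -/
def frameCoord (x₀ : N) (l : F →ₗ[ℝ] ℝ) (s : Cₛ^∞⟮I; F, E⟯) : C^∞⟮I, N; ℝ⟯ :=
  ⟨fun x => cutoff I F E x₀ x • l ((trivializationAt F E x₀).continuousLinearMapAt ℝ x (s x)), by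
    refine contMDiff_of_contMDiffOn_union_of_isOpen
      (s := (trivializationAt F E x₀).baseSet) (t := (tsupport (cutoff I F E x₀))ᶜ) ?_ ?_ ?_
      (trivializationAt F E x₀).open_baseSet (isOpen_compl_iff.mpr (isClosed_tsupport _))
    · refine (cutoff I F E x₀).contMDiff.contMDiffOn.smul ?_
      have h1 := ((trivializationAt F E x₀).contMDiffOn_section_baseSet_iff (IB := I)
        (n := ∞)).1 s.contMDiff.contMDiffOn
      have h2 : ContMDiff 𝓘(ℝ, F) 𝓘(ℝ, ℝ) ∞ l.toContinuousLinearMap :=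
        l.toContinuousLinearMap.contMDiff
      refine (h2.comp_contMDiffOn h1).congr fun y hy => ?_
      simp [Trivialization.coe_linearMapAt_of_mem _ hy]
    · refine (contMDiffOn_const (c := (0 : ℝ))).congr fun y hy => ?_
      rw [image_eq_zero_of_notMem_tsupport hy, zero_smul]
    · exact compl_subset_iff_union.mp (compl_subset_compl.mpr (cutoff_tsupport x₀))⟩

theorem frameCoord_apply (x₀ x : N) (l : F →ₗ[ℝ] ℝ) (s : Cₛ^∞⟮I; F, E⟯) :
    frameCoord I F E x₀ l s x =
      cutoff I F E x₀ x • l ((trivializationAt F E x₀).continuousLinearMapAt ℝ x (s x)) := rfl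

theorem frame_expand (x₀ : N) (s : Cₛ^∞⟮I; F, E⟯) :
    (cutoff I F E x₀ * cutoff I F E x₀) • s =
      ∑ i, frameCoord I F E x₀ ((Module.finBasis ℝ F).coord i) s •
        frameSec I F E x₀ (Module.finBasis ℝ F i) := by
  ext x
  rw [sec_sum_apply, fn_smul_apply]
  simp only [fn_smul_apply, frameCoord_apply, frameSec_apply]
  by_cases hx : x ∈ (trivializationAt F E x₀).baseSet
  · have h1 := Trivialization.symmL_continuousLinearMapAt (R := ℝ) _ hx (s x)
    have h2 := (Module.finBasis ℝ F).sum_repr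
      ((trivializationAt F E x₀).continuousLinearMapAt ℝ x (s x))
    conv_lhs => rw [← h1, ← h2, map_sum, Finset.smul_sum]
    refine Finset.sum_congr rfl fun i _ => ?_
    simp only [map_smul, ContMDiffMap.coe_mul, Pi.mul_apply, smul_smul, smul_eq_mul,
      Module.Basis.coord_apply]
    congr 1
    ring
  · simp [cutoff_eq_zero hx]

/-- A `C^∞(N)`-linear endomorphism of `Γ(E)` is given by its values in the fibres. -/
theorem tensorial_zero (φ : Module.End C^∞⟮I, N; ℝ⟯ Cₛ^∞⟮I; F, E⟯) (s : Cₛ^∞⟮I; F, E⟯) (x : N)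
    (hs : s x = 0) : φ s x = 0 := by
  have h := congrArg (fun u => φ u x) (frame_expand x s)
  simpa [cutoff_self, sec_sum_apply, frameCoord_apply, hs] using h

/-- The endomorphism of the fibre `E x` induced by a `C^∞(N)`-linear endomorphism of `Γ(E)`: it
maps `v` to the value at `x` of `φ s`, for a section `s` with `s x = v`. -/
def fibreEnd (φ : Module.End C^∞⟮I, N; ℝ⟯ Cₛ^∞⟮I; F, E⟯) (x : N) : E x →ₗ[ℝ] E x :=
  evalSec x ∘ₗ φ.restrictScalars ℝ ∘ₗ frameSec I F E x ∘ₗ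
    ((trivializationAt F E x).continuousLinearMapAt ℝ x).toLinearMap

theorem fibreEnd_apply (φ : Module.End C^∞⟮I, N; ℝ⟯ Cₛ^∞⟮I; F, E⟯) (x : N)
    (s : Cₛ^∞⟮I; F, E⟯) : fibreEnd φ x (s x) = φ s x := by
  have h : φ (frameSec I F E x ((trivializationAt F E x).continuousLinearMapAt ℝ x (s x)) - s) x
      = 0 := tensorial_zero φ _ x (by
    rw [ContMDiffSection.coe_sub, Pi.sub_apply, frameSec_surj, sub_self])
  rw [map_sub, ContMDiffSection.coe_sub, Pi.sub_apply, sub_eq_zero] at h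
  exact h

/-- Near `x₀`, the fibrewise trace in terms of a frame. -/
theorem trace_fibreEnd_eq (φ : Module.End C^∞⟮I, N; ℝ⟯ Cₛ^∞⟮I; F, E⟯) (x₀ x : N)
    (hx : x ∈ (trivializationAt F E x₀).baseSet) (h1 : cutoff I F E x₀ x = 1) :
    LinearMap.trace ℝ (E x) (fibreEnd φ x) =
      ∑ i, frameCoord I F E x₀ ((Module.finBasis ℝ F).coord i)
        (φ (frameSec I F E x₀ (Module.finBasis ℝ F i))) x := by
  rw [LinearMap.trace_eq_matrix_trace ℝ
    ((trivializationAt F E x₀).basisAt (Module.finBasis ℝ F) hx), Matrix.trace]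
  refine Finset.sum_congr rfl fun i _ => ?_
  rw [Matrix.diag_apply, LinearMap.toMatrix_apply, frameCoord_apply, h1, one_smul]
  have h2 : (trivializationAt F E x₀).basisAt (Module.finBasis ℝ F) hx i =
      frameSec I F E x₀ (Module.finBasis ℝ F i) x := by
    rw [frameSec_apply, h1, one_smul, Trivialization.symmL_apply]
    simp [Trivialization.basisAt]
    exact hx
  rw [h2, fibreEnd_apply]
  simp [Trivialization.basisAt, Trivialization.coe_linearMapAt_of_mem _ hx]

theorem contMDiff_trace (φ : Module.End C^∞⟮I, N; ℝ⟯ Cₛ^∞⟮I; F, E⟯) :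
    ContMDiff I 𝓘(ℝ, ℝ) ∞ fun x => LinearMap.trace ℝ (E x) (fibreEnd φ x) := by
  intro x₀
  have h : ContMDiff I 𝓘(ℝ, ℝ) ∞ (fun x =>
      ∑ i, frameCoord I F E x₀ ((Module.finBasis ℝ F).coord i)
        (φ (frameSec I F E x₀ (Module.finBasis ℝ F i))) x) :=
    contMDiff_finsetSum fun i _ => ContMDiffMap.contMDiff _
  refine ContMDiffAt.congr_of_eventuallyEq (h x₀) ?_
  filter_upwards [cutoff_eventually (I := I) (F := F) (E := E) x₀,
    (trivializationAt F E x₀).open_baseSet.mem_nhds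
      (mem_baseSet_trivializationAt F E x₀)] with x h1 hx
  exact trace_fibreEnd_eq φ x₀ x hx h1

/-- The fibrewise trace `Tr : Γ(End E) → C^∞(N)`. -/
def trEnd : Module.End C^∞⟮I, N; ℝ⟯ Cₛ^∞⟮I; F, E⟯ →ₗ[ℝ] C^∞⟮I, N; ℝ⟯ where
  toFun φ := ⟨fun x => LinearMap.trace ℝ (E x) (fibreEnd φ x), contMDiff_trace φ⟩
  map_add' φ χ := by
    ext x
    exact map_add (LinearMap.trace ℝ (E x)) (fibreEnd φ x) (fibreEnd χ x)
  map_smul' c φ := by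
    ext x
    exact map_smul (LinearMap.trace ℝ (E x)) c (fibreEnd φ x)

theorem trEnd_apply (φ : Module.End C^∞⟮I, N; ℝ⟯ Cₛ^∞⟮I; F, E⟯) (x : N) :
    trEnd φ x = LinearMap.trace ℝ (E x) (fibreEnd φ x) := rfl

end Frames

/-! ### `ℝ`-linear forms, the differential and cohomology

Here `L` is a real Lie algebra which acts on `C^∞(N)` by derivations through the anchor `ρ`. The
main example is `L = Γ(A)` for a Lie algebroid `A` over `N`. -/
section Forms

variable {EN : Type*} [NormedAddCommGroup EN] [NormedSpace ℝ EN]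
  {H : Type*} [TopologicalSpace H] {I : ModelWithCorners ℝ EN H}
  {N : Type*} [TopologicalSpace N] [ChartedSpace H N]
  {L : Type*} [LieRing L] [LieAlgebra ℝ L]
  (ρ : L →ₗ⁅ℝ⁆ Derivation ℝ C^∞⟮I, N; ℝ⟯ C^∞⟮I, N; ℝ⟯)

/-- The bracket part of the Koszul formula: the sum over `i < j` of
`(-1) ^ (i + j) • η (⁅a i, a j⁆, a 0, …, omit i, …, omit j, …)`. -/
def bracketSum : {n : ℕ} → (L [⋀^Fin n]→ₗ[ℝ] C^∞⟮I, N; ℝ⟯) → (Fin (n + 1) → L) → C^∞⟮I, N; ℝ⟯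
  | 0, _, _ => 0
  | n + 1, η, a => ∑ j : Fin (n + 2), ∑ i : Fin (n + 1),
      if i.castSucc < j then
        (-1 : ℝ) ^ ((i : ℕ) + (j : ℕ)) •
          η (Fin.cons ⁅a i.castSucc, a j⁆ (i.removeNth (j.removeNth a)))
      else 0

/-- The differential `d` on `ℝ`-linear alternating forms with values in `C^∞(N)`, given by the
Koszul formula
`dη (a 0, …, a n) = ∑ i, (-1) ^ i • ρ (a i) (η (a 0, …, omit i, …, a n)) +`
`∑ i < j, (-1) ^ (i + j) • η (⁅a i, a j⁆, a 0, …, omit i, …, omit j, …, a n)`. -/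
def extD (n : ℕ) : (L [⋀^Fin n]→ₗ[ℝ] C^∞⟮I, N; ℝ⟯) →ₗ[ℝ] ((Fin (n + 1) → L) → C^∞⟮I, N; ℝ⟯) where
  toFun η a := (∑ i : Fin (n + 1), (-1 : ℝ) ^ (i : ℕ) • ρ (a i) (η (i.removeNth a))) +
    bracketSum η a
  map_add' η θ := by
    funext a
    have h : bracketSum (η + θ) a = bracketSum η a + bracketSum θ a := by
      cases n with
      | zero => simp [bracketSum]
      | succ n =>
        simp only [bracketSum, ← Finset.sum_add_distrib]
        refine Finset.sum_congr rfl fun j _ => Finset.sum_congr rfl fun i _ => ?_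
        split_ifs <;> simp
    simp only [h, AlternatingMap.add_apply, map_add, smul_add, Finset.sum_add_distrib,
      Pi.add_apply]
    abel
  map_smul' c η := by
    funext a
    have h : bracketSum (c • η) a = c • bracketSum η a := by
      cases n with
      | zero => simp [bracketSum]
      | succ n =>
        simp only [bracketSum, Finset.smul_sum]
        refine Finset.sum_congr rfl fun j _ => Finset.sum_congr rfl fun i _ => ?_
        split_ifs
        · rw [AlternatingMap.smul_apply, smul_comm]
        · rw [smul_zero]
    simp only [h, AlternatingMap.smul_apply, Finset.smul_sum, RingHom.id_apply,
      Pi.smul_apply, smul_add]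
    congr 1
    refine Finset.sum_congr rfl fun i _ => ?_
    rw [Derivation.map_smul, smul_comm]

/-- The closed `ℝ`-linear `n`-forms. -/
def cocycles (n : ℕ) : Submodule ℝ (L [⋀^Fin n]→ₗ[ℝ] C^∞⟮I, N; ℝ⟯) := LinearMap.ker (extD ρ n)

/-- The exact `ℝ`-linear `n`-forms. -/
def boundaries : (n : ℕ) → Submodule ℝ (L [⋀^Fin n]→ₗ[ℝ] C^∞⟮I, N; ℝ⟯)
  | 0 => ⊥
  | n + 1 =>
    { carrier := {θ | ∃ η, ∀ a, θ a = extD ρ n η a}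
      add_mem' := by
        rintro θ θ' ⟨η, hη⟩ ⟨η', hη'⟩
        exact ⟨η + η', fun a => by simp [hη, hη']⟩
      zero_mem' := ⟨0, fun a => by simp⟩
      smul_mem' := by
        rintro c θ ⟨η, hη⟩
        exact ⟨c • η, fun a => by simp [hη]⟩ }

/-- The `ℝ`-cohomology in degree `n`: closed `ℝ`-linear `n`-forms modulo exact ones, i.e. the image
of the closed forms in the quotient of all forms by the exact ones. -/
abbrev Cohomology (n : ℕ) : Type _ := (cocycles ρ n).map (boundaries ρ n).mkQ

/-- The cohomology class of a closed `ℝ`-linear form. -/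
def cohomClass {n : ℕ} (θ : L [⋀^Fin n]→ₗ[ℝ] C^∞⟮I, N; ℝ⟯) (hθ : θ ∈ cocycles ρ n) :
    Cohomology ρ n :=
  ⟨(boundaries ρ n).mkQ θ, Submodule.mem_map_of_mem hθ⟩

/-- Two closed forms have the same class if and only if they differ by an exact form. -/
theorem cohomClass_eq_iff {n : ℕ} {θ θ' : L [⋀^Fin n]→ₗ[ℝ] C^∞⟮I, N; ℝ⟯}
    (hθ : θ ∈ cocycles ρ n) (hθ' : θ' ∈ cocycles ρ n) :
    cohomClass ρ θ hθ = cohomClass ρ θ' hθ' ↔ θ - θ' ∈ boundaries ρ n := by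
  rw [cohomClass, cohomClass, Subtype.mk.injEq, Submodule.mkQ_apply, Submodule.mkQ_apply,
    Submodule.Quotient.eq]

end Forms

/-! ### `ℝ`-linear connections, curvature and the Chern character forms -/
section Connections

variable {EN : Type*} [NormedAddCommGroup EN] [NormedSpace ℝ EN]
  {H : Type*} [TopologicalSpace H] {I : ModelWithCorners ℝ EN H}
  {N : Type*} [TopologicalSpace N] [ChartedSpace H N]
  {L : Type*} [LieRing L] [LieAlgebra ℝ L]
  (ρ : L →ₗ⁅ℝ⁆ Derivation ℝ C^∞⟮I, N; ℝ⟯ C^∞⟮I, N; ℝ⟯)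
  (F : Type*) [NormedAddCommGroup F] [NormedSpace ℝ F]
  (E : N → Type*) [TopologicalSpace (TotalSpace F E)] [∀ x, TopologicalSpace (E x)]
  [∀ x, AddCommGroup (E x)] [∀ x, Module ℝ (E x)] [FiberBundle F E] [VectorBundle ℝ F E]

variable {F E} in
/-- `ℓ` is a covariant differential operator on `Γ(E)` with symbol the vector field `X`. -/
def IsCDO (X : Derivation ℝ C^∞⟮I, N; ℝ⟯ C^∞⟮I, N; ℝ⟯) (ℓ : Module.End ℝ Cₛ^∞⟮I; F, E⟯) : Prop :=
  ∀ (f : C^∞⟮I, N; ℝ⟯) (s : Cₛ^∞⟮I; F, E⟯), ℓ (f • s) = f • ℓ s + X f • s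

/-- An `ℝ`-linear connection on `E`: an `ℝ`-linear map `∇` from `L` to the covariant differential
operators on `E`, such that the symbol of `∇ a` is the anchor of `a`. No `C^∞(N)`-linearity in `a`
and no locality is required. -/
structure RConn where
  /-- the operators `∇ a` -/
  op : L →ₗ[ℝ] Module.End ℝ Cₛ^∞⟮I; F, E⟯
  isCDO : ∀ a, IsCDO (ρ a) (op a)

variable {ρ F E}

namespace RConn

/-- The curvature `R a b = [∇ a, ∇ b] - ∇ ⁅a, b⁆`, as an element of
`Γ(End E) = End_{C^∞(N)} Γ(E)`. -/
def curv (D : RConn ρ F E) : L →ₗ[ℝ] L →ₗ[ℝ] Module.End C^∞⟮I, N; ℝ⟯ Cₛ^∞⟮I; F, E⟯ :=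
  LinearMap.mk₂ ℝ
    (fun a b =>
      { toFun := fun s => D.op a (D.op b s) - D.op b (D.op a s) - D.op ⁅a, b⁆ s
        map_add' := fun s t => by
          simp only [map_add]
          abel
        map_smul' := fun f s => by
          have h : ρ ⁅a, b⁆ f = ρ a (ρ b f) - ρ b (ρ a f) := by
            rw [LieHom.map_lie, Derivation.commutator_apply]
          simp only [RingHom.id_apply, D.isCDO _ _ _, map_add, h, sub_smul, smul_sub]
          abel })
    (fun a a' b => by
      ext1 s
      simp only [LinearMap.add_apply, LinearMap.coe_mk, AddHom.coe_mk, map_add, add_lie]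
      abel)
    (fun c a b => by
      ext1 s
      simp only [LinearMap.smul_apply, LinearMap.coe_mk, AddHom.coe_mk, map_smul, smul_lie,
        smul_sub])
    (fun a b b' => by
      ext1 s
      simp only [LinearMap.add_apply, LinearMap.coe_mk, AddHom.coe_mk, map_add, lie_add]
      abel)
    (fun c a b => by
      ext1 s
      simp only [LinearMap.smul_apply, LinearMap.coe_mk, AddHom.coe_mk, map_smul, lie_smul,
        smul_sub])

@[simp] theorem curv_apply (D : RConn ρ F E) (a b : L) (s : Cₛ^∞⟮I; F, E⟯) :
    D.curv a b s = D.op a (D.op b s) - D.op b (D.op a s) - D.op ⁅a, b⁆ s := rfl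

/-- A connection is flat if its curvature vanishes. -/
def IsFlat (D : RConn ρ F E) : Prop := D.curv = 0

theorem curvProd_update (D : RConn ρ F E) (p : ℕ) (a : Fin (2 * p) → L) (i : Fin (2 * p)) :
    ∃ (k₀ : Fin p) (T : L →ₗ[ℝ] Module.End C^∞⟮I, N; ℝ⟯ Cₛ^∞⟮I; F, E⟯), ∀ x : L,
      (fun k : Fin p => D.curv (Function.update a i x ⟨2 * k, by omega⟩)
        (Function.update a i x ⟨2 * k + 1, by omega⟩)) =
      Function.update (fun k : Fin p => D.curv (a ⟨2 * k, by omega⟩) (a ⟨2 * k + 1, by omega⟩))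
        k₀ (T x) := by
  rcases Nat.even_or_odd' (i : ℕ) with ⟨m, hm | hm⟩
  · refine ⟨⟨m, by omega⟩, D.curv.flip (a ⟨2 * m + 1, by omega⟩), fun x => ?_⟩
    funext k
    by_cases hk : k = ⟨m, by omega⟩
    · subst hk
      have h1 : (⟨2 * m, by omega⟩ : Fin (2 * p)) = i := Fin.ext hm.symm
      have h2 : (⟨2 * m + 1, by omega⟩ : Fin (2 * p)) ≠ i := fun h => by
        have := congrArg Fin.val h
        simp only at this
        omega
      simp [h1, Function.update_of_ne h2]
    · have h0 : (k : ℕ) ≠ m := fun h => hk (Fin.ext h)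
      have h1 : (⟨2 * k, by omega⟩ : Fin (2 * p)) ≠ i := fun h => by
        have := congrArg Fin.val h
        simp only at this
        omega
      have h2 : (⟨2 * k + 1, by omega⟩ : Fin (2 * p)) ≠ i := fun h => by
        have := congrArg Fin.val h
        simp only at this
        omega
      simp [Function.update_of_ne h1, Function.update_of_ne h2, Function.update_of_ne hk]
  · refine ⟨⟨m, by omega⟩, D.curv (a ⟨2 * m, by omega⟩), fun x => ?_⟩
    funext k
    by_cases hk : k = ⟨m, by omega⟩
    · subst hk
      have h1 : (⟨2 * m + 1, by omega⟩ : Fin (2 * p)) = i := Fin.ext hm.symm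
      have h2 : (⟨2 * m, by omega⟩ : Fin (2 * p)) ≠ i := fun h => by
        have := congrArg Fin.val h
        simp only at this
        omega
      simp [h1, Function.update_of_ne h2]
    · have h0 : (k : ℕ) ≠ m := fun h => hk (Fin.ext h)
      have h1 : (⟨2 * k, by omega⟩ : Fin (2 * p)) ≠ i := fun h => by
        have := congrArg Fin.val h
        simp only at this
        omega
      have h2 : (⟨2 * k + 1, by omega⟩ : Fin (2 * p)) ≠ i := fun h => by
        have := congrArg Fin.val h
        simp only at this
        omega
      simp [Function.update_of_ne h1, Function.update_of_ne h2, Function.update_of_ne hk]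

/-- The composition `R (a 0) (a 1) ∘ R (a 2) (a 3) ∘ ⋯ ∘ R (a (2p-2)) (a (2p-1))`. -/
def curvProd (D : RConn ρ F E) (p : ℕ) :
    MultilinearMap ℝ (fun _ : Fin (2 * p) => L) (Module.End C^∞⟮I, N; ℝ⟯ Cₛ^∞⟮I; F, E⟯) where
  toFun a := (List.ofFn fun k : Fin p =>
    D.curv (a ⟨2 * k, by omega⟩) (a ⟨2 * k + 1, by omega⟩)).prod
  map_update_add' := by
    intro hdec a i x y
    obtain rfl : hdec = instDecidableEqFin _ := Subsingleton.elim _ _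
    obtain ⟨k₀, T, h⟩ := D.curvProd_update p a i
    rw [h, h, h, map_add]
    exact (MultilinearMap.mkPiAlgebraFin ℝ p
      (Module.End C^∞⟮I, N; ℝ⟯ Cₛ^∞⟮I; F, E⟯)).map_update_add _ k₀ (T x) (T y)
  map_update_smul' := by
    intro hdec a i c x
    obtain rfl : hdec = instDecidableEqFin _ := Subsingleton.elim _ _
    obtain ⟨k₀, T, h⟩ := D.curvProd_update p a i
    rw [h, h, map_smul]
    exact (MultilinearMap.mkPiAlgebraFin ℝ p
      (Module.End C^∞⟮I, N; ℝ⟯ Cₛ^∞⟮I; F, E⟯)).map_update_smul _ k₀ c (T x)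

/-- The power `R ^ p`, an alternating `2p`-form with values in `Γ(End E)`:
`R ^ p (a 1, …, a (2p)) = 1 / 2 ^ p • ∑ τ, sgn τ • R (a τ1) (a τ2) ∘ ⋯ ∘ R (a τ(2p-1)) (a τ(2p))`. -/
def curvPow (D : RConn ρ F E) (p : ℕ) :
    L [⋀^Fin (2 * p)]→ₗ[ℝ] Module.End C^∞⟮I, N; ℝ⟯ Cₛ^∞⟮I; F, E⟯ :=
  ((1 / 2 ^ p : ℝ)) • MultilinearMap.alternatization (D.curvProd p)

variable [FiniteDimensional ℝ EN] [IsManifold I ∞ N] [T2Space N] [FiniteDimensional ℝ F]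
  [ContMDiffVectorBundle ∞ F E I]

/-- The Chern character form `ch p ∇ = Tr (R ^ p)`. -/
def ch (D : RConn ρ F E) (p : ℕ) : L [⋀^Fin (2 * p)]→ₗ[ℝ] C^∞⟮I, N; ℝ⟯ :=
  trEnd.compAlternatingMap (D.curvPow p)

end RConn

end Connections

/-! ### Lie algebroids -/
section Algebroid

variable {EM : Type*} [NormedAddCommGroup EM] [NormedSpace ℝ EM]
  {H : Type*} [TopologicalSpace H] (I : ModelWithCorners ℝ EM H)
  {M : Type*} [TopologicalSpace M] [ChartedSpace H M] [IsManifold I ∞ M]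
  (FA : Type*) [NormedAddCommGroup FA] [NormedSpace ℝ FA]
  (A : M → Type*) [TopologicalSpace (TotalSpace FA A)] [∀ x, TopologicalSpace (A x)]
  [∀ x, AddCommGroup (A x)] [∀ x, Module ℝ (A x)] [FiberBundle FA A] [VectorBundle ℝ FA A]

/-- A Lie algebroid structure on the vector bundle `A` over `M`: a real Lie bracket on `Γ(A)` and a
smooth vector bundle morphism `A → TM`, the anchor, such that the Leibniz rule
`⁅a, f • b⁆ = f • ⁅a, b⁆ + (anchor a)(f) • b` holds. -/
structure LieAlgebroid where
  /-- the Lie bracket on `Γ(A)` -/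
  bracket : Cₛ^∞⟮I; FA, A⟯ →ₗ[ℝ] Cₛ^∞⟮I; FA, A⟯ →ₗ[ℝ] Cₛ^∞⟮I; FA, A⟯
  bracket_self : ∀ a, bracket a a = 0
  jacobi : ∀ a b c, bracket a (bracket b c) = bracket (bracket a b) c + bracket b (bracket a c)
  /-- the anchor, fibre by fibre -/
  anchor : ∀ x : M, A x →ₗ[ℝ] TangentSpace I x
  contMDiff_anchor : ContMDiff (I.prod 𝓘(ℝ, FA)) I.tangent ∞
    fun v : TotalSpace FA A => (⟨v.1, anchor v.1 v.2⟩ : TangentBundle I M)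
  leibniz : ∀ (a b : Cₛ^∞⟮I; FA, A⟯) (f : C^∞⟮I, M; ℝ⟯) (x : M),
    bracket a (f • b) x =
      f x • bracket a b x + mvfderiv I f x (anchor x (a x)) • b x

variable {I FA A}

namespace LieAlgebroid

/-- The Lie algebra of smooth sections of a Lie algebroid. -/
def Sec (_ : LieAlgebroid I FA A) : Type _ := Cₛ^∞⟮I; FA, A⟯

variable (𝒜 : LieAlgebroid I FA A)

instance instAddCommGroupSec : AddCommGroup 𝒜.Sec :=
  inferInstanceAs (AddCommGroup Cₛ^∞⟮I; FA, A⟯)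

instance instModuleSec : Module ℝ 𝒜.Sec := inferInstanceAs (Module ℝ Cₛ^∞⟮I; FA, A⟯)

instance instLieRingSec : LieRing 𝒜.Sec where
  bracket a b := 𝒜.bracket a b
  add_lie a b c := LinearMap.map_add₂ 𝒜.bracket a b c
  lie_add a b c := map_add (𝒜.bracket a) b c
  lie_self a := 𝒜.bracket_self a
  leibniz_lie a b c := 𝒜.jacobi a b c

instance instLieAlgebraSec : LieAlgebra ℝ 𝒜.Sec where
  lie_smul c a b := map_smul (𝒜.bracket a) c b

/-- The map `Γ(A) → 𝔛(M)` induced by the anchor. -/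
def secAnchor : 𝒜.Sec →ₗ[ℝ] Cₛ^∞⟮I; EM, (TangentSpace I : M → Type _)⟯ where
  toFun a := ⟨fun x => 𝒜.anchor x (ContMDiffSection.toFun a x),
    𝒜.contMDiff_anchor.comp (ContMDiffSection.contMDiff_toFun a)⟩
  map_add' a b := by
    ext1 x
    exact map_add (𝒜.anchor x) _ _
  map_smul' c a := by
    ext1 x
    exact map_smul (𝒜.anchor x) _ _

theorem secAnchor_apply (a : Cₛ^∞⟮I; FA, A⟯) (x : M) :
    𝒜.secAnchor a x = 𝒜.anchor x (a x) := rfl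

theorem lie_smul_fn (a b : Cₛ^∞⟮I; FA, A⟯) (f : C^∞⟮I, M; ℝ⟯) :
    𝒜.bracket a (f • b) = f • 𝒜.bracket a b + vfDer (𝒜.secAnchor a) f • b := by
  ext1 x
  exact 𝒜.leibniz a b f x

variable [FiniteDimensional ℝ EM] [T2Space M] [ContMDiffVectorBundle ∞ FA A I]

/-- The anchor is a homomorphism of Lie algebras on sections. -/
theorem anchor_lie (a b : Cₛ^∞⟮I; FA, A⟯) :
    vfDer (𝒜.secAnchor (𝒜.bracket a b)) = ⁅vfDer (𝒜.secAnchor a), vfDer (𝒜.secAnchor b)⁆ := by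
  have key : ∀ (f : C^∞⟮I, M; ℝ⟯) (c : Cₛ^∞⟮I; FA, A⟯),
      (vfDer (𝒜.secAnchor (𝒜.bracket a b)) f -
        ⁅vfDer (𝒜.secAnchor a), vfDer (𝒜.secAnchor b)⁆ f) • c = 0 := by
    intro f c
    have h := 𝒜.jacobi a b (f • c)
    have h2 := 𝒜.jacobi a b c
    simp only [lie_smul_fn, map_add] at h
    rw [h2] at h
    rw [Derivation.commutator_apply, sub_smul, sub_smul]
    simp only [smul_add] at h
    rw [sub_eq_zero]
    have h3 := sub_eq_zero.2 h
    rw [← sub_eq_zero, ← neg_eq_zero, ← h3]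
    abel
  by_cases hA : Subsingleton FA
  · have hx : ∀ x, Subsingleton (A x) := fun x =>
      (VectorBundle.continuousLinearEquivAt ℝ FA A x).toEquiv.subsingleton
    have hs : Subsingleton Cₛ^∞⟮I; FA, A⟯ := ⟨fun s t => by
      ext1 x
      exact Subsingleton.elim _ _⟩
    have hz : ∀ u : Cₛ^∞⟮I; FA, A⟯, vfDer (𝒜.secAnchor u) = 0 := by
      intro u
      rw [Subsingleton.elim u 0]
      ext f x
      have : 𝒜.secAnchor (0 : Cₛ^∞⟮I; FA, A⟯) = 0 := map_zero 𝒜.secAnchor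
      rw [vfDer_apply, this]
      exact map_zero (mfderiv I 𝓘(ℝ, ℝ) f x)
    simp [hz]
  · obtain ⟨v, hv⟩ : ∃ v : FA, v ≠ 0 := by
      by_contra! hcon
      exact hA ⟨fun v w => (hcon v).trans (hcon w).symm⟩
    ext f x
    have h := congrArg (fun s => (trivializationAt FA A x).continuousLinearMapAt ℝ x (s x))
      (key f (frameSec I FA A x v))
    simp only [fn_smul_apply, frameSec_apply, cutoff_self, one_smul, map_smul,
      Trivialization.continuousLinearMapAt_symmL _ (mem_baseSet_trivializationAt FA A x),
      ContMDiffSection.coe_zero, Pi.zero_apply, map_zero] at h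
    exact sub_eq_zero.1 ((smul_eq_zero.1 h).resolve_right hv)

/-- The anchor, as a homomorphism of Lie algebras from `Γ(A)` to the derivations of `C^∞(M)`. -/
def rho : 𝒜.Sec →ₗ⁅ℝ⁆ Derivation ℝ C^∞⟮I, M; ℝ⟯ C^∞⟮I, M; ℝ⟯ where
  toFun a := vfDer (𝒜.secAnchor a)
  map_add' a b := by
    ext f x
    rw [map_add]
    exact map_add (mfderiv I 𝓘(ℝ, ℝ) f x) _ _
  map_smul' c a := by
    ext f x
    rw [map_smul]
    exact map_smul (mfderiv I 𝓘(ℝ, ℝ) f x) _ _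
  map_lie' := 𝒜.anchor_lie _ _

end LieAlgebroid

end Algebroid

/-! ### Metrics and adjoint connections -/
section Metric

variable {EN : Type*} [NormedAddCommGroup EN] [NormedSpace ℝ EN]
  {H : Type*} [TopologicalSpace H] {I : ModelWithCorners ℝ EN H}
  {N : Type*} [TopologicalSpace N] [ChartedSpace H N]
  {F : Type*} [NormedAddCommGroup F] [NormedSpace ℝ F]
  {E : N → Type*} [TopologicalSpace (TotalSpace F E)] [∀ x, TopologicalSpace (E x)]
  [∀ x, AddCommGroup (E x)] [∀ x, Module ℝ (E x)]
  [∀ x, IsTopologicalAddGroup (E x)] [∀ x, ContinuousConstSMul ℝ (E x)]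
  [FiberBundle F E] [VectorBundle ℝ F E]

/-- The smooth function `h(s, t)`, for a metric `h` on `E` and sections `s`, `t` of `E`. -/
def metricFn (h : ContMDiffRiemannianMetric I ∞ F E) (s t : Cₛ^∞⟮I; F, E⟯) : C^∞⟮I, N; ℝ⟯ :=
  ⟨fun x => h.inner x (s x) (t x), by
    intro x
    have : ContMDiffAt I (I.prod 𝓘(ℝ, ℝ)) ∞
        (fun y => TotalSpace.mk' ℝ (E := Bundle.Trivial N ℝ) y (h.inner y (s y) (t y))) x :=
      ContMDiffAt.clm_bundle_apply₂ (F₁ := F) (F₂ := F) (h.contMDiff x) (s.contMDiff x)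
        (t.contMDiff x)
    simp only [contMDiffAt_totalSpace] at this
    exact this.2⟩

theorem metricFn_apply (h : ContMDiffRiemannianMetric I ∞ F E) (s t : Cₛ^∞⟮I; F, E⟯) (x : N) :
    metricFn h s t x = h.inner x (s x) (t x) := rfl

theorem metricFn_add_left (h : ContMDiffRiemannianMetric I ∞ F E) (s s' t : Cₛ^∞⟮I; F, E⟯) :
    metricFn h (s + s') t = metricFn h s t + metricFn h s' t := by
  ext x
  simp [metricFn_apply]

theorem metricFn_smul_left (h : ContMDiffRiemannianMetric I ∞ F E) (f : C^∞⟮I, N; ℝ⟯)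
    (s t : Cₛ^∞⟮I; F, E⟯) : metricFn h (f • s) t = f * metricFn h s t := by
  ext x
  simp [metricFn_apply]

theorem metricFn_symm (h : ContMDiffRiemannianMetric I ∞ F E) (s t : Cₛ^∞⟮I; F, E⟯) :
    metricFn h s t = metricFn h t s := by
  ext x
  exact h.symm x _ _

theorem metricFn_add_right (h : ContMDiffRiemannianMetric I ∞ F E) (s t t' : Cₛ^∞⟮I; F, E⟯) :
    metricFn h s (t + t') = metricFn h s t + metricFn h s t' := by
  ext x
  simp [metricFn_apply]

theorem metricFn_smul_right (h : ContMDiffRiemannianMetric I ∞ F E) (f : C^∞⟮I, N; ℝ⟯)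
    (s t : Cₛ^∞⟮I; F, E⟯) : metricFn h s (f • t) = f * metricFn h s t := by
  ext x
  simp [metricFn_apply]

theorem metricFn_const_smul_right (h : ContMDiffRiemannianMetric I ∞ F E) (c : ℝ)
    (s t : Cₛ^∞⟮I; F, E⟯) : metricFn h s (c • t) = c • metricFn h s t := by
  ext x
  simp [metricFn_apply]

theorem metricFn_const_smul_left (h : ContMDiffRiemannianMetric I ∞ F E) (c : ℝ)
    (s t : Cₛ^∞⟮I; F, E⟯) : metricFn h (c • s) t = c • metricFn h s t := by
  ext x
  simp [metricFn_apply]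

theorem metricFn_sum_right (h : ContMDiffRiemannianMetric I ∞ F E) {ι : Type*} (T : Finset ι)
    (s : Cₛ^∞⟮I; F, E⟯) (g : ι → Cₛ^∞⟮I; F, E⟯) :
    metricFn h s (∑ i ∈ T, g i) = ∑ i ∈ T, metricFn h s (g i) :=
  map_sum (AddMonoidHom.mk' (fun t => metricFn h s t) (metricFn_add_right h s)) g T

variable [FiniteDimensional ℝ EN] [IsManifold I ∞ N] [T2Space N]
  [FiniteDimensional ℝ F] [ContMDiffVectorBundle ∞ F E I]

theorem metricFn_nondeg (h : ContMDiffRiemannianMetric I ∞ F E) {t t' : Cₛ^∞⟮I; F, E⟯}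
    (hs : ∀ s, metricFn h s t = metricFn h s t') : t = t' := by
  ext1 x
  by_contra hne
  have h1 := h.pos x (t x - t' x) (sub_ne_zero.2 hne)
  have h2 := congrArg (fun f : C^∞⟮I, N; ℝ⟯ => f x) (hs (t - t'))
  simp only [metricFn_apply, ContMDiffSection.coe_sub, Pi.sub_apply] at h2
  rw [map_sub, h2, sub_self] at h1
  exact lt_irrefl _ h1

theorem tensorial_zero_fn (α : Cₛ^∞⟮I; F, E⟯ →ₗ[C^∞⟮I, N; ℝ⟯] C^∞⟮I, N; ℝ⟯)
    (s : Cₛ^∞⟮I; F, E⟯) (x : N) (hs : s x = 0) : α s x = 0 := by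
  have h := congrArg (fun u => α u x) (frame_expand x s)
  have hev : ∀ (g : Fin (Module.finrank ℝ F) → C^∞⟮I, N; ℝ⟯), (∑ i, g i) x = ∑ i, g i x :=
    fun g => map_sum (ContMDiffMap.evalRingHom x) g Finset.univ
  simpa [cutoff_self, hev, frameCoord_apply, hs] using h

theorem exists_riesz_at (h : ContMDiffRiemannianMetric I ∞ F E)
    (α : Cₛ^∞⟮I; F, E⟯ →ₗ[C^∞⟮I, N; ℝ⟯] C^∞⟮I, N; ℝ⟯) (x : N) :
    ∃ w : E x, ∀ s : Cₛ^∞⟮I; F, E⟯, h.inner x (s x) w = α s x := by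
  have hfd : FiniteDimensional ℝ (E x) := VectorBundle.finiteDimensional ℝ F E x
  let B : E x →ₗ[ℝ] Module.Dual ℝ (E x) :=
    LinearMap.mk₂ ℝ (fun w v => h.inner x v w) (fun w w' v => map_add _ _ _)
      (fun c w v => map_smul _ _ _) (fun w v v' => by simp) (fun c w v => by simp)
  have hinj : Function.Injective B := by
    rw [← LinearMap.ker_eq_bot, LinearMap.ker_eq_bot']
    intro w hw
    by_contra hne
    have h1 := h.pos x w hne
    have h2 : B w w = 0 := by rw [hw]; rfl
    exact h1.ne' h2
  have hsurj : Function.Surjective B :=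
    (LinearMap.injective_iff_surjective_of_finrank_eq_finrank
      (Subspace.dual_finrank_eq (K := ℝ) (V := E x)).symm).1 hinj
  let l : Module.Dual ℝ (E x) :=
    { toFun := fun v => α (frameSec I F E x
        ((trivializationAt F E x).continuousLinearMapAt ℝ x v)) x
      map_add' := fun v v' => by simp
      map_smul' := fun c v => by
        rw [map_smul, map_smul, LinearMap.map_smul_of_tower]
        rfl }
  obtain ⟨w, hw⟩ := hsurj l
  refine ⟨w, fun s => ?_⟩
  have h1 : h.inner x (s x) w = l (s x) := congrArg (fun u => u (s x)) hw
  rw [h1]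
  have h2 := tensorial_zero_fn α
    (frameSec I F E x ((trivializationAt F E x).continuousLinearMapAt ℝ x (s x)) - s) x (by
      rw [ContMDiffSection.coe_sub, Pi.sub_apply, frameSec_surj, sub_self])
  rw [map_sub] at h2
  exact sub_eq_zero.1 h2

theorem frame_ext (h : ContMDiffRiemannianMetric I ∞ F E) (x₀ x : N)
    (hx : x ∈ (trivializationAt F E x₀).baseSet) (h1 : cutoff I F E x₀ x = 1) (v : E x)
    (hv : ∀ i, h.inner x (frameSec I F E x₀ (Module.finBasis ℝ F i) x) v = 0) : v = 0 := by
  by_contra hne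
  refine (h.pos x v hne).ne' ?_
  have h2 := ((trivializationAt F E x₀).basisAt (Module.finBasis ℝ F) hx).sum_repr v
  have h3 : ∀ i, (trivializationAt F E x₀).basisAt (Module.finBasis ℝ F) hx i =
      frameSec I F E x₀ (Module.finBasis ℝ F i) x := by
    intro i
    rw [frameSec_apply, h1, one_smul, Trivialization.symmL_apply]
    simp [Trivialization.basisAt]
    exact hx
  conv_lhs => enter [1]; rw [← h2]
  simp [map_sum, h3, hv]

theorem exists_riesz (h : ContMDiffRiemannianMetric I ∞ F E)
    (α : Cₛ^∞⟮I; F, E⟯ →ₗ[C^∞⟮I, N; ℝ⟯] C^∞⟮I, N; ℝ⟯) :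
    ∃ w : Cₛ^∞⟮I; F, E⟯, ∀ s, metricFn h s w = α s := by
  choose w hw using exists_riesz_at h α
  refine ⟨⟨w, fun x₀ => ?_⟩, fun s => ?_⟩
  swap
  · ext x
    exact hw x s
  let e : Fin (Module.finrank ℝ F) → Cₛ^∞⟮I; F, E⟯ :=
    fun i => frameSec I F E x₀ (Module.finBasis ℝ F i)
  let G : Matrix (Fin (Module.finrank ℝ F)) (Fin (Module.finrank ℝ F)) C^∞⟮I, N; ℝ⟯ :=
    Matrix.of fun i j => metricFn h (e i) (e j)
  let u : Cₛ^∞⟮I; F, E⟯ := ∑ i, (G.adjugate.mulVec fun j => α (e j)) i • e i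
  have hu : ∀ k, metricFn h (e k) u = G.det * α (e k) := by
    intro k
    have h1 : metricFn h (e k) u = (G.mulVec (G.adjugate.mulVec fun j => α (e j))) k := by
      simp only [u, metricFn_sum_right, metricFn_smul_right, Matrix.mulVec, dotProduct, G,
        Matrix.of_apply]
      exact Finset.sum_congr rfl fun i _ => mul_comm _ _
    rw [h1, Matrix.mulVec_mulVec, Matrix.mul_adjugate, Matrix.smul_mulVec, Matrix.one_mulVec]
    rfl
  have hnear : ∀ᶠ x in 𝓝 x₀, cutoff I F E x₀ x = 1 ∧ x ∈ (trivializationAt F E x₀).baseSet :=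
    (cutoff_eventually x₀).and ((trivializationAt F E x₀).open_baseSet.mem_nhds
      (mem_baseSet_trivializationAt F E x₀))
  have hdet₀ : G.det x₀ ≠ 0 := by
    intro h0
    have h1 : (G.map (ContMDiffMap.evalRingHom x₀)).det = 0 := by
      rw [← h0]
      exact (RingHom.map_det (ContMDiffMap.evalRingHom x₀) G).symm
    obtain ⟨v, hv0, hv⟩ := Matrix.exists_mulVec_eq_zero_iff.2 h1
    have h2 : (frameSec I F E x₀ (∑ k, v k • Module.finBasis ℝ F k)) x₀ = 0 := by
      refine frame_ext h x₀ x₀ (mem_baseSet_trivializationAt F E x₀) (cutoff_self x₀) _ fun i => ?_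
      have h3 := congrFun hv i
      rw [map_sum, sec_sum_apply, map_sum]
      refine Eq.trans ?_ h3
      rw [Matrix.mulVec, dotProduct]
      refine Finset.sum_congr rfl fun k _ => ?_
      rw [map_smul, ContMDiffSection.coe_smul, Pi.smul_apply, map_smul, smul_eq_mul, mul_comm]
      rfl
    have h4 := congrArg (fun z => (trivializationAt F E x₀).continuousLinearMapAt ℝ x₀ z) h2
    simp only [frameSec_apply, cutoff_self, one_smul, map_zero,
      Trivialization.continuousLinearMapAt_symmL _ (mem_baseSet_trivializationAt F E x₀)] at h4
    refine hv0 (funext fun k => ?_)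
    exact Fintype.linearIndependent_iff.1 (Module.finBasis ℝ F).linearIndependent v h4 k
  have hdet : ∀ᶠ x in 𝓝 x₀, G.det x ≠ 0 :=
    (G.det.contMDiff.continuous.continuousAt (x := x₀)).eventually_ne hdet₀
  have hsm : ContMDiffAt I (I.prod 𝓘(ℝ, F)) ∞
      (fun x => TotalSpace.mk' F x ((G.det x)⁻¹ • u x)) x₀ :=
    ContMDiffAt.smul_section (f := fun x => (G.det x)⁻¹) (s := fun x => u x)
      ((G.det.contMDiff x₀).inv₀ hdet₀) (u.contMDiff x₀)
  refine hsm.congr_of_eventuallyEq ?_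
  filter_upwards [hnear, hdet] with x hx hd
  congr 1
  rw [eq_inv_smul_iff₀ hd]
  refine sub_eq_zero.1 (frame_ext h x₀ x hx.2 hx.1 _ fun i => ?_)
  have h5 := congrArg (fun f : C^∞⟮I, N; ℝ⟯ => f x) (hu i)
  have h6 := hw x (e i)
  rw [map_sub, map_smul]
  change _ • h.inner x (e i x) (w x) - metricFn h (e i) u x = 0
  rw [h6]
  exact sub_eq_zero.2 h5.symm

/-- The section `w` with `h(s, w) = α s` for all sections `s`. -/
def riesz (h : ContMDiffRiemannianMetric I ∞ F E)
    (α : Cₛ^∞⟮I; F, E⟯ →ₗ[C^∞⟮I, N; ℝ⟯] C^∞⟮I, N; ℝ⟯) : Cₛ^∞⟮I; F, E⟯ := (exists_riesz h α).choose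

theorem metricFn_riesz (h : ContMDiffRiemannianMetric I ∞ F E)
    (α : Cₛ^∞⟮I; F, E⟯ →ₗ[C^∞⟮I, N; ℝ⟯] C^∞⟮I, N; ℝ⟯) (s : Cₛ^∞⟮I; F, E⟯) :
    metricFn h s (riesz h α) = α s := (exists_riesz h α).choose_spec s

variable {L : Type*} [LieRing L] [LieAlgebra ℝ L]
  {ρ : L →ₗ⁅ℝ⁆ Derivation ℝ C^∞⟮I, N; ℝ⟯ C^∞⟮I, N; ℝ⟯}

namespace RConn

/-- The functional `s ↦ ρ a (h(s, t)) - h(∇ a s, t)`, which is `C^∞(N)`-linear in `s`. -/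
def adjointFn (D : RConn ρ F E) (h : ContMDiffRiemannianMetric I ∞ F E) (a : L)
    (t : Cₛ^∞⟮I; F, E⟯) : Cₛ^∞⟮I; F, E⟯ →ₗ[C^∞⟮I, N; ℝ⟯] C^∞⟮I, N; ℝ⟯ where
  toFun s := ρ a (metricFn h s t) - metricFn h (D.op a s) t
  map_add' s s' := by
    simp only [metricFn_add_left, map_add]
    abel
  map_smul' f s := by
    simp only [D.isCDO _ _ _, metricFn_add_left, metricFn_smul_left, Derivation.leibniz,
      smul_eq_mul, RingHom.id_apply]
    ring

/-- The adjoint connection `∇^h` of `∇` with respect to the metric `h`. -/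
def adjoint (D : RConn ρ F E) (h : ContMDiffRiemannianMetric I ∞ F E) : RConn ρ F E where
  op := LinearMap.mk₂ ℝ (fun a t => riesz h (D.adjointFn h a t))
    (fun a b t => metricFn_nondeg h fun s => by
      simp only [metricFn_add_right, metricFn_riesz, adjointFn, LinearMap.coe_mk, AddHom.coe_mk,
        map_add, Derivation.add_apply, LinearMap.add_apply, metricFn_add_left]
      abel)
    (fun c a t => metricFn_nondeg h fun s => by
      simp only [metricFn_const_smul_right, metricFn_riesz, adjointFn, LinearMap.coe_mk,
        AddHom.coe_mk, map_smul, Derivation.smul_apply, LinearMap.smul_apply,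
        metricFn_const_smul_left, smul_sub])
    (fun a t t' => metricFn_nondeg h fun s => by
      simp only [metricFn_add_right, metricFn_riesz, adjointFn, LinearMap.coe_mk, AddHom.coe_mk,
        map_add]
      abel)
    (fun c a t => metricFn_nondeg h fun s => by
      simp only [metricFn_const_smul_right, metricFn_riesz, adjointFn, LinearMap.coe_mk,
        AddHom.coe_mk, Derivation.map_smul, smul_sub])
  isCDO a f t := metricFn_nondeg h fun s => by
    simp only [LinearMap.mk₂_apply, metricFn_add_right, metricFn_smul_right, metricFn_riesz,
      adjointFn, LinearMap.coe_mk, AddHom.coe_mk, Derivation.leibniz, smul_eq_mul]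
    ring

/-- The defining property of the adjoint connection:
`ρ a (h(s, t)) = h(∇ a s, t) + h(s, ∇^h a t)`. -/
theorem adjoint_spec (D : RConn ρ F E) (h : ContMDiffRiemannianMetric I ∞ F E) (a : L)
    (s t : Cₛ^∞⟮I; F, E⟯) :
    ρ a (metricFn h s t) = metricFn h (D.op a s) t + metricFn h s ((D.adjoint h).op a t) := by
  change _ = _ + metricFn h s (riesz h (D.adjointFn h a t))
  rw [metricFn_riesz]
  simp [adjointFn]

/-- `∇` is a metric connection with respect to `h`:
`ρ a (h(s, t)) = h(∇ a s, t) + h(s, ∇ a t)`. -/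
def IsMetricFor (D : RConn ρ F E) (h : ContMDiffRiemannianMetric I ∞ F E) : Prop :=
  ∀ (a : L) (s t : Cₛ^∞⟮I; F, E⟯),
    ρ a (metricFn h s t) = metricFn h (D.op a s) t + metricFn h s (D.op a t)

end RConn

end Metric

/-! ### The product with the real line -/
section Product

variable {EM : Type*} [NormedAddCommGroup EM] [NormedSpace ℝ EM]
  {H : Type*} [TopologicalSpace H] {I : ModelWithCorners ℝ EM H}
  {M : Type*} [TopologicalSpace M] [ChartedSpace H M]

/-- The restriction of a smooth function on `ℝ × M` to `{t} × M`. -/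
def sliceFn (t : ℝ) (f : C^∞⟮𝓘(ℝ, ℝ).prod I, ℝ × M; ℝ⟯) : C^∞⟮I, M; ℝ⟯ :=
  ⟨fun x => f (t, x), f.contMDiff.comp (contMDiff_const.prodMk contMDiff_id)⟩

@[simp] theorem sliceFn_apply (t : ℝ) (f : C^∞⟮𝓘(ℝ, ℝ).prod I, ℝ × M; ℝ⟯) (x : M) :
    sliceFn t f x = f (t, x) := rfl

/-- The function `t ↦ f (t, x)`. -/
theorem contDiff_line (f : C^∞⟮𝓘(ℝ, ℝ).prod I, ℝ × M; ℝ⟯) (x : M) :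
    ContDiff ℝ ∞ fun t => f (t, x) :=
  contMDiff_iff_contDiff.1 (f.contMDiff.comp (contMDiff_id.prodMk contMDiff_const))

variable [IsManifold I ∞ M]

/-- The vector field `c ∂_t + X` on `ℝ × M`. -/
def prodField (c : ℝ) (X : Cₛ^∞⟮I; EM, (TangentSpace I : M → Type _)⟯) :
    Cₛ^∞⟮𝓘(ℝ, ℝ).prod I; ℝ × EM, (TangentSpace (𝓘(ℝ, ℝ).prod I) : ℝ × M → Type _)⟯ :=
  ⟨fun p => ((c, X p.2) : ℝ × EM), by
    have : IsManifold I 1 M := IsManifold.of_le (n := ∞) (by simp)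
    have h1 : ContMDiff 𝓘(ℝ, ℝ) 𝓘(ℝ, ℝ).tangent ∞
        (fun t : ℝ => (⟨t, c⟩ : TangentBundle 𝓘(ℝ, ℝ) ℝ)) :=
      contMDiff_vectorSpace_iff_contDiff.2 contDiff_const
    have h2 : ContMDiff (𝓘(ℝ, ℝ).prod I) (𝓘(ℝ, ℝ).tangent.prod I.tangent) ∞
        (fun p : ℝ × M => ((⟨p.1, c⟩ : TangentBundle 𝓘(ℝ, ℝ) ℝ),
          (⟨p.2, X p.2⟩ : TangentBundle I M))) :=
      (h1.comp contMDiff_fst).prodMk (X.contMDiff.comp contMDiff_snd)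
    exact contMDiff_equivTangentBundleProd_symm.comp h2⟩

theorem vfDer_prodField (c : ℝ) (X : Cₛ^∞⟮I; EM, (TangentSpace I : M → Type _)⟯)
    (f : C^∞⟮𝓘(ℝ, ℝ).prod I, ℝ × M; ℝ⟯) (t : ℝ) (x : M) :
    vfDer (prodField c X) f (t, x) =
      c * deriv (fun s => f (s, x)) t + vfDer X (sliceFn t f) x := by
  have h := mfderiv_prod_eq_add_apply (I := 𝓘(ℝ, ℝ)) (I' := I) (I'' := 𝓘(ℝ, ℝ)) (p := (t, x))
    (v := prodField c X (t, x)) (f.mdifferentiableAt (x := (t, x)))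
  refine (vfDer_apply _ _ _).trans (h.trans ?_)
  congr 1
  rw [mfderiv_eq_fderiv]
  have h2 : (c : ℝ) = c • (1 : ℝ) := by simp
  change fderiv ℝ (fun s => f (s, x)) t c = _
  conv_lhs => rw [h2, map_smul, fderiv_apply_one_eq_deriv, smul_eq_mul]

theorem vfDer_prodField_one (f : C^∞⟮𝓘(ℝ, ℝ).prod I, ℝ × M; ℝ⟯) (t : ℝ) (x : M) :
    vfDer (prodField 1 (0 : Cₛ^∞⟮I; EM, (TangentSpace I : M → Type _)⟯)) f (t, x) =
      deriv (fun s => f (s, x)) t := by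
  rw [vfDer_prodField, one_mul, vfDer_apply]
  exact (congrArg _ (map_zero (mfderiv I 𝓘(ℝ, ℝ) (sliceFn t f) x))).trans (add_zero _)

theorem vfDer_prodField_zero (X : Cₛ^∞⟮I; EM, (TangentSpace I : M → Type _)⟯)
    (f : C^∞⟮𝓘(ℝ, ℝ).prod I, ℝ × M; ℝ⟯) (t : ℝ) (x : M) :
    vfDer (prodField 0 X) f (t, x) = vfDer X (sliceFn t f) x := by
  rw [vfDer_prodField, zero_mul, zero_add]

theorem vfDer_prodField_eq (c : ℝ) (X : Cₛ^∞⟮I; EM, (TangentSpace I : M → Type _)⟯) :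
    vfDer (prodField c X) =
      c • vfDer (prodField 1 (0 : Cₛ^∞⟮I; EM, (TangentSpace I : M → Type _)⟯)) +
        vfDer (prodField 0 X) := by
  ext f ⟨t, x⟩
  rw [vfDer_prodField, Derivation.add_apply, Derivation.smul_apply, ContMDiffMap.coe_add,
    Pi.add_apply, ContMDiffMap.coe_smul, Pi.smul_apply, vfDer_prodField_one,
    vfDer_prodField_zero, smul_eq_mul]

theorem sliceFn_vfDer (t : ℝ) (X : Cₛ^∞⟮I; EM, (TangentSpace I : M → Type _)⟯)
    (f : C^∞⟮𝓘(ℝ, ℝ).prod I, ℝ × M; ℝ⟯) :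
    sliceFn t (vfDer (prodField 0 X) f) = vfDer X (sliceFn t f) := by
  ext x
  exact vfDer_prodField_zero X f t x

variable [I.Boundaryless]

theorem vfDer_chart (X : Cₛ^∞⟮I; EM, (TangentSpace I : M → Type _)⟯) (g : C^∞⟮I, M; ℝ⟯) (x : M) :
    vfDer X g x = fderiv ℝ (g ∘ (extChartAt I x).symm) (extChartAt I x x) (X x : EM) := by
  rw [vfDer_apply, (g.mdifferentiableAt (x := x)).mfderiv]
  simp only [writtenInExtChartAt, I.range_eq_univ, fderivWithin_univ]
  rfl

theorem contDiffOn_chart (f : C^∞⟮𝓘(ℝ, ℝ).prod I, ℝ × M; ℝ⟯) (x : M) :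
    ContDiffOn ℝ ∞ (fun q : ℝ × EM => f (q.1, (extChartAt I x).symm q.2))
      (univ ×ˢ (extChartAt I x).target) := by
  rw [← contMDiffOn_iff_contDiffOn]
  refine f.contMDiff.comp_contMDiffOn (ContMDiffOn.prodMk ?_ ?_)
  · exact contDiff_fst.contMDiff.contMDiffOn
  · exact (contMDiffOn_extChartAt_symm x).comp contDiff_snd.contMDiff.contMDiffOn
      (fun q hq => hq.2)

theorem two_le_infty : (1 + 1 : WithTop ℕ∞) ≤ ∞ := by
  rw [one_add_one_eq_two]
  exact WithTop.coe_le_coe.2 (le_top : (2 : ℕ∞) ≤ ⊤)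

theorem dt_comm (X : Cₛ^∞⟮I; EM, (TangentSpace I : M → Type _)⟯)
    (f : C^∞⟮𝓘(ℝ, ℝ).prod I, ℝ × M; ℝ⟯) :
    vfDer (prodField 1 (0 : Cₛ^∞⟮I; EM, (TangentSpace I : M → Type _)⟯))
        (vfDer (prodField 0 X) f) =
      vfDer (prodField 0 X)
        (vfDer (prodField 1 (0 : Cₛ^∞⟮I; EM, (TangentSpace I : M → Type _)⟯)) f) := by
  ext ⟨t, x⟩
  rw [vfDer_prodField_one, vfDer_prodField_zero, vfDer_chart]
  set φ := extChartAt I x with hφ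
  set G : ℝ × EM → ℝ := fun q => f (q.1, φ.symm q.2) with hG
  set v : EM := X x with hv
  have hopen : IsOpen (univ ×ˢ φ.target : Set (ℝ × EM)) :=
    isOpen_univ.prod (isOpen_extChartAt_target x)
  have hmem : ∀ s, (s, φ x) ∈ (univ ×ˢ φ.target : Set (ℝ × EM)) :=
    fun s => ⟨mem_univ _, mem_extChartAt_target x⟩
  have hsm : ∀ q ∈ (univ ×ˢ φ.target : Set (ℝ × EM)), ContDiffAt ℝ ∞ G q :=
    fun q hq => (contDiffOn_chart f x).contDiffAt (hopen.mem_nhds hq)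
  have hd : ∀ q ∈ (univ ×ˢ φ.target : Set (ℝ × EM)), HasFDerivAt G (fderiv ℝ G q) q :=
    fun q hq => ((hsm q hq).differentiableAt (by simp)).hasFDerivAt
  have hdd : HasFDerivAt (fderiv ℝ G) (fderiv ℝ (fderiv ℝ G) (t, φ x)) (t, φ x) :=
    (((hsm _ (hmem t)).fderiv_right (m := 1) two_le_infty).differentiableAt (by simp)).hasFDerivAt
  have hl : ∀ s, vfDer (prodField 0 X) f (s, x) = fderiv ℝ G (s, φ x) ((0 : ℝ), v) := by
    intro s
    rw [vfDer_prodField_zero, vfDer_chart]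
    have h1 : HasFDerivAt (sliceFn s f ∘ φ.symm)
        ((fderiv ℝ G (s, φ x)).comp (ContinuousLinearMap.inr ℝ ℝ EM)) (φ x) :=
      (hd _ (hmem s)).comp (φ x) (hasFDerivAt_prodMk_right s (φ x))
    rw [h1.fderiv]
    rfl
  have hr : ∀ y ∈ φ.target,
      (sliceFn t (vfDer (prodField 1 (0 : Cₛ^∞⟮I; EM, (TangentSpace I : M → Type _)⟯)) f) ∘
        φ.symm) y = fderiv ℝ G (t, y) ((1 : ℝ), (0 : EM)) := by
    intro y hy
    rw [Function.comp_apply, sliceFn_apply, vfDer_prodField_one]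
    have h1 : HasFDerivAt (fun s => f (s, φ.symm y))
        ((fderiv ℝ G (t, y)).comp (ContinuousLinearMap.inl ℝ ℝ EM)) t :=
      HasFDerivAt.comp (g := G) (f := fun s => (s, y)) t (hd (t, y) ⟨mem_univ _, hy⟩)
        (hasFDerivAt_prodMk_left t y)
    rw [← fderiv_apply_one_eq_deriv, h1.fderiv]
    rfl
  have e1 : deriv (fun s => vfDer (prodField 0 X) f (s, x)) t =
      fderiv ℝ (fderiv ℝ G) (t, φ x) ((1 : ℝ), (0 : EM)) ((0 : ℝ), v) := by
    simp only [hl]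
    have h1 : HasFDerivAt (fun s => fderiv ℝ G (s, φ x))
        ((fderiv ℝ (fderiv ℝ G) (t, φ x)).comp (ContinuousLinearMap.inl ℝ ℝ EM)) t :=
      hdd.comp t (hasFDerivAt_prodMk_left t (φ x))
    have h2 := (h1.hasDerivAt).clm_apply (hasDerivAt_const t ((0 : ℝ), v))
    rw [h2.deriv]
    simp
  have e2 : fderiv ℝ (sliceFn t (vfDer (prodField 1
        (0 : Cₛ^∞⟮I; EM, (TangentSpace I : M → Type _)⟯)) f) ∘ φ.symm) (φ x) v =
      fderiv ℝ (fderiv ℝ G) (t, φ x) ((0 : ℝ), v) ((1 : ℝ), (0 : EM)) := by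
    have h0 : (sliceFn t (vfDer (prodField 1
        (0 : Cₛ^∞⟮I; EM, (TangentSpace I : M → Type _)⟯)) f) ∘ φ.symm) =ᶠ[𝓝 (φ x)]
        fun y => fderiv ℝ G (t, y) ((1 : ℝ), (0 : EM)) := by
      filter_upwards [(isOpen_extChartAt_target x).mem_nhds (mem_extChartAt_target x)] with y hy
      exact hr y hy
    rw [h0.fderiv_eq]
    have h1 : HasFDerivAt (fun y => fderiv ℝ G (t, y))
        ((fderiv ℝ (fderiv ℝ G) (t, φ x)).comp (ContinuousLinearMap.inr ℝ ℝ EM)) (φ x) :=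
      hdd.comp (φ x) (hasFDerivAt_prodMk_right t (φ x))
    have h2 := h1.clm_apply (hasFDerivAt_const ((1 : ℝ), (0 : EM)) (φ x))
    rw [h2.fderiv]
    simp
  rw [e1, e2]
  exact ((hsm _ (hmem t)).isSymmSndFDerivAt (by simpa [one_add_one_eq_two] using two_le_infty)).eq _ _

end Product

/-! ### The anchor of `ℝ ∂_t ⊕ Γ(A)` -/
section ProdAnchor

/-- The commutative Lie algebra `ℝ`. -/
instance instLieRingReal : LieRing ℝ := LieRing.ofAssociativeRing

instance instLieAlgebraReal : LieAlgebra ℝ ℝ := LieAlgebra.ofAssociativeAlgebra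

variable {EM : Type*} [NormedAddCommGroup EM] [NormedSpace ℝ EM] [FiniteDimensional ℝ EM]
  {H : Type*} [TopologicalSpace H] {I : ModelWithCorners ℝ EM H} [I.Boundaryless]
  {M : Type*} [TopologicalSpace M] [ChartedSpace H M] [IsManifold I ∞ M] [T2Space M]
  {FA : Type*} [NormedAddCommGroup FA] [NormedSpace ℝ FA]
  {A : M → Type*} [TopologicalSpace (TotalSpace FA A)] [∀ x, TopologicalSpace (A x)]
  [∀ x, AddCommGroup (A x)] [∀ x, Module ℝ (A x)] [FiberBundle FA A] [VectorBundle ℝ FA A]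
  [ContMDiffVectorBundle ∞ FA A I]

/-- The anchor of the Lie algebra `ℝ ∂_t ⊕ Γ(A)`, the sections of `Tℝ × A → ℝ × M` which are
constant in `t`: the pair `(c, a)` acts on `C^∞(ℝ × M)` as the vector field `c ∂_t + ρ a`. -/
def LieAlgebroid.rhoProd (𝒜 : LieAlgebroid I FA A) :
    ℝ × 𝒜.Sec →ₗ⁅ℝ⁆
      Derivation ℝ C^∞⟮𝓘(ℝ, ℝ).prod I, ℝ × M; ℝ⟯ C^∞⟮𝓘(ℝ, ℝ).prod I, ℝ × M; ℝ⟯ where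
  toFun u := vfDer (prodField u.1 (𝒜.secAnchor u.2))
  map_add' u w := by
    ext f ⟨t, x⟩
    have h := congrArg (fun d => d (sliceFn t f) x) (map_add 𝒜.rho u.2 w.2)
    simp only [Derivation.add_apply, ContMDiffMap.coe_add, Pi.add_apply] at h ⊢
    simp only [vfDer_prodField, Prod.fst_add, Prod.snd_add]
    have h' : vfDer (𝒜.secAnchor (u.2 + w.2)) (sliceFn t f) x =
      vfDer (𝒜.secAnchor u.2) (sliceFn t f) x + vfDer (𝒜.secAnchor w.2) (sliceFn t f) x := h
    rw [h']
    ring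
  map_smul' c u := by
    ext f ⟨t, x⟩
    have h := congrArg (fun d => d (sliceFn t f) x) (map_smul 𝒜.rho c u.2)
    simp only [Derivation.smul_apply, ContMDiffMap.coe_smul, Pi.smul_apply, RingHom.id_apply] at h ⊢
    simp only [vfDer_prodField, Prod.smul_fst, Prod.smul_snd, smul_eq_mul] at h ⊢
    have h' : vfDer (𝒜.secAnchor (c • u.2)) (sliceFn t f) x =
      c * vfDer (𝒜.secAnchor u.2) (sliceFn t f) x := h
    rw [h']
    ring
  map_lie' {u w} := by
    have h0 : ⁅u, w⁆.1 = 0 := by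
      change u.1 * w.1 - w.1 * u.1 = 0
      ring
    have h1 : ⁅u, w⁆.2 = ⁅u.2, w.2⁆ := rfl
    have h2 : vfDer (prodField 0 (𝒜.secAnchor ⁅u.2, w.2⁆)) =
        ⁅vfDer (prodField 0 (𝒜.secAnchor u.2)), vfDer (prodField 0 (𝒜.secAnchor w.2))⁆ := by
      ext f ⟨t, x⟩
      have h := congrArg (fun d => d (sliceFn t f) x) (LieHom.map_lie 𝒜.rho u.2 w.2)
      rw [Derivation.commutator_apply, vfDer_prodField_zero, ContMDiffMap.coe_sub, Pi.sub_apply,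
        vfDer_prodField_zero, vfDer_prodField_zero, sliceFn_vfDer, sliceFn_vfDer]
      exact h
    rw [h0, h1, h2, vfDer_prodField_eq u.1, vfDer_prodField_eq w.1]
    ext f q
    simp only [Derivation.commutator_apply, Derivation.add_apply, Derivation.smul_apply,
      Derivation.map_smul, map_add, dt_comm, ContMDiffMap.coe_sub, ContMDiffMap.coe_add,
      ContMDiffMap.coe_smul, Pi.add_apply, Pi.sub_apply, Pi.smul_apply, smul_eq_mul]
    ring

theorem LieAlgebroid.rhoProd_apply (𝒜 : LieAlgebroid I FA A) (u : ℝ × 𝒜.Sec)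
    (f : C^∞⟮𝓘(ℝ, ℝ).prod I, ℝ × M; ℝ⟯) (t : ℝ) (x : M) :
    𝒜.rhoProd u f (t, x) = u.1 * deriv (fun s => f (s, x)) t + 𝒜.rho u.2 (sliceFn t f) x :=
  vfDer_prodField _ _ f t x

end ProdAnchor

/-! ### The pull-back bundle on `ℝ × M`, and its sections -/
section PullBack

variable {EM : Type*} [NormedAddCommGroup EM] [NormedSpace ℝ EM]
  {H : Type*} [TopologicalSpace H] {I : ModelWithCorners ℝ EM H}
  {M : Type*} [TopologicalSpace M] [ChartedSpace H M]
  {F : Type*} [NormedAddCommGroup F] [NormedSpace ℝ F]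
  {E : M → Type*} [TopologicalSpace (TotalSpace F E)] [∀ x, TopologicalSpace (E x)]
  [∀ x, AddCommGroup (E x)] [∀ x, Module ℝ (E x)] [FiberBundle F E] [VectorBundle ℝ F E]

variable (I E) in
/-- The pull-back of the bundle `E` along the projection `ℝ × M → M`, with fibre `E x` over
`(t, x)`. -/
abbrev PullE : ℝ × M → Type _ :=
  (ContMDiffMap.snd : C^∞⟮𝓘(ℝ, ℝ).prod I, ℝ × M; I, M⟯) *ᵖ E

instance instAddCommGroupPullE (p : ℝ × M) : AddCommGroup (PullE I E p) :=
  inferInstanceAs (AddCommGroup (E p.2))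

/-- A section of the pull-back bundle, as a function with values in the fibres of `E`. -/
def pullVal (σ : Cₛ^∞⟮𝓘(ℝ, ℝ).prod I; F, PullE I E⟯) (t : ℝ) (x : M) : E x := σ (t, x)

theorem pullVal_add (σ τ : Cₛ^∞⟮𝓘(ℝ, ℝ).prod I; F, PullE I E⟯) (t : ℝ) (x : M) :
    pullVal (σ + τ) t x = pullVal σ t x + pullVal τ t x := rfl

theorem pullVal_smul (c : ℝ) (σ : Cₛ^∞⟮𝓘(ℝ, ℝ).prod I; F, PullE I E⟯) (t : ℝ) (x : M) :
    pullVal (c • σ) t x = c • pullVal σ t x := rfl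

theorem pullVal_fn_smul (f : C^∞⟮𝓘(ℝ, ℝ).prod I, ℝ × M; ℝ⟯)
    (σ : Cₛ^∞⟮𝓘(ℝ, ℝ).prod I; F, PullE I E⟯) (t : ℝ) (x : M) :
    pullVal (f • σ) t x = f (t, x) • pullVal σ t x := rfl

theorem pullVal_ext {σ τ : Cₛ^∞⟮𝓘(ℝ, ℝ).prod I; F, PullE I E⟯}
    (h : ∀ t x, pullVal σ t x = pullVal τ t x) : σ = τ := by
  ext1 ⟨t, x⟩
  exact h t x

theorem pull_contMDiffAt_iff {s : ∀ p : ℝ × M, PullE I E p} (p₀ : ℝ × M) :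
    ContMDiffAt (𝓘(ℝ, ℝ).prod I) ((𝓘(ℝ, ℝ).prod I).prod 𝓘(ℝ, F)) ∞
      (fun p => TotalSpace.mk' F p (s p)) p₀ ↔
    ContMDiffAt (𝓘(ℝ, ℝ).prod I) 𝓘(ℝ, F) ∞
      (fun p : ℝ × M => (trivializationAt F E p₀.2 (TotalSpace.mk (F := F) (E := E) p.2 (s p))).2) p₀ :=
  contMDiffAt_section p₀

/-- The restriction `σ_t` of a section `σ` of the pull-back bundle to `{t} × M`. -/
def slice (t : ℝ) (σ : Cₛ^∞⟮𝓘(ℝ, ℝ).prod I; F, PullE I E⟯) : Cₛ^∞⟮I; F, E⟯ :=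
  ⟨fun x => pullVal σ t x, fun x₀ => by
    rw [contMDiffAt_section]
    have h := (pull_contMDiffAt_iff (t, x₀)).1 (σ.contMDiff (t, x₀))
    exact ContMDiffAt.comp (f := fun x => (t, x)) x₀ h
      (contMDiff_const.prodMk contMDiff_id).contMDiffAt⟩

theorem slice_apply (t : ℝ) (σ : Cₛ^∞⟮𝓘(ℝ, ℝ).prod I; F, PullE I E⟯) (x : M) :
    slice t σ x = pullVal σ t x := rfl

theorem slice_add (t : ℝ) (σ τ : Cₛ^∞⟮𝓘(ℝ, ℝ).prod I; F, PullE I E⟯) :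
    slice t (σ + τ) = slice t σ + slice t τ := rfl

theorem slice_smul (t c : ℝ) (σ : Cₛ^∞⟮𝓘(ℝ, ℝ).prod I; F, PullE I E⟯) :
    slice t (c • σ) = c • slice t σ := rfl

theorem slice_fn_smul (t : ℝ) (f : C^∞⟮𝓘(ℝ, ℝ).prod I, ℝ × M; ℝ⟯)
    (σ : Cₛ^∞⟮𝓘(ℝ, ℝ).prod I; F, PullE I E⟯) :
    slice t (f • σ) = sliceFn t f • slice t σ := rfl

/-- The section `(t, x) ↦ s x` of the pull-back bundle. -/
def pullSec (s : Cₛ^∞⟮I; F, E⟯) : Cₛ^∞⟮𝓘(ℝ, ℝ).prod I; F, PullE I E⟯ :=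
  ⟨fun p => s p.2, fun p₀ => by
    refine (pull_contMDiffAt_iff (I := I) (F := F) (E := E) p₀).2 ?_
    have h := (contMDiffAt_section p₀.2).1 (s.contMDiff p₀.2)
    exact ContMDiffAt.comp (f := fun p : ℝ × M => p.2) p₀ h contMDiff_snd.contMDiffAt⟩

theorem pullVal_pullSec (s : Cₛ^∞⟮I; F, E⟯) (t : ℝ) (x : M) : pullVal (pullSec s) t x = s x := rfl

variable [FiniteDimensional ℝ EM] [IsManifold I ∞ M] [T2Space M] [FiniteDimensional ℝ F]
  [ContMDiffVectorBundle ∞ F E I]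

/-- The coordinates of the sections `σ_t` in the frame at `x₀`, as a function on `ℝ × M`. -/
def famCoord (x₀ : M) (l : F →ₗ[ℝ] ℝ) (σ : Cₛ^∞⟮𝓘(ℝ, ℝ).prod I; F, PullE I E⟯) :
    C^∞⟮𝓘(ℝ, ℝ).prod I, ℝ × M; ℝ⟯ :=
  ⟨fun p => frameCoord I F E x₀ l (slice p.1 σ) p.2, by
    refine contMDiff_of_contMDiffOn_union_of_isOpen
      (s := (trivializationAt F (PullE I E) ((0 : ℝ), x₀)).baseSet)
      (t := Prod.snd ⁻¹' (tsupport (cutoff I F E x₀))ᶜ) ?_ ?_ ?_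
      (trivializationAt F (PullE I E) ((0 : ℝ), x₀)).open_baseSet
      ((isOpen_compl_iff.mpr (isClosed_tsupport _)).preimage continuous_snd)
    · refine ((cutoff I F E x₀).contMDiff.comp contMDiff_snd).contMDiffOn.smul ?_
      have h1 := ((trivializationAt F (PullE I E) ((0 : ℝ), x₀)).contMDiffOn_section_baseSet_iff
        (IB := 𝓘(ℝ, ℝ).prod I) (n := ∞)).1 σ.contMDiff.contMDiffOn
      have h2 : ContMDiff 𝓘(ℝ, F) 𝓘(ℝ, ℝ) ∞ l.toContinuousLinearMap :=
        l.toContinuousLinearMap.contMDiff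
      refine (h2.comp_contMDiffOn h1).congr fun y hy => ?_
      have hy' : y.2 ∈ (trivializationAt F E x₀).baseSet := hy
      simp only [Trivialization.continuousLinearMapAt_apply,
        Trivialization.coe_linearMapAt_of_mem _ hy', Function.comp_apply,
        LinearMap.coe_toContinuousLinearMap']
      rfl
    · refine (contMDiffOn_const (c := (0 : ℝ))).congr fun y hy => ?_
      rw [frameCoord_apply, image_eq_zero_of_notMem_tsupport hy, zero_smul]
    · refine eq_univ_of_forall fun p => ?_
      by_cases hp : p.2 ∈ tsupport (cutoff I F E x₀)
      · exact Or.inl (cutoff_tsupport x₀ hp)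
      · exact Or.inr hp⟩

theorem famCoord_apply (x₀ : M) (l : F →ₗ[ℝ] ℝ) (σ : Cₛ^∞⟮𝓘(ℝ, ℝ).prod I; F, PullE I E⟯)
    (t : ℝ) (x : M) : famCoord x₀ l σ (t, x) = frameCoord I F E x₀ l (slice t σ) x := rfl

theorem sliceFn_famCoord (x₀ : M) (l : F →ₗ[ℝ] ℝ) (σ : Cₛ^∞⟮𝓘(ℝ, ℝ).prod I; F, PullE I E⟯)
    (t : ℝ) : sliceFn t (famCoord x₀ l σ) = frameCoord I F E x₀ l (slice t σ) := rfl

theorem fam_expand (x₀ x : M) (hx : cutoff I F E x₀ x = 1)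
    (σ : Cₛ^∞⟮𝓘(ℝ, ℝ).prod I; F, PullE I E⟯) (t : ℝ) :
    pullVal σ t x = ∑ i, famCoord x₀ ((Module.finBasis ℝ F).coord i) σ (t, x) •
      frameSec I F E x₀ (Module.finBasis ℝ F i) x := by
  have h := congrArg (fun s => s x) (frame_expand x₀ (slice t σ))
  simp only [fn_smul_apply, sec_sum_apply, ContMDiffMap.coe_mul, Pi.mul_apply, hx, mul_one,
    one_smul, slice_apply] at h
  exact h

/-! #### Applying a covariant differential operator slice by slice -/

theorem vfDer_eq_zero_of_eventually (X : Cₛ^∞⟮I; EM, (TangentSpace I : M → Type _)⟯)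
    (f : C^∞⟮I, M; ℝ⟯) (c : ℝ) (x : M) (h : ∀ᶠ y in 𝓝 x, f y = c) : vfDer X f x = 0 := by
  have h1 : (f : M → ℝ) =ᶠ[𝓝 x] fun _ => c := h
  rw [vfDer_apply, h1.mfderiv_eq, mfderiv_const]
  rfl

theorem cdo_expand (X : Cₛ^∞⟮I; EM, (TangentSpace I : M → Type _)⟯)
    (ℓ : Module.End ℝ Cₛ^∞⟮I; F, E⟯) (hℓ : IsCDO (vfDer X) ℓ) (x₀ x : M)
    (hx : ∀ᶠ y in 𝓝 x, cutoff I F E x₀ y = 1)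
    (σ : Cₛ^∞⟮𝓘(ℝ, ℝ).prod I; F, PullE I E⟯) (t : ℝ) :
    ℓ (slice t σ) x = pullVal (∑ i,
      (famCoord x₀ ((Module.finBasis ℝ F).coord i) σ •
        pullSec (ℓ (frameSec I F E x₀ (Module.finBasis ℝ F i))) +
      vfDer (prodField 0 X) (famCoord x₀ ((Module.finBasis ℝ F).coord i) σ) •
        pullSec (frameSec I F E x₀ (Module.finBasis ℝ F i)))) t x := by
  have h := congrArg (fun s => ℓ s x) (frame_expand x₀ (slice t σ))
  have h0 : vfDer X (cutoff I F E x₀ * cutoff I F E x₀) x = 0 :=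
    vfDer_eq_zero_of_eventually X _ 1 x (by
      filter_upwards [hx] with y hy
      simp [hy])
  have h1 : pullVal (∑ i,
      (famCoord x₀ ((Module.finBasis ℝ F).coord i) σ •
        pullSec (ℓ (frameSec I F E x₀ (Module.finBasis ℝ F i))) +
      vfDer (prodField 0 X) (famCoord x₀ ((Module.finBasis ℝ F).coord i) σ) •
        pullSec (frameSec I F E x₀ (Module.finBasis ℝ F i)))) t x = ∑ i,
      (famCoord x₀ ((Module.finBasis ℝ F).coord i) σ (t, x) •
        ℓ (frameSec I F E x₀ (Module.finBasis ℝ F i)) x +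
      vfDer (prodField 0 X) (famCoord x₀ ((Module.finBasis ℝ F).coord i) σ) (t, x) •
        frameSec I F E x₀ (Module.finBasis ℝ F i) x) :=
    sec_sum_apply Finset.univ _ (t, x)
  rw [h1]
  simp only [map_sum, hℓ _ _, sec_sum_apply, ContMDiffSection.coe_add, Pi.add_apply,
    fn_smul_apply, h0, zero_smul, add_zero, ContMDiffMap.coe_mul, Pi.mul_apply,
    hx.self_of_nhds, mul_one, one_smul] at h
  rw [h]
  simp only [vfDer_prodField_zero, sliceFn_famCoord, famCoord_apply]

/-- The operator `(ℓ σ)(t, x) = (ℓ σ_t)(x)` on sections of the pull-back bundle, for a covariant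
differential operator `ℓ` on `E`. -/
def liftOp (X : Cₛ^∞⟮I; EM, (TangentSpace I : M → Type _)⟯)
    (ℓ : Module.End ℝ Cₛ^∞⟮I; F, E⟯) (hℓ : IsCDO (vfDer X) ℓ) :
    Module.End ℝ Cₛ^∞⟮𝓘(ℝ, ℝ).prod I; F, PullE I E⟯ where
  toFun σ := ⟨fun p => ℓ (slice p.1 σ) p.2, fun p₀ => by
    refine ((∑ i, (famCoord p₀.2 ((Module.finBasis ℝ F).coord i) σ •
        pullSec (ℓ (frameSec I F E p₀.2 (Module.finBasis ℝ F i))) +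
      vfDer (prodField 0 X) (famCoord p₀.2 ((Module.finBasis ℝ F).coord i) σ) •
        pullSec (frameSec I F E p₀.2 (Module.finBasis ℝ F i))) :
        Cₛ^∞⟮𝓘(ℝ, ℝ).prod I; F, PullE I E⟯).contMDiff p₀).congr_of_eventuallyEq ?_
    have hev := (continuous_snd.tendsto p₀).eventually
      (eventually_eventually_nhds.2 (cutoff_eventually (I := I) (F := F) (E := E) p₀.2))
    filter_upwards [hev] with p hp
    congr 1
    exact cdo_expand X ℓ hℓ p₀.2 p.2 hp σ p.1⟩
  map_add' σ τ := pullVal_ext fun t x => by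
    change ℓ (slice t (σ + τ)) x = ℓ (slice t σ) x + ℓ (slice t τ) x
    rw [slice_add, map_add]
    rfl
  map_smul' c σ := pullVal_ext fun t x => by
    change ℓ (slice t (c • σ)) x = c • ℓ (slice t σ) x
    rw [slice_smul, map_smul]
    rfl

theorem pullVal_liftOp (X : Cₛ^∞⟮I; EM, (TangentSpace I : M → Type _)⟯)
    (ℓ : Module.End ℝ Cₛ^∞⟮I; F, E⟯) (hℓ : IsCDO (vfDer X) ℓ)
    (σ : Cₛ^∞⟮𝓘(ℝ, ℝ).prod I; F, PullE I E⟯) (t : ℝ) (x : M) :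
    pullVal (liftOp X ℓ hℓ σ) t x = ℓ (slice t σ) x := rfl

/-! #### The derivative in the direction of `t` -/

theorem hasDerivAt_fam (x₀ x : M) (hx : cutoff I F E x₀ x = 1)
    (σ : Cₛ^∞⟮𝓘(ℝ, ℝ).prod I; F, PullE I E⟯) (t : ℝ) :
    HasDerivAt (fun s => VectorBundle.continuousLinearEquivAt ℝ F E x (pullVal σ s x))
      (VectorBundle.continuousLinearEquivAt ℝ F E x (pullVal (∑ i,
        vfDer (prodField 1 (0 : Cₛ^∞⟮I; EM, (TangentSpace I : M → Type _)⟯))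
          (famCoord x₀ ((Module.finBasis ℝ F).coord i) σ) •
            pullSec (frameSec I F E x₀ (Module.finBasis ℝ F i))) t x)) t := by
  have h1 : pullVal (∑ i,
        vfDer (prodField 1 (0 : Cₛ^∞⟮I; EM, (TangentSpace I : M → Type _)⟯))
          (famCoord x₀ ((Module.finBasis ℝ F).coord i) σ) •
            pullSec (frameSec I F E x₀ (Module.finBasis ℝ F i))) t x =
      ∑ i, vfDer (prodField 1 (0 : Cₛ^∞⟮I; EM, (TangentSpace I : M → Type _)⟯))
          (famCoord x₀ ((Module.finBasis ℝ F).coord i) σ) (t, x) •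
            frameSec I F E x₀ (Module.finBasis ℝ F i) x :=
    sec_sum_apply Finset.univ _ (t, x)
  rw [h1]
  simp only [fam_expand x₀ x hx, map_sum, map_smul, vfDer_prodField_one]
  refine HasDerivAt.fun_sum fun i _ => ?_
  exact (((contDiff_line (famCoord x₀ ((Module.finBasis ℝ F).coord i) σ) x).differentiable
    (by simp) t).hasDerivAt).smul_const _

/-- The derivative `∂_t σ` of a section of the pull-back bundle: at `(t, x)`, the derivative at `t`
of the curve `s ↦ σ(s, x)` in the vector space `E x`, which is identified with the model fibre. -/
def dtSec : Module.End ℝ Cₛ^∞⟮𝓘(ℝ, ℝ).prod I; F, PullE I E⟯ where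
  toFun σ := ⟨fun p => (VectorBundle.continuousLinearEquivAt ℝ F E p.2).symm
      (deriv (fun s => VectorBundle.continuousLinearEquivAt ℝ F E p.2 (pullVal σ s p.2)) p.1),
    fun p₀ => by
      refine ((∑ i, vfDer (prodField 1 (0 : Cₛ^∞⟮I; EM, (TangentSpace I : M → Type _)⟯))
          (famCoord p₀.2 ((Module.finBasis ℝ F).coord i) σ) •
            pullSec (frameSec I F E p₀.2 (Module.finBasis ℝ F i)) :
        Cₛ^∞⟮𝓘(ℝ, ℝ).prod I; F, PullE I E⟯).contMDiff p₀).congr_of_eventuallyEq ?_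
      have hev := (continuous_snd.tendsto p₀).eventually
        (cutoff_eventually (I := I) (F := F) (E := E) p₀.2)
      filter_upwards [hev] with p hp
      congr 1
      rw [(hasDerivAt_fam p₀.2 p.2 hp σ p.1).deriv, ContinuousLinearEquiv.symm_apply_apply]
      rfl⟩
  map_add' σ τ := pullVal_ext fun t x => by
    have h1 := (hasDerivAt_fam x x (cutoff_self x) σ t).differentiableAt.hasDerivAt
    have h2 := (hasDerivAt_fam x x (cutoff_self x) τ t).differentiableAt.hasDerivAt
    change (VectorBundle.continuousLinearEquivAt ℝ F E x).symm _ =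
      (VectorBundle.continuousLinearEquivAt ℝ F E x).symm _ +
        (VectorBundle.continuousLinearEquivAt ℝ F E x).symm _
    simp only [pullVal_add, map_add]
    rw [(h1.fun_add h2).deriv, map_add]
  map_smul' c σ := pullVal_ext fun t x => by
    have h1 := (hasDerivAt_fam x x (cutoff_self x) σ t).differentiableAt.hasDerivAt
    change (VectorBundle.continuousLinearEquivAt ℝ F E x).symm _ =
      c • (VectorBundle.continuousLinearEquivAt ℝ F E x).symm _
    simp only [pullVal_smul, map_smul]
    rw [(h1.fun_const_smul c).deriv, map_smul]

theorem pullVal_dtSec (σ : Cₛ^∞⟮𝓘(ℝ, ℝ).prod I; F, PullE I E⟯) (t : ℝ) (x : M) :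
    pullVal (dtSec σ) t x = (VectorBundle.continuousLinearEquivAt ℝ F E x).symm
      (deriv (fun s => VectorBundle.continuousLinearEquivAt ℝ F E x (pullVal σ s x)) t) := rfl

theorem dtSec_smul (f : C^∞⟮𝓘(ℝ, ℝ).prod I, ℝ × M; ℝ⟯)
    (σ : Cₛ^∞⟮𝓘(ℝ, ℝ).prod I; F, PullE I E⟯) (t : ℝ) (x : M) :
    pullVal (dtSec (f • σ)) t x =
      f (t, x) • pullVal (dtSec σ) t x + deriv (fun s => f (s, x)) t • pullVal σ t x := by
  have h1 := (hasDerivAt_fam x x (cutoff_self x) σ t).differentiableAt.hasDerivAt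
  have h2 := ((contDiff_line f x).differentiable (by simp) t).hasDerivAt
  simp only [pullVal_dtSec, pullVal_fn_smul, map_smul]
  rw [(h2.fun_smul h1).deriv, map_add, map_smul, map_smul,
    ContinuousLinearEquiv.symm_apply_apply]

theorem dtSec_pullSec (s : Cₛ^∞⟮I; F, E⟯) :
    dtSec (pullSec s) = (0 : Cₛ^∞⟮𝓘(ℝ, ℝ).prod I; F, PullE I E⟯) :=
  pullVal_ext fun t x => by
    rw [pullVal_dtSec]
    simp only [pullVal_pullSec, deriv_const, map_zero]
    rfl

end PullBack

/-! ### Integration over the interval `[0, 1]` -/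
section Integration

variable {EM : Type*} [NormedAddCommGroup EM] [NormedSpace ℝ EM]
  {H : Type*} [TopologicalSpace H] {I : ModelWithCorners ℝ EM H} [I.Boundaryless]
  {M : Type*} [TopologicalSpace M] [ChartedSpace H M]

theorem contDiffOn_integral {V : Set EM} (hV : IsOpen V) {G : ℝ × EM → ℝ}
    (hG : ContDiffOn ℝ ∞ G (univ ×ˢ V)) :
    ContDiffOn ℝ ∞ (fun y => ∫ t in (0 : ℝ)..1, G (t, y)) V := by
  let χ : ContDiffBump (0 : ℝ) := ⟨2, 3, by norm_num, by norm_num⟩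
  let g : EM → ℝ → ℝ := fun y s => χ s * G (-s, y)
  have hg : ContDiffOn ℝ ∞ (Function.uncurry g) (V ×ˢ univ) := by
    refine ContDiffOn.mul (χ.contDiff.comp contDiff_snd).contDiffOn ?_
    refine hG.comp (contDiff_snd.neg.prodMk contDiff_fst).contDiffOn ?_
    rintro ⟨y, s⟩ hq
    exact ⟨mem_univ _, hq.1⟩
  have hfi : LocallyIntegrable ((Ioc (0 : ℝ) 1).indicator fun _ => (1 : ℝ)) volume :=
    ((integrable_indicator_iff measurableSet_Ioc).2 (by simp)).locallyIntegrable
  have h := contDiffOn_convolution_right_with_param_comp (μ := (volume : Measure ℝ))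
    (ContinuousLinearMap.mul ℝ ℝ) (n := ⊤) (v := fun _ : EM => (0 : ℝ)) contDiffOn_const hV
    (isCompact_closedBall (0 : ℝ) 3) (f := (Ioc (0 : ℝ) 1).indicator fun _ => (1 : ℝ)) (g := g)
    (fun y s _ hs => by
      have h0 : χ s = 0 := by
        refine χ.zero_of_le_dist ?_
        rw [Metric.mem_closedBall, not_le] at hs
        exact hs.le
      simp only [g, h0, zero_mul]) hfi hg
  refine h.congr fun y _ => ?_
  rw [convolution_def, intervalIntegral.integral_of_le zero_le_one,
    ← integral_indicator measurableSet_Ioc]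
  refine integral_congr_ae (Eventually.of_forall fun t => ?_)
  by_cases ht : t ∈ Ioc (0 : ℝ) 1
  · have h1 : χ (-t) = 1 := by
      refine χ.one_of_mem_closedBall ?_
      rw [Metric.mem_closedBall, dist_zero_right, norm_neg, Real.norm_of_nonneg ht.1.le]
      exact ht.2.trans one_le_two
    simp [ht, g, h1]
  · simp [ht]

variable [IsManifold I ∞ M]

/-- The map `f ↦ ∫ t in [0, 1], f (t, ·)` from `C^∞(ℝ × M)` to `C^∞(M)`. -/
def intFn : C^∞⟮𝓘(ℝ, ℝ).prod I, ℝ × M; ℝ⟯ →ₗ[ℝ] C^∞⟮I, M; ℝ⟯ where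
  toFun f := ⟨fun x => ∫ t in (0 : ℝ)..1, f (t, x), fun x₀ => by
    have h1 : ContMDiffAt I 𝓘(ℝ, ℝ) ∞
        ((fun y => ∫ t in (0 : ℝ)..1, f (t, (extChartAt I x₀).symm y)) ∘ extChartAt I x₀) x₀ := by
      have h := contDiffOn_integral (isOpen_extChartAt_target x₀) (contDiffOn_chart f x₀)
      exact (h.contDiffAt ((isOpen_extChartAt_target x₀).mem_nhds
        (mem_extChartAt_target x₀))).contMDiffAt.comp x₀ contMDiffAt_extChartAt
    refine h1.congr_of_eventuallyEq ?_
    filter_upwards [extChartAt_source_mem_nhds (I := I) x₀] with x hx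
    simp only [Function.comp_apply, (extChartAt I x₀).left_inv hx]⟩
  map_add' f g := by
    ext x
    exact intervalIntegral.integral_add
      ((contDiff_line f x).continuous.intervalIntegrable 0 1)
      ((contDiff_line g x).continuous.intervalIntegrable 0 1)
  map_smul' c f := by
    ext x
    exact intervalIntegral.integral_const_mul c fun t => f (t, x)

theorem intFn_apply (f : C^∞⟮𝓘(ℝ, ℝ).prod I, ℝ × M; ℝ⟯) (x : M) :
    intFn f x = ∫ t in (0 : ℝ)..1, f (t, x) := rfl

end Integration

/-! ### The affine combination of two connections and the Chern-Simons forms -/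
section ChernSimons

variable {EM : Type*} [NormedAddCommGroup EM] [NormedSpace ℝ EM] [FiniteDimensional ℝ EM]
  {H : Type*} [TopologicalSpace H] {I : ModelWithCorners ℝ EM H} [I.Boundaryless]
  {M : Type*} [TopologicalSpace M] [ChartedSpace H M] [IsManifold I ∞ M] [T2Space M]
  {FA : Type*} [NormedAddCommGroup FA] [NormedSpace ℝ FA]
  {A : M → Type*} [TopologicalSpace (TotalSpace FA A)] [∀ x, TopologicalSpace (A x)]
  [∀ x, AddCommGroup (A x)] [∀ x, Module ℝ (A x)] [FiberBundle FA A] [VectorBundle ℝ FA A]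
  [ContMDiffVectorBundle ∞ FA A I]
  {F : Type*} [NormedAddCommGroup F] [NormedSpace ℝ F] [FiniteDimensional ℝ F]
  {E : M → Type*} [TopologicalSpace (TotalSpace F E)] [∀ x, TopologicalSpace (E x)]
  [∀ x, AddCommGroup (E x)] [∀ x, Module ℝ (E x)] [FiberBundle F E] [VectorBundle ℝ F E]
  [ContMDiffVectorBundle ∞ F E I]
  {𝒜 : LieAlgebroid I FA A}

/-- The function `(t, x) ↦ t` on `ℝ × M`. -/
def timeFn : C^∞⟮𝓘(ℝ, ℝ).prod I, ℝ × M; ℝ⟯ := ⟨Prod.fst, contMDiff_fst⟩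

@[simp] theorem timeFn_apply (t : ℝ) (x : M) :
    (timeFn : C^∞⟮𝓘(ℝ, ℝ).prod I, ℝ × M; ℝ⟯) (t, x) = t := rfl

/-- The operator `(∇ a σ)(t, x) = (∇ a σ_t)(x)` on sections of the pull-back bundle. -/
def RConn.lift (D : RConn 𝒜.rho F E) (a : 𝒜.Sec) :
    Module.End ℝ Cₛ^∞⟮𝓘(ℝ, ℝ).prod I; F, PullE I E⟯ :=
  liftOp (𝒜.secAnchor a) (D.op a) (D.isCDO a)

theorem RConn.pullVal_lift (D : RConn 𝒜.rho F E) (a : 𝒜.Sec)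
    (σ : Cₛ^∞⟮𝓘(ℝ, ℝ).prod I; F, PullE I E⟯) (t : ℝ) (x : M) :
    pullVal (D.lift a σ) t x = D.op a (slice t σ) x := rfl

/-- The affine combination of two `ℝ`-linear connections: the `ℝ`-linear connection
`∇^aff (c ∂_t + a) = (1 - t) ∇⁰ a + t ∇¹ a + c ∂_t` on the pull-back bundle on `ℝ × M`. -/
def affConn (D₀ D₁ : RConn 𝒜.rho F E) : RConn 𝒜.rhoProd F (PullE I E) where
  op := LinearMap.mk₂ ℝ
    (fun u σ => (1 - timeFn (I := I) (M := M)) • D₀.lift u.2 σ +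
      timeFn (I := I) (M := M) • D₁.lift u.2 σ + u.1 • dtSec σ)
    (fun u w σ => pullVal_ext fun t x => by
      simp only [pullVal_add, pullVal_fn_smul, pullVal_smul, RConn.pullVal_lift, Prod.snd_add,
        Prod.fst_add, map_add, LinearMap.add_apply, ContMDiffSection.coe_add, Pi.add_apply,
        smul_add, add_smul]
      abel)
    (fun c u σ => pullVal_ext fun t x => by
      simp only [pullVal_add, pullVal_fn_smul, pullVal_smul, RConn.pullVal_lift, Prod.smul_snd,
        Prod.smul_fst, map_smul, LinearMap.smul_apply, ContMDiffSection.coe_smul, Pi.smul_apply,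
        smul_add, smul_eq_mul, mul_smul]
      rw [smul_comm _ c, smul_comm _ c])
    (fun u σ τ => by
      simp only [map_add, smul_add]
      abel)
    (fun c u σ => pullVal_ext fun t x => by
      simp only [pullVal_add, pullVal_fn_smul, pullVal_smul, map_smul, smul_add]
      rw [smul_comm _ c, smul_comm _ c, smul_comm _ c])
  isCDO u f σ := pullVal_ext fun t x => by
    simp only [LinearMap.mk₂_apply, pullVal_add, pullVal_fn_smul, pullVal_smul,
      RConn.pullVal_lift, dtSec_smul, slice_fn_smul, D₀.isCDO _ _ _, D₁.isCDO _ _ _,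
      LieAlgebroid.rhoProd_apply, ContMDiffSection.coe_add, Pi.add_apply, fn_smul_apply,
      sliceFn_apply, slice_apply, ContMDiffMap.coe_sub, Pi.sub_apply, timeFn_apply,
      ContMDiffMap.coe_one, Pi.one_apply]
    module

theorem affConn_apply (D₀ D₁ : RConn 𝒜.rho F E) (c : ℝ) (a : 𝒜.Sec)
    (σ : Cₛ^∞⟮𝓘(ℝ, ℝ).prod I; F, PullE I E⟯) (t : ℝ) (x : M) :
    pullVal ((affConn D₀ D₁).op (c, a) σ) t x =
      (1 - t) • D₀.op a (slice t σ) x + t • D₁.op a (slice t σ) x + c • pullVal (dtSec σ) t x :=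
  rfl

/-- Integration over the `1`-simplex:
`(∫ η) (a 1, …, a n) = ∫ t in [0, 1], η (∂_t, a 1, …, a n) (t, ·)`. -/
def simplexInt {n : ℕ}
    (η : (ℝ × 𝒜.Sec) [⋀^Fin (n + 1)]→ₗ[ℝ] C^∞⟮𝓘(ℝ, ℝ).prod I, ℝ × M; ℝ⟯) :
    𝒜.Sec [⋀^Fin n]→ₗ[ℝ] C^∞⟮I, M; ℝ⟯ :=
  intFn.compAlternatingMap
    ((η.curryLeft ((1 : ℝ), (0 : 𝒜.Sec))).compLinearMap (LinearMap.inr ℝ ℝ 𝒜.Sec))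

theorem simplexInt_apply {n : ℕ}
    (η : (ℝ × 𝒜.Sec) [⋀^Fin (n + 1)]→ₗ[ℝ] C^∞⟮𝓘(ℝ, ℝ).prod I, ℝ × M; ℝ⟯)
    (a : Fin n → 𝒜.Sec) (x : M) :
    simplexInt η a x = ∫ t in (0 : ℝ)..1,
      η (Fin.cons ((1 : ℝ), (0 : 𝒜.Sec)) fun i => ((0 : ℝ), a i)) (t, x) := rfl

/-- The Chern-Simons transgression form `cs p (∇⁰, ∇¹) = ∫ ch p (∇^aff)`, an `ℝ`-linear form of
degree `2p - 1`. -/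
def cs (p : ℕ) (hp : 0 < p) (D₀ D₁ : RConn 𝒜.rho F E) :
    𝒜.Sec [⋀^Fin (2 * p - 1)]→ₗ[ℝ] C^∞⟮I, M; ℝ⟯ :=
  simplexInt (((affConn D₀ D₁).ch p).domDomCongr
    (finCongr (by omega : 2 * p = 2 * p - 1 + 1)))

end ChernSimons

end LieAlgd

end

noncomputable section

namespace LieAlgd

/-! ### Cochains as functions on lists

Forms are evaluated on lists of vectors, so that the wedge product, the Lie derivative and the
differential are defined by recursion on the list of arguments, following Cartan's formulas. -/

/-! Put p = n + 1, let θ = ∇¹ - ∇⁰, a one-form with values in `End E`, and let R_t be the curvature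
of (1 - t)∇⁰ + t∇¹. Because the curvature of the affine connection pairs ∂_t and a to θ(a), the form
cs_p(∇⁰, ∇¹) equals (n + 1) ∫ Tr(θ R_t ^ n) dt (`RConn.cs_eq_csCo`). Nothing here uses tensoriality
in the arguments, so the calculus of forms is carried out for a Lie algebra `L` acting on
coefficients.

Four properties of this expression carry the theorem. The transgression formula `RConn.d_csCo` says
d cs_p(∇⁰, ∇¹) = ch_p(∇¹) - ch_p(∇⁰); it follows from the Bianchi identity, from ∂_t R_t = d_{∇_t} θ
and from the cyclicity of the trace. Reversing the path gives cs_p(∇¹, ∇⁰) = -cs_p(∇⁰, ∇¹)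
(`RConn.csCo_symm`). Passing to adjoint connections replaces R by minus its transpose and θ by minus
its transpose. Transposition reverses products, but the trace and the even degree of R undo the
reversal, hence cs_p(∇⁰, ∇¹) = (-1)^p cs_p(∇⁰^h, ∇¹^h) (`RConn.csCo_adjoint`). Lastly, Stokes'
theorem on [0, 1] × M, applied to the Chern-Simons form of two connections on the pull-back bundle,
compares the integrals of their Chern characters with the Chern-Simons forms at both ends, up to an
exact form (`RConn.chInt_sub_mem`).

If p is even, adjunction and antisymmetry give cs_p(∇, ∇^h) = cs_p(∇^h, ∇) = -cs_p(∇, ∇^h), so the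
form itself is zero (`RConn.csCo_adjoint_eq_zero`).

Let p be odd and ∇ flat. Then ∇^h is flat, and ch_p(∇_m) = -ch_p(∇_m) = 0 since ∇_m is its own
adjoint; transgression makes both forms closed. To change the metric, take a path of metrics as a
metric on the pull-back bundle: the pulled-back connection and its adjoint are both flat, so the
homotopy formula leaves only the difference of the two ends, which is exact
(`RConn.csCo_adjoint_sub_mem`). One may therefore use the metric h₀ preserved by ∇_m. The triangle
relation `RConn.csCo_triangle` gives cs_p(∇, ∇^{h₀}) ~ cs_p(∇, ∇_m) + cs_p(∇_m, ∇^{h₀}), and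
adjunction with respect to h₀ followed by antisymmetry identifies the last term with cs_p(∇, ∇_m).
This is the factor 2. -/

/-- Inhomogeneous forms on `L` with values in `B`, as functions on lists of arguments. -/
@[ext]
structure Cochain (L B : Type*) where
  /-- the value on a list of arguments -/
  toFun : List L → B

namespace Cochain

section Basic

variable {L B : Type*} [Ring B]

instance : CoeFun (Cochain L B) fun _ => List L → B := ⟨toFun⟩

theorem ext_apply {f g : Cochain L B} (h : ∀ l, f l = g l) : f = g := Cochain.ext (funext h)

instance : Zero (Cochain L B) := ⟨⟨fun _ => 0⟩⟩
instance : Add (Cochain L B) := ⟨fun f g => ⟨fun l => f l + g l⟩⟩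
instance : Neg (Cochain L B) := ⟨fun f => ⟨fun l => -f l⟩⟩
instance : Sub (Cochain L B) := ⟨fun f g => ⟨fun l => f l - g l⟩⟩
instance : SMul ℕ (Cochain L B) := ⟨fun n f => ⟨fun l => n • f l⟩⟩
instance : SMul ℤ (Cochain L B) := ⟨fun n f => ⟨fun l => n • f l⟩⟩

instance : AddCommGroup (Cochain L B) :=
  Function.Injective.addCommGroup toFun (fun _ _ => Cochain.ext) rfl (fun _ _ => rfl)
    (fun _ => rfl) (fun _ _ => rfl) (fun _ _ => rfl) (fun _ _ => rfl)

@[simp] theorem add_apply (f g : Cochain L B) (l : List L) : (f + g) l = f l + g l := rfl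
@[simp] theorem sub_apply (f g : Cochain L B) (l : List L) : (f - g) l = f l - g l := rfl
@[simp] theorem neg_apply (f : Cochain L B) (l : List L) : (-f) l = -f l := rfl
@[simp] theorem zero_apply (l : List L) : (0 : Cochain L B) l = 0 := rfl

/-- The insertion of a vector as the first argument. -/
def ins (a : L) : Cochain L B →+ Cochain L B where
  toFun f := ⟨fun l => f (a :: l)⟩
  map_zero' := rfl
  map_add' _ _ := rfl

theorem ins_apply (a : L) (f : Cochain L B) (l : List L) : ins a f l = f (a :: l) := rfl

/-- The working extensionality principle: an identity of low-degree cochains is checked by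
contracting until degree zero is reached. -/
theorem ext_ins {f g : Cochain L B} (h0 : f [] = g []) (h : ∀ a, ins a f = ins a g) : f = g := by
  refine ext_apply fun l => ?_
  cases l with
  | nil => exact h0
  | cons a l => exact congrArg (fun u => u l) (h a)

/-- The grading involution, with sign `(-1) ^ n` in degree `n`. -/
def bar : Cochain L B →+ Cochain L B where
  toFun f := ⟨fun l => (-1) ^ l.length * f l⟩
  map_zero' := by
    refine ext_apply fun l => ?_
    exact mul_zero _
  map_add' f g := by
    refine ext_apply fun l => ?_
    exact mul_add _ _ _

theorem bar_nil (f : Cochain L B) : bar f [] = f [] := by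
  change (-1) ^ 0 * f [] = f []
  rw [pow_zero, one_mul]

theorem bar_apply (f : Cochain L B) (l : List L) : bar f l = (-1) ^ l.length * f l := rfl

theorem ins_bar (a : L) (f : Cochain L B) : ins a (bar f) = -bar (ins a f) := by
  refine ext_apply fun l => ?_
  simp [ins_apply, bar_apply, pow_succ]

@[simp] theorem bar_bar (f : Cochain L B) : bar (bar f) = f := by
  refine ext_apply fun l => ?_
  rw [bar_apply, bar_apply, ← mul_assoc, ← pow_add, ← two_mul, pow_mul]
  simp

/-- The wedge product, evaluated on a list of arguments. -/
def wedge : List L → Cochain L B → Cochain L B → B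
  | [], f, g => f [] * g []
  | a :: l, f, g => wedge l (ins a f) g + wedge l (bar f) (ins a g)

instance : Mul (Cochain L B) := ⟨fun f g => ⟨fun l => wedge l f g⟩⟩

@[simp] theorem mul_nil (f g : Cochain L B) : (f * g) [] = f [] * g [] := rfl

theorem mul_cons (f g : Cochain L B) (a : L) (l : List L) :
    (f * g) (a :: l) = (ins a f * g) l + (bar f * ins a g) l := rfl

theorem ins_mul (a : L) (f g : Cochain L B) :
    ins a (f * g) = ins a f * g + bar f * ins a g := rfl

instance : One (Cochain L B) := ⟨⟨fun l => if l = [] then 1 else 0⟩⟩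

@[simp] theorem one_nil : (1 : Cochain L B) [] = 1 := rfl

@[simp] theorem ins_one (a : L) : ins a (1 : Cochain L B) = 0 := rfl

theorem wedge_add (f g g' : Cochain L B) (l : List L) :
    (f * (g + g')) l = (f * g) l + (f * g') l := by
  induction l generalizing f g g' with
  | nil => exact _root_.mul_add _ _ _
  | cons a l ih =>
    simp only [mul_cons, map_add, ih]
    abel

theorem add_wedge (f f' g : Cochain L B) (l : List L) :
    ((f + f') * g) l = (f * g) l + (f' * g) l := by
  induction l generalizing f f' g with
  | nil => exact _root_.add_mul _ _ _
  | cons a l ih =>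
    simp only [mul_cons, map_add, ih]
    abel

instance : NonUnitalNonAssocRing (Cochain L B) where
  left_distrib f g h := ext_apply (wedge_add f g h)
  right_distrib f g h := ext_apply (add_wedge f g h)
  zero_mul f := by
    have h : (0 + 0) * f = 0 * f + 0 * f := ext_apply (add_wedge 0 0 f)
    rwa [add_zero, left_eq_add] at h
  mul_zero f := by
    have h : f * (0 + 0) = f * 0 + f * 0 := ext_apply (wedge_add f 0 0)
    rwa [add_zero, left_eq_add] at h

theorem bar_mul (f g : Cochain L B) : bar (f * g) = bar f * bar g := by
  refine ext_apply fun l => ?_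
  induction l generalizing f g with
  | nil => simp [bar_nil]
  | cons a l ih =>
    have h : bar (f * g) (a :: l) = -(bar (ins a f * g) l + bar (bar f * ins a g) l) := by
      simp only [bar_apply, List.length_cons, pow_succ, mul_cons]
      noncomm_ring
    rw [h, ih, ih, mul_cons, ins_bar, ins_bar, neg_mul, mul_neg]
    simp only [neg_apply]
    abel

theorem mul_assoc_apply (f g h : Cochain L B) (l : List L) :
    ((f * g) * h) l = (f * (g * h)) l := by
  induction l generalizing f g h with
  | nil => simp [mul_assoc]
  | cons a l ih =>
    simp only [mul_cons, ins_mul, add_mul, mul_add, add_apply, bar_mul, ih]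
    abel

theorem one_mul_apply (f : Cochain L B) (l : List L) : (1 * f) l = f l := by
  induction l generalizing f with
  | nil => simp
  | cons a l ih =>
    have h : bar (1 : Cochain L B) = 1 := by
      refine ext_ins (bar_nil _) fun b => ?_
      simp [ins_bar]
    rw [mul_cons, ins_one, zero_mul, h, ih, zero_apply, zero_add, ins_apply]

theorem mul_one_apply (f : Cochain L B) (l : List L) : (f * 1) l = f l := by
  induction l generalizing f with
  | nil => simp
  | cons a l ih => rw [mul_cons, ins_one, mul_zero, ih, zero_apply, add_zero, ins_apply]

instance : Ring (Cochain L B) where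
  __ := (inferInstance : NonUnitalNonAssocRing (Cochain L B))
  mul_assoc f g h := ext_apply (mul_assoc_apply f g h)
  one_mul f := ext_apply (one_mul_apply f)
  mul_one f := ext_apply (mul_one_apply f)

@[simp] theorem bar_one : bar (1 : Cochain L B) = 1 := by
  refine ext_ins (bar_nil _) fun b => ?_
  simp [ins_bar]

theorem bar_pow_of_even {f : Cochain L B} (hf : bar f = f) (n : ℕ) : bar (f ^ n) = f ^ n := by
  induction n with
  | zero => simp
  | succ n ih => rw [pow_succ, bar_mul, ih, hf]

/-- The cochain of degree one given by a function. -/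
def form1 (θ : L → B) : Cochain L B :=
  ⟨fun l => match l with
    | [a] => θ a
    | _ => 0⟩

/-- The cochain of degree two given by a function of two variables. -/
def form2 (R : L → L → B) : Cochain L B :=
  ⟨fun l => match l with
    | [a, b] => R a b
    | _ => 0⟩

/-- The cochain of degree zero given by an element. -/
def form0 (b : B) : Cochain L B :=
  ⟨fun l => match l with
    | [] => b
    | _ => 0⟩

@[simp] theorem form1_nil (θ : L → B) : form1 θ [] = 0 := rfl
@[simp] theorem form2_nil (R : L → L → B) : form2 R [] = 0 := rfl
@[simp] theorem form0_nil (b : B) : (form0 b : Cochain L B) [] = b := rfl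
@[simp] theorem form0_cons (b : B) (a : L) (l : List L) : (form0 b : Cochain L B) (a :: l) = 0 := rfl

@[simp] theorem ins_form0 (b : B) (a : L) : ins a (form0 b : Cochain L B) = 0 := rfl

@[simp] theorem ins_form1 (θ : L → B) (a : L) : ins a (form1 θ) = form0 (θ a) := by
  refine ext_apply fun l => ?_
  rcases l with _ | ⟨b, l⟩ <;> rfl

@[simp] theorem ins_form2 (R : L → L → B) (a : L) : ins a (form2 R) = form1 (R a) := by
  refine ext_apply fun l => ?_
  rcases l with _ | ⟨b, _ | ⟨c, l⟩⟩ <;> rfl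

@[simp] theorem bar_form0 (b : B) : bar (form0 b : Cochain L B) = form0 b :=
  ext_ins (bar_nil _) fun a => by rw [ins_bar, ins_form0, map_zero, neg_zero]

@[simp] theorem bar_form1 (θ : L → B) : bar (form1 θ) = -form1 θ :=
  ext_ins (by simp [bar_nil]) fun a => by rw [ins_bar, map_neg, ins_form1, bar_form0]

@[simp] theorem bar_form2 (R : L → L → B) : bar (form2 R) = form2 R :=
  ext_ins (by simp [bar_nil]) fun a => by rw [ins_bar, ins_form2, bar_form1, neg_neg]

@[simp] theorem form0_zero : (form0 (0 : B) : Cochain L B) = 0 :=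
  ext_ins rfl fun _ => rfl

@[simp] theorem form1_zero : (form1 (fun _ => (0 : B)) : Cochain L B) = 0 :=
  ext_ins rfl fun a => by simp

theorem form0_mul_apply (b : B) (f : Cochain L B) (l : List L) : ((form0 b : Cochain L B) * f) l = b * f l := by
  induction l generalizing f with
  | nil => simp
  | cons a l ih => rw [mul_cons, ins_form0, zero_mul, bar_form0, ih, zero_apply, zero_add, ins_apply]

/-- This fixes the normalisation: the product is a sum over shuffles, without factorials. -/
theorem form1_mul_form1 (θ η : L → B) :
    form1 θ * form1 η = form2 fun a b => θ a * η b - θ b * η a := by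
  refine ext_ins (by simp) fun a => ext_ins ?_ fun b => ?_
  · simp [ins_mul]
  · refine ext_ins ?_ fun c => ?_
    · simp only [ins_mul, ins_form1, ins_form2, bar_form1, neg_mul]
      simp [ins_apply, form1, ins_mul, sub_eq_add_neg]
    · simp [ins_mul]

end Basic

/-! ### Graded cyclicity of the trace -/

section Trace

variable {L B C : Type*} [Ring B] [AddCommGroup C]

/-- The trace of a product of cochains is graded commutative. -/
theorem trace_mul_comm_aux (τ : B →+ C) (hτ : ∀ x y, τ (x * y) = τ (y * x)) (l : List L) :
    (∀ f g : Cochain L B, bar f = f → τ ((f * g) l) = τ ((g * f) l)) ∧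
    (∀ f g : Cochain L B, bar f = -f → τ ((f * g) l) = τ ((bar g * f) l)) := by
  have h1 : ∀ (f : Cochain L B) a, bar f = f → bar (ins a f) = -ins a f := fun f a h => by
    rw [← neg_eq_iff_eq_neg, ← ins_bar, h]
  have h2 : ∀ (f : Cochain L B) a, bar f = -f → bar (ins a f) = ins a f := fun f a h => by
    have := ins_bar a f
    rw [h, map_neg, neg_inj] at this
    exact this.symm
  -- Contraction exchanges the two parities of `f`, so both statements have to go through the same
  -- induction; `g` needs no parity because `bar` records its sign.
  induction l with
  | nil =>
    refine ⟨fun f g _ => hτ _ _, fun f g _ => ?_⟩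
    rw [mul_nil, mul_nil, bar_nil, hτ]
  | cons a l ih =>
    refine ⟨fun f g hf => ?_, fun f g hf => ?_⟩
    · rw [mul_cons, mul_cons, map_add, map_add, hf, ih.2 _ g (h1 f a hf), ih.1 f _ hf, add_comm]
    · rw [mul_cons, mul_cons, map_add, map_add, hf, neg_mul, neg_apply, map_neg,
        ih.1 _ g (h2 f a hf), ih.2 f _ hf, ins_bar, neg_mul, neg_apply, map_neg, bar_bar, add_comm]

theorem trace_mul_comm (τ : B →+ C) (hτ : ∀ x y, τ (x * y) = τ (y * x)) {f : Cochain L B}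
    (hf : bar f = f) (g : Cochain L B) (l : List L) : τ ((f * g) l) = τ ((g * f) l) :=
  (trace_mul_comm_aux τ hτ l).1 f g hf

end Trace

/-! ### Product-reversing relations, as satisfied by transposition -/

section Adjoint

variable {L B : Type*} [Ring B]

/-- A relation which is compatible with sums, and with products up to reversal, is compatible with
wedge products up to reversal. -/
theorem rel_mul_aux (S : AddSubgroup (B × B))
    (hS : ∀ x x' y y', (x, x') ∈ S → (y, y') ∈ S → (x * y, y' * x') ∈ S) (l : List L) :
    (∀ f f' g g' : Cochain L B, (∀ m, (f m, f' m) ∈ S) → (∀ m, (g m, g' m) ∈ S) → bar f' = f' →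
      bar f = f → ((f * g) l, (g' * f') l) ∈ S) ∧
    (∀ f f' g g' : Cochain L B, (∀ m, (f m, f' m) ∈ S) → (∀ m, (g m, g' m) ∈ S) → bar f' = -f' →
      bar f = -f → ((f * g) l, (bar g' * f') l) ∈ S) := by
  have h1 : ∀ (f : Cochain L B) a, bar f = f → bar (ins a f) = -ins a f := fun f a h => by
    rw [← neg_eq_iff_eq_neg, ← ins_bar, h]
  have h2 : ∀ (f : Cochain L B) a, bar f = -f → bar (ins a f) = ins a f := fun f a h => by
    have := ins_bar a f
    rw [h, map_neg, neg_inj] at this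
    exact this.symm
  induction l with
  | nil =>
    refine ⟨fun f f' g g' hf hg _ _ => hS _ _ _ _ (hf _) (hg _), fun f f' g g' hf hg _ _ => ?_⟩
    rw [mul_nil, mul_nil, bar_nil]
    exact hS _ _ _ _ (hf _) (hg _)
  | cons a l ih =>
    refine ⟨fun f f' g g' hf hg h h' => ?_, fun f f' g g' hf hg h h' => ?_⟩
    -- Under reversal the term in which the vector enters the first factor of one product
    -- corresponds to the term in which it enters the second factor of the other; hence the exchange
    -- of the two summands.
    · rw [mul_cons, mul_cons, h', add_comm]
      exact S.add_mem (ih.1 f f' (ins a g) (ins a g') hf (fun m => hg _) h h')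
        (ih.2 (ins a f) (ins a f') g g' (fun m => hf _) hg (h1 _ a h) (h1 _ a h'))
    · rw [mul_cons, mul_cons, h', neg_mul, neg_apply, ins_bar, neg_mul, neg_apply, bar_bar,
        add_comm]
      exact S.add_mem (S.neg_mem (ih.2 f f' (ins a g) (ins a g') hf (fun m => hg _) h h'))
        (ih.1 (ins a f) (ins a f') g g' (fun m => hf _) hg (h2 _ a h) (h2 _ a h'))

theorem rel_mul (S : AddSubgroup (B × B))
    (hS : ∀ x x' y y', (x, x') ∈ S → (y, y') ∈ S → (x * y, y' * x') ∈ S)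
    {f f' g g' : Cochain L B} (hf : ∀ m, (f m, f' m) ∈ S) (hg : ∀ m, (g m, g' m) ∈ S)
    (h : bar f = f) (h' : bar f' = f') (l : List L) : ((f * g) l, (g' * f') l) ∈ S :=
  (rel_mul_aux S hS l).1 f f' g g' hf hg h' h

theorem rel_pow (S : AddSubgroup (B × B))
    (hS : ∀ x x' y y', (x, x') ∈ S → (y, y') ∈ S → (x * y, y' * x') ∈ S) (h1 : (1, 1) ∈ S)
    {f f' : Cochain L B} (hf : ∀ m, (f m, f' m) ∈ S) (h : bar f = f) (h' : bar f' = f') (n : ℕ)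
    (l : List L) : ((f ^ n) l, (f' ^ n) l) ∈ S := by
  induction n generalizing l with
  | zero =>
    rw [pow_zero, pow_zero]
    rcases l with _ | ⟨a, l⟩
    · exact h1
    · exact S.zero_mem
  | succ n ih =>
    -- The new factor is split off on the left of one power and on the right of the other, as the
    -- reversal demands.
    rw [pow_succ', pow_succ]
    exact rel_mul S hS hf ih h h' l

end Adjoint

/-! ### Change of coefficients and change of arguments -/

section Functoriality

variable {L L' B B' B'' : Type*} [Ring B] [Ring B'] [Ring B'']

/-- The action of an additive map on the values of a cochain. -/
def mapCo (φ : B →+ B') : Cochain L B →+ Cochain L B' where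
  toFun f := ⟨fun l => φ (f l)⟩
  map_zero' := by
    refine ext_apply fun l => ?_
    exact map_zero φ
  map_add' f g := by
    refine ext_apply fun l => ?_
    exact map_add φ _ _

@[simp] theorem mapCo_apply (φ : B →+ B') (f : Cochain L B) (l : List L) :
    mapCo φ f l = φ (f l) := rfl

theorem ins_mapCo (φ : B →+ B') (f : Cochain L B) (a : L) :
    ins a (mapCo φ f) = mapCo φ (ins a f) := rfl

/-- As an integer multiple, the sign passes through maps that are merely additive. -/
theorem neg_one_pow_mul (n : ℕ) (b : B) : (-1) ^ n * b = ((-1 : ℤ) ^ n) • b := by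
  rcases neg_one_pow_eq_or B n with h | h <;> rcases Nat.even_or_odd n with h' | h' <;>
    simp [h'.neg_one_pow]

theorem bar_mapCo (φ : B →+ B') (f : Cochain L B) : bar (mapCo φ f) = mapCo φ (bar f) := by
  refine ext_apply fun l => ?_
  simp only [bar_apply, mapCo_apply, neg_one_pow_mul, map_zsmul]

theorem mapCo_form1 (φ : B →+ B') (θ : L → B) : mapCo φ (form1 θ) = form1 fun a => φ (θ a) := by
  refine ext_apply fun l => ?_
  rcases l with _ | ⟨b, _ | ⟨c, l⟩⟩ <;> simp [form1]

theorem mapCo_form2 (φ : B →+ B') (R : L → L → B) :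
    mapCo φ (form2 R) = form2 fun a b => φ (R a b) := by
  refine ext_apply fun l => ?_
  rcases l with _ | ⟨b, _ | ⟨c, _ | ⟨d, l⟩⟩⟩ <;> simp [form2]

theorem mapCo_mul_of (φ : B →+ B') (hφ : ∀ x y, φ (x * y) = φ x * φ y) (f g : Cochain L B) :
    mapCo φ (f * g) = mapCo φ f * mapCo φ g := by
  refine ext_apply fun l => ?_
  induction l generalizing f g with
  | nil => exact hφ _ _
  | cons a l ih =>
    rw [mapCo_apply, mul_cons, map_add, mul_cons, ins_mapCo, ins_mapCo, bar_mapCo, ← ih, ← ih]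
    rfl

/-- The ring homomorphism on cochains induced by a ring homomorphism. -/
def mapHom (φ : B →+* B') : Cochain L B →+* Cochain L B' where
  __ := mapCo φ.toAddMonoidHom
  map_one' := ext_ins (map_one φ) fun a => by
    refine ext_apply fun l => ?_
    exact map_zero φ
  map_mul' f g := mapCo_mul_of φ.toAddMonoidHom (map_mul φ) f g

@[simp] theorem mapHom_apply (φ : B →+* B') (f : Cochain L B) (l : List L) :
    mapHom φ f l = φ (f l) := rfl

theorem mapHom_form1 (φ : B →+* B') (θ : L → B) :
    mapHom φ (form1 θ) = form1 fun a => φ (θ a) := mapCo_form1 φ.toAddMonoidHom θ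

theorem mapHom_form2 (φ : B →+* B') (R : L → L → B) :
    mapHom φ (form2 R) = form2 fun a b => φ (R a b) := mapCo_form2 φ.toAddMonoidHom R

/-- The pull-back of cochains along a map. -/
def pull (j : L' → L) : Cochain L B →+ Cochain L' B where
  toFun f := ⟨fun l => f (l.map j)⟩
  map_zero' := rfl
  map_add' _ _ := rfl

@[simp] theorem pull_apply (j : L' → L) (f : Cochain L B) (l : List L') :
    pull j f l = f (l.map j) := rfl

theorem ins_pull (j : L' → L) (f : Cochain L B) (a : L') :
    ins a (pull j f) = pull j (ins (j a) f) := rfl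

theorem bar_pull (j : L' → L) (f : Cochain L B) : bar (pull j f) = pull j (bar f) := by
  refine ext_apply fun l => ?_
  simp [bar_apply]

theorem pull_mul (j : L' → L) (f g : Cochain L B) : pull j (f * g) = pull j f * pull j g := by
  refine ext_apply fun l => ?_
  induction l generalizing f g with
  | nil => rfl
  | cons a l ih =>
    rw [mul_cons, ins_pull, ins_pull, bar_pull, ← ih, ← ih]
    rfl

theorem pull_pow (j : L' → L) (f : Cochain L B) (n : ℕ) : pull j (f ^ n) = pull j f ^ n := by
  induction n with
  | zero =>
    rw [pow_zero, pow_zero]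
    exact ext_ins rfl fun _ => rfl
  | succ n ih => rw [pow_succ, pow_succ, pull_mul, ih]

theorem pull_form1 (j : L' → L) (θ : L → B) : pull j (form1 θ) = form1 fun a => θ (j a) := by
  refine ext_apply fun l => ?_
  rcases l with _ | ⟨b, _ | ⟨c, l⟩⟩ <;> rfl

theorem pull_form2 (j : L' → L) (R : L → L → B) :
    pull j (form2 R) = form2 fun a b => R (j a) (j b) := by
  refine ext_apply fun l => ?_
  rcases l with _ | ⟨b, _ | ⟨c, _ | ⟨d, l⟩⟩⟩ <;> rfl

end Functoriality

/-! ### Lie derivative and differential by Cartan's formulas -/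

section Differential

variable {L B B' : Type*} [LieRing L] [Ring B] [Ring B']

/-- The Lie derivative in the direction of `a`, evaluated on a list of arguments; here `δ a` is the
action of `a` on the coefficients. -/
def lieDList (δ : L → B →+ B) (a : L) : List L → Cochain L B → B
  | [], f => δ a (f [])
  | b :: l, f => lieDList δ a l (ins b f) - f (⁅a, b⁆ :: l)

theorem lieDList_add (δ : L → B →+ B) (a : L) (l : List L) (f g : Cochain L B) :
    lieDList δ a l (f + g) = lieDList δ a l f + lieDList δ a l g := by
  induction l generalizing f g with
  | nil => exact map_add _ _ _
  | cons b l ih =>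
    simp only [lieDList, map_add, ih, add_apply]
    abel

/-- The Lie derivative in the direction of `a`. -/
def lieD (δ : L → B →+ B) (a : L) : Cochain L B →+ Cochain L B :=
  AddMonoidHom.mk' (fun f => ⟨fun l => lieDList δ a l f⟩)
    fun f g => ext_apply fun l => lieDList_add δ a l f g

@[simp] theorem lieD_nil (δ : L → B →+ B) (a : L) (f : Cochain L B) :
    lieD δ a f [] = δ a (f []) := rfl

theorem ins_lieD (δ : L → B →+ B) (a b : L) (f : Cochain L B) :
    ins b (lieD δ a f) = lieD δ a (ins b f) - ins ⁅a, b⁆ f := rfl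

theorem lieD_bar (δ : L → B →+ B) (a : L) (f : Cochain L B) :
    lieD δ a (bar f) = bar (lieD δ a f) := by
  refine ext_apply fun l => ?_
  induction l generalizing f with
  | nil => simp [bar_nil]
  | cons b l ih =>
    change ins b (lieD δ a (bar f)) l = ins b (bar (lieD δ a f)) l
    rw [ins_bar, ins_lieD, ins_lieD, ins_bar, ins_bar, map_sub, map_neg, sub_apply, neg_apply, ih,
      neg_apply, neg_apply, sub_apply]
    abel

theorem lieD_mul (δ : L → B →+ B) (a : L) (hδ : ∀ x y, δ a (x * y) = δ a x * y + x * δ a y)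
    (f g : Cochain L B) : lieD δ a (f * g) = lieD δ a f * g + f * lieD δ a g := by
  refine ext_apply fun l => ?_
  induction l generalizing f g with
  | nil => exact hδ _ _
  | cons b l ih =>
    change ins b (lieD δ a (f * g)) l = ins b (lieD δ a f * g + f * lieD δ a g) l
    simp only [ins_lieD, ins_mul, map_add, sub_apply, add_apply, ih, sub_mul, mul_sub, lieD_bar]
    abel

/-- The differential, evaluated on a list of arguments. -/
def dList (δ : L → B →+ B) : List L → Cochain L B → B
  | [], _ => 0
  | a :: l, f => lieD δ a f l - dList δ l (ins a f)

theorem dList_add (δ : L → B →+ B) (l : List L) (f g : Cochain L B) :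
    dList δ l (f + g) = dList δ l f + dList δ l g := by
  induction l generalizing f g with
  | nil => simp [dList]
  | cons b l ih =>
    simp only [dList, map_add, ih, add_apply]
    abel

/-- The differential on cochains, defined by Cartan's formula `ι_a d = L_a - d ι_a`. -/
def d (δ : L → B →+ B) : Cochain L B →+ Cochain L B :=
  AddMonoidHom.mk' (fun f => ⟨fun l => dList δ l f⟩) fun f g => ext_apply fun l => dList_add δ l f g

@[simp] theorem d_nil (δ : L → B →+ B) (f : Cochain L B) : d δ f [] = 0 := rfl

theorem ins_d (δ : L → B →+ B) (a : L) (f : Cochain L B) :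
    ins a (d δ f) = lieD δ a f - d δ (ins a f) := rfl

theorem d_bar (δ : L → B →+ B) (f : Cochain L B) : d δ (bar f) = -bar (d δ f) := by
  refine ext_apply fun l => ?_
  induction l generalizing f with
  | nil => simp [bar_nil]
  | cons b l ih =>
    change ins b (d δ (bar f)) l = (-ins b (bar (d δ f))) l
    rw [ins_bar, ins_d, ins_d, ins_bar, map_neg, map_sub, sub_apply, neg_apply, neg_apply,
      neg_apply, sub_apply, ih, lieD_bar, neg_apply]
    abel

/-- Contraction with a vector turns both sides into Lie derivatives, which obey the ungraded Leibniz
rule, and into differentials of products with one contracted factor, which the induction covers. The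
sign is the one by which `d` anticommutes with `bar`. -/
theorem d_mul (δ : L → B →+ B) (hδ : ∀ a x y, δ a (x * y) = δ a x * y + x * δ a y)
    (f g : Cochain L B) : d δ (f * g) = d δ f * g + bar f * d δ g := by
  refine ext_apply fun l => ?_
  induction l generalizing f g with
  | nil => simp
  | cons b l ih =>
    change ins b (d δ (f * g)) l = ins b (d δ f * g + bar f * d δ g) l
    simp only [ins_d, ins_mul, map_add, sub_apply, add_apply, ih, sub_mul, mul_sub,
      lieD_mul δ b (hδ b), d_bar, ins_bar, bar_bar, neg_mul, neg_apply]
    abel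

theorem d_pow_of_closed (δ : L → B →+ B) (hδ : ∀ a x y, δ a (x * y) = δ a x * y + x * δ a y)
    {f : Cochain L B} (hf : d δ f = 0) (n : ℕ) : d δ (f ^ n) = 0 := by
  induction n with
  | zero =>
    have h := d_mul δ hδ (1 : Cochain L B) 1
    rw [mul_one, bar_one, mul_one, one_mul, left_eq_add] at h
    rw [pow_zero, h]
  | succ n ih => rw [pow_succ, d_mul δ hδ, ih, hf, zero_mul, mul_zero, add_zero]

theorem mapCo_lieD (φ : B →+ B') (δ : L → B →+ B) (δ' : L → B' →+ B')
    (h : ∀ a x, φ (δ a x) = δ' a (φ x)) (a : L) (f : Cochain L B) :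
    mapCo φ (lieD δ a f) = lieD δ' a (mapCo φ f) := by
  refine ext_apply fun l => ?_
  induction l generalizing f with
  | nil => exact h _ _
  | cons b l ih =>
    change φ (lieD δ a (ins b f) l - f (⁅a, b⁆ :: l)) = _
    rw [map_sub, ← mapCo_apply, ih]
    rfl

theorem mapCo_d (φ : B →+ B') (δ : L → B →+ B) (δ' : L → B' →+ B')
    (h : ∀ a x, φ (δ a x) = δ' a (φ x)) (f : Cochain L B) :
    mapCo φ (d δ f) = d δ' (mapCo φ f) := by
  refine ext_apply fun l => ?_
  induction l generalizing f with
  | nil => exact map_zero φ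
  | cons b l ih =>
    change φ (lieD δ b f l - d δ (ins b f) l) = _
    rw [map_sub, ← mapCo_apply, ← mapCo_apply φ (d δ _), ih, mapCo_lieD φ δ δ' h]
    rfl

theorem lieD_form0 (δ : L → B →+ B) (a : L) (b : B) :
    lieD δ a (form0 b : Cochain L B) = form0 (δ a b) :=
  ext_ins rfl fun c => by simp [ins_lieD]

theorem lieD_form1 (δ : L → B →+ B) (a : L) (θ : L → B) :
    lieD δ a (form1 θ) = form1 fun b => δ a (θ b) - θ ⁅a, b⁆ := by
  refine ext_ins (by simp) fun c => ?_
  rw [ins_lieD, ins_form1, ins_form1, lieD_form0, ins_form1]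
  exact ext_ins rfl fun c => by simp

theorem lieD_form2 (δ : L → B →+ B) (a : L) (R : L → L → B) :
    lieD δ a (form2 R) = form2 fun b c => δ a (R b c) - R b ⁅a, c⁆ - R ⁅a, b⁆ c := by
  refine ext_ins (by simp) fun b => ext_ins ?_ fun c => ?_
  · simp [ins_lieD, lieD_form1]
  · simp only [ins_lieD, ins_form2, lieD_form1, ins_form1, map_sub]
    exact ext_ins rfl fun c => by simp

theorem d_form0 (δ : L → B →+ B) (b : B) : d δ (form0 b : Cochain L B) = form1 fun a => δ a b :=
  ext_ins rfl fun a => by simp [ins_d, lieD_form0]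

theorem d_form1 (δ : L → B →+ B) (θ : L → B) :
    d δ (form1 θ) = form2 fun a b => δ a (θ b) - δ b (θ a) - θ ⁅a, b⁆ := by
  refine ext_ins (by simp) fun a => ext_ins ?_ fun b => ?_
  · simp [ins_d, lieD_form1, d_form0]
  · simp only [ins_d, ins_form2, lieD_form1, ins_form1, map_sub, d_form0]
    exact ext_ins (by simp; abel) fun c => by simp

/-- The hypothesis is what three successive contractions leave of the differential, in the order in
which Cartan's formula produces it. -/
theorem d_form2_eq_zero (δ : L → B →+ B) (R : L → L → B)
    (h : ∀ a b c, δ a (R b c) - R b ⁅a, c⁆ - R ⁅a, b⁆ c - (δ b (R a c) - δ c (R a b) - R a ⁅b, c⁆)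
      = 0) : d δ (form2 R) = 0 := by
  refine ext_ins (by simp) fun a => ext_ins ?_ fun b => ext_ins ?_ fun c => ?_
  · simp [ins_d, lieD_form2, d_form1]
  · simp [ins_d, lieD_form2, d_form1]
  · simp only [ins_d, ins_form2, lieD_form2, ins_form1, map_sub, d_form1]
    exact ext_ins (by simpa using h a b c) fun c => by simp

end Differential

end Cochain

/-! ### Algebraic Chern-Weil theory -/

namespace Cochain

section Curved

variable {L B : Type*} [LieRing L] [Ring B]

/-- The operators `δ a` are derivations of the ring `B` with curvature `R`, and `R` satisfies the
Bianchi identity. -/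
structure IsCurved (δ : L → B →+ B) (R : L → L → B) : Prop where
  leibniz : ∀ a x y, δ a (x * y) = δ a x * y + x * δ a y
  comm : ∀ a b x, δ a (δ b x) - δ b (δ a x) - δ ⁅a, b⁆ x = R a b * x - x * R a b
  bianchi : d δ (form2 R) = 0

/-- The commutator with `b`. -/
def ad (b : B) : B →+ B := AddMonoidHom.mulLeft b - AddMonoidHom.mulRight b

@[simp] theorem ad_apply (b x : B) : ad b x = b * x - x * b := rfl

theorem lieD_add_ad (δ : L → B →+ B) (θ : L → B) (a : L) (f : Cochain L B) :
    lieD (fun a => δ a + ad (θ a)) a f = lieD δ a f + (form0 (θ a) * f - f * form0 (θ a)) := by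
  refine ext_apply fun l => ?_
  induction l generalizing f with
  | nil => simp
  | cons b l ih =>
    change ins b (lieD (fun a => δ a + ad (θ a)) a f) l =
      ins b (lieD δ a f + (form0 (θ a) * f - f * form0 (θ a))) l
    rw [ins_lieD, sub_apply, ih, map_add, ins_lieD, map_sub, ins_mul, ins_mul]
    simp
    abel

/-- The differential of a connection which is changed by a form of degree one. -/
theorem d_add_ad (δ : L → B →+ B) (θ : L → B) (f : Cochain L B) :
    d (fun a => δ a + ad (θ a)) f = d δ f + (form1 θ * f - bar f * form1 θ) := by
  refine ext_apply fun l => ?_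
  induction l generalizing f with
  | nil => simp
  | cons b l ih =>
    change ins b (d (fun a => δ a + ad (θ a)) f) l =
      ins b (d δ f + (form1 θ * f - bar f * form1 θ)) l
    rw [ins_d, sub_apply, ih, map_add, ins_d, map_sub, ins_mul, ins_mul, lieD_add_ad]
    simp only [ins_form1, bar_form1, ins_bar, bar_bar, add_apply, sub_apply, neg_mul, neg_apply]
    abel

/-- The square of the covariant differential is the commutator with the curvature. Degree one is all
that the Bianchi identity for a changed connection requires. -/
theorem d_d_form1 {δ : L → B →+ B} {R : L → L → B} (h : IsCurved δ R) (θ : L →+ B) :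
    d δ (d δ (form1 θ)) = form2 R * form1 θ - form1 θ * form2 R := by
  rw [d_form1]
  have e1 : (form2 fun a b => δ a (θ b) - δ b (θ a) - θ ⁅a, b⁆ : Cochain L B) [] = 0 := rfl
  refine ext_ins (by simp) fun a => ext_ins (by simp [ins_d, ins_mul, lieD_form2, d_form1])
    fun b => ext_ins ?_ fun c => ?_
  · simp [ins_d, ins_mul, lieD_form2, d_form1]
  · simp only [ins_d, ins_form2, lieD_form2, ins_form1, map_sub, d_form1, ins_mul, bar_form2,
      bar_form1, bar_form0, map_add, ins_form0, neg_mul, map_neg, zero_mul, mul_zero]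
    refine ext_ins ?_ fun c => ?_
    · have h1 := h.comm a b (θ c)
      have h2 := h.comm a c (θ b)
      have h3 := h.comm b c (θ a)
      -- The Jacobi identity cancels the terms in which `θ` is applied to double brackets; this is
      -- where additivity of `θ` enters.
      have hj : θ ⁅⁅a, b⁆, c⁆ = θ ⁅a, ⁅b, c⁆⁆ - θ ⁅b, ⁅a, c⁆⁆ := by
        rw [lie_lie, map_sub]
      simp only [sub_apply, form0_nil, add_apply, neg_apply, mul_nil, zero_apply, hj]
      rw [sub_sub, sub_eq_iff_eq_add] at h1 h2 h3
      rw [h1, h2, h3]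
      abel
    · simp [ins_mul]

/-- The curvature `R + dθ + θ²` of the sum of a connection and a form of degree one. -/
def twCurv (δ : L → B →+ B) (R : L → L → B) (θ : L → B) : Cochain L B :=
  form2 R + d δ (form1 θ) + form1 θ * form1 θ

theorem bar_twCurv (δ : L → B →+ B) (R : L → L → B) (θ : L → B) :
    bar (twCurv δ R θ) = twCurv δ R θ := by
  rw [twCurv, map_add, map_add, bar_mul, bar_form2, d_form1, bar_form2, bar_form1, neg_mul_neg]

/-- The Bianchi identity for ∇ + θ: the terms [θ, R], [θ, dθ] and [θ, θ²] cancel against d²θ and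
d(θ²). -/
theorem IsCurved.d_twCurv {δ : L → B →+ B} {R : L → L → B} (h : IsCurved δ R) (θ : L →+ B) :
    d (fun a => δ a + ad (θ a)) (twCurv δ R θ) = 0 := by
  rw [d_add_ad, bar_twCurv, twCurv, map_add, map_add, h.bianchi, d_d_form1 h, d_mul δ h.leibniz,
    bar_form1]
  noncomm_ring

theorem IsCurved.leibniz_add_ad {δ : L → B →+ B} {R : L → L → B} (h : IsCurved δ R) (b : B)
    (a : L) (x y : B) : (δ a + ad b) (x * y) = (δ a + ad b) x * y + x * (δ a + ad b) y := by
  simp only [AddMonoidHom.add_apply, ad_apply, h.leibniz, sub_mul, mul_sub, add_mul, mul_add,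
    mul_assoc]
  abel

variable {C : Type*} [Ring C]

/-- A parallel trace turns the covariant differential into the scalar one, and the covariantly
closed factor `R ^ n` contributes nothing. -/
theorem d_trace_mul_pow {δ : L → B →+ B} (hδ : ∀ a x y, δ a (x * y) = δ a x * y + x * δ a y)
    {R : Cochain L B} (hR : d δ R = 0) {ρ : L → C →+ C} (τ : B →+ C)
    (hτ : ∀ a x, τ (δ a x) = ρ a (τ x)) (f : Cochain L B) (n : ℕ) :
    d ρ (mapCo τ (f * R ^ n)) = mapCo τ (d δ f * R ^ n) := by
  rw [← mapCo_d τ δ ρ hτ, d_mul δ hδ, d_pow_of_closed δ hδ hR, mul_zero, add_zero]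

theorem mapCo_mul_of_derivation (D : B →+ B) (hD : ∀ x y, D (x * y) = D x * y + x * D y)
    (f g : Cochain L B) : mapCo D (f * g) = mapCo D f * g + f * mapCo D g := by
  refine ext_apply fun l => ?_
  induction l generalizing f g with
  | nil => exact hD _ _
  | cons a l ih =>
    rw [mapCo_apply, mul_cons, map_add, add_apply, mul_cons, mul_cons, ins_mapCo, ins_mapCo,
      bar_mapCo, ← mapCo_apply, ← mapCo_apply D (bar f * _), ih, ih, add_apply, add_apply]
    abel

/-- The variation of the curvature along θ' is the covariant differential of θ': from dθ + θ² one
gets dθ' + θ'θ + θθ', and the last two terms are the graded commutator with θ. -/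
theorem mapCo_twCurv (D : B →+ B) (hD : ∀ x y, D (x * y) = D x * y + x * D y) {δ : L → B →+ B}
    {R : L → L → B} {θ θ' : L → B} (hδ : ∀ a x, D (δ a x) = δ a (D x)) (hR : ∀ a b, D (R a b) = 0)
    (hθ : ∀ a, D (θ a) = θ' a) :
    mapCo D (twCurv δ R θ) = d (fun a => δ a + ad (θ a)) (form1 θ') := by
  have h2 : (form2 fun _ _ => 0 : Cochain L B) = 0 := ext_ins rfl fun a => by simp
  rw [twCurv, map_add, map_add, mapCo_form2, mapCo_d _ δ δ hδ, mapCo_mul_of_derivation D hD,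
    mapCo_form1, d_add_ad, bar_form1]
  simp only [hR, hθ, h2, zero_add, neg_mul, sub_neg_eq_add]
  abel

/-- For an operator which is a derivation on products with an even first factor, such as the
insertion of a vector or a derivation of the coefficients. -/
theorem trace_derivation_pow (D : Cochain L B →+ Cochain L B)
    (hD : ∀ f g, bar f = f → D (f * g) = D f * g + f * D g)
    (τ : B →+ C) (hτ : ∀ x y, τ (x * y) = τ (y * x)) {R : Cochain L B} (hR : bar R = R) (n : ℕ) :
    mapCo τ (D (R ^ (n + 1))) = (n + 1) • mapCo τ (D R * R ^ n) := by
  -- A trailing power has to be carried along: the induction splits off the last factor, and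
  -- cyclicity moves the powers in front of `D R` behind it.
  have key : ∀ m k : ℕ, mapCo τ (D (R ^ (m + 1)) * R ^ k) =
      (m + 1) • mapCo τ (D R * R ^ (m + k)) := by
    intro m
    induction m with
    | zero => intro k; simp
    | succ m ih =>
      intro k
      have h1 : mapCo τ (R ^ (m + 1) * D R * R ^ k) =
          mapCo τ (D R * R ^ (m + 1 + k)) := by
        refine ext_apply fun l => ?_
        rw [mapCo_apply, mapCo_apply, mul_assoc,
          trace_mul_comm τ hτ (bar_pow_of_even hR (m + 1)), mul_assoc, ← pow_add, add_comm k]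
      rw [pow_succ R (m + 1), hD _ _ (bar_pow_of_even hR (m + 1)), add_mul, map_add, h1, mul_assoc,
        ← pow_succ', ih, add_right_comm, ← add_assoc, succ_nsmul _ (m + 1)]
  simpa using key n 0

end Curved

/-! ### Polynomial families -/
section Families

open TensorProduct Polynomial

/-- The integral of a polynomial over the unit interval. -/
def polyInt : ℝ[X] →ₗ[ℝ] ℝ where
  toFun p := ∫ t in (0 : ℝ)..1, p.eval t
  map_add' p q := by
    simp only [eval_add]
    exact intervalIntegral.integral_add (p.continuous.intervalIntegrable _ _)
      (q.continuous.intervalIntegrable _ _)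
  map_smul' c p := by
    simp only [eval_smul, smul_eq_mul, RingHom.id_apply]
    exact intervalIntegral.integral_const_mul _ _

theorem polyInt_derivative (p : ℝ[X]) : polyInt (derivative p) = p.eval 1 - p.eval 0 :=
  intervalIntegral.integral_eq_sub_of_hasDerivAt (fun t _ => p.hasDerivAt t)
    ((derivative p).continuous.intervalIntegrable _ _)

variable {B C : Type*} [Ring B] [Algebra ℝ B] [Ring C] [Algebra ℝ C]

variable (B) in
/-- The derivative of a polynomial family. -/
def famDeriv : ℝ[X] ⊗[ℝ] B →ₗ[ℝ] ℝ[X] ⊗[ℝ] B := LinearMap.rTensor B derivative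

variable (B) in
/-- The integral of a polynomial family over the unit interval. -/
def famInt : ℝ[X] ⊗[ℝ] B →ₗ[ℝ] B := TensorProduct.lid ℝ B ∘ₗ LinearMap.rTensor B polyInt

variable (B) in
/-- The value of a polynomial family. -/
def famEval (t : ℝ) : ℝ[X] ⊗[ℝ] B →ₐ[ℝ] B :=
  (Algebra.TensorProduct.lid ℝ B).toAlgHom.comp
    (Algebra.TensorProduct.map (Polynomial.aeval t) (AlgHom.id ℝ B))

@[simp] theorem famDeriv_tmul (p : ℝ[X]) (b : B) :
    famDeriv B (p ⊗ₜ b) = derivative p ⊗ₜ b := rfl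

@[simp] theorem famInt_tmul (p : ℝ[X]) (b : B) : famInt B (p ⊗ₜ b) = polyInt p • b := rfl

@[simp] theorem famEval_tmul (t : ℝ) (p : ℝ[X]) (b : B) :
    famEval B t (p ⊗ₜ b) = p.eval t • b := by
  simp [famEval, Polynomial.aeval_def, Polynomial.eval₂_eq_eval_map]

theorem famInt_famDeriv (q : ℝ[X] ⊗[ℝ] B) :
    famInt B (famDeriv B q) = famEval B 1 q - famEval B 0 q := by
  induction q with
  | zero => simp
  | tmul p b => simp [polyInt_derivative, sub_smul]
  | add x y hx hy =>
    simp only [map_add, hx, hy]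
    abel

/-- The reason for formal polynomial families: the coefficient rings carry no topology, yet R_t is
polynomial in t, and in the tensor product integration commutes with every linear operator, with no
differentiation under the integral sign. -/
theorem famInt_lTensor (φ : B →ₗ[ℝ] C) (q : ℝ[X] ⊗[ℝ] B) :
    famInt C (φ.lTensor ℝ[X] q) = φ (famInt B q) := by
  induction q with
  | zero => simp
  | tmul p b => simp
  | add x y hx hy => simp only [map_add, hx, hy]

theorem famEval_lTensor (φ : B →ₗ[ℝ] C) (t : ℝ) (q : ℝ[X] ⊗[ℝ] B) :
    famEval C t (φ.lTensor ℝ[X] q) = φ (famEval B t q) := by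
  induction q with
  | zero => simp
  | tmul p b => simp
  | add x y hx hy => simp only [map_add, hx, hy]

/-- The formal integral becomes an honest one after applying a real functional, such as evaluation
of a function at a point. Continuity is proved alongside because additivity of the integral needs
integrability. -/
theorem famInt_eq_integral (φ : B →ₗ[ℝ] ℝ) (q : ℝ[X] ⊗[ℝ] B) :
    Continuous (fun t => φ (famEval B t q)) ∧
      φ (famInt B q) = ∫ t in (0 : ℝ)..1, φ (famEval B t q) := by
  induction q with
  | zero => simp [continuous_const]
  | tmul p b =>
    simp only [famEval_tmul, famInt_tmul, map_smul, smul_eq_mul]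
    exact ⟨p.continuous.mul continuous_const, (intervalIntegral.integral_mul_const _ _).symm⟩
  | add x y hx hy =>
    simp only [map_add]
    exact ⟨hx.1.add hy.1, by
      rw [hx.2, hy.2]
      exact (intervalIntegral.integral_add (hx.1.intervalIntegrable _ _)
        (hy.1.intervalIntegrable _ _)).symm⟩

theorem famDeriv_mul (x y : ℝ[X] ⊗[ℝ] B) :
    famDeriv B (x * y) = famDeriv B x * y + x * famDeriv B y := by
  induction x with
  | zero => simp
  | tmul p b =>
    induction y with
    | zero => simp
    | tmul q c => simp [Algebra.TensorProduct.tmul_mul_tmul, derivative_mul, add_tmul]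
    | add x y hx hy =>
      simp only [mul_add, map_add, hx, hy]
      abel
  | add x y hx hy =>
    simp only [add_mul, map_add, hx, hy]
    abel

theorem lTensor_leibniz (δ : B →ₗ[ℝ] B) (hδ : ∀ x y, δ (x * y) = δ x * y + x * δ y)
    (x y : ℝ[X] ⊗[ℝ] B) :
    δ.lTensor ℝ[X] (x * y) = δ.lTensor ℝ[X] x * y + x * δ.lTensor ℝ[X] y := by
  induction x with
  | zero => simp
  | tmul p b =>
    induction y with
    | zero => simp
    | tmul q c => simp [Algebra.TensorProduct.tmul_mul_tmul, hδ, tmul_add]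
    | add x y hx hy =>
      simp only [mul_add, map_add, hx, hy]
      abel
  | add x y hx hy =>
    simp only [add_mul, map_add, hx, hy]
    abel

theorem lTensor_trace (τ : B →ₗ[ℝ] C) (hτ : ∀ x y, τ (x * y) = τ (y * x)) (x y : ℝ[X] ⊗[ℝ] B) :
    τ.lTensor ℝ[X] (x * y) = τ.lTensor ℝ[X] (y * x) := by
  induction x with
  | zero => simp
  | tmul p b =>
    induction y with
    | zero => simp
    | tmul q c => simp [Algebra.TensorProduct.tmul_mul_tmul, hτ b c, mul_comm p q]
    | add x y hx hy => simp only [mul_add, add_mul, map_add, hx, hy]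
  | add x y hx hy => simp only [mul_add, add_mul, map_add, hx, hy]

theorem famDeriv_lTensor (δ : B →ₗ[ℝ] C) (x : ℝ[X] ⊗[ℝ] B) :
    famDeriv C (δ.lTensor ℝ[X] x) = δ.lTensor ℝ[X] (famDeriv B x) := by
  induction x with
  | zero => simp
  | tmul p b => simp
  | add x y hx hy => simp only [map_add, hx, hy]

variable {L : Type*} [LieRing L]

/-- The extension of operators on `B` to polynomial families. -/
def famOp (δ : L → B →ₗ[ℝ] B) (a : L) : ℝ[X] ⊗[ℝ] B →+ ℝ[X] ⊗[ℝ] B :=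
  ((δ a).lTensor ℝ[X]).toAddMonoidHom

theorem famOp_apply (δ : L → B →ₗ[ℝ] B) (a : L) (x : ℝ[X] ⊗[ℝ] B) :
    famOp δ a x = (δ a).lTensor ℝ[X] x := rfl

theorem IsCurved.fam {δ : L → B →ₗ[ℝ] B} {R : L → L → B}
    (h : IsCurved (fun a => (δ a).toAddMonoidHom) R) :
    IsCurved (famOp δ) fun a b => (1 : ℝ[X]) ⊗ₜ[ℝ] R a b where
  leibniz a x y := lTensor_leibniz (δ a) (h.leibniz a) x y
  comm a b x := by
    simp only [famOp_apply]
    induction x with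
    | zero => simp
    | tmul p c =>
      have := h.comm a b c
      simp only [LinearMap.toAddMonoidHom_coe] at this
      simp [Algebra.TensorProduct.tmul_mul_tmul, ← tmul_sub, this]
    | add x y hx hy =>
      simp only [mul_add, add_mul, map_add]
      rw [add_sub_add_comm, add_sub_add_comm, hx, hy, add_sub_add_comm]
  bianchi := by
    -- The constant family of curvatures is the image of `R` under a map intertwining the operators,
    -- so its Bianchi identity is inherited.
    have h1 := mapCo_d (Algebra.TensorProduct.includeRight (R := ℝ) (A := ℝ[X])
      (B := B)).toLinearMap.toAddMonoidHom (fun a => (δ a).toAddMonoidHom) (famOp δ)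
      (fun a x => by simp [famOp_apply]) (form2 R)
    rw [h.bianchi, map_zero, mapCo_form2] at h1
    exact h1.symm

/-- The family of forms `t • θ`, of degree one. -/
def famTheta (θ : L →+ B) : L →+ ℝ[X] ⊗[ℝ] B :=
  ((TensorProduct.mk ℝ ℝ[X] B X).toAddMonoidHom).comp θ

theorem famTheta_apply (θ : L →+ B) (a : L) : famTheta θ a = X ⊗ₜ θ a := rfl

/-- The constant family of forms of degree one. -/
def conTheta (θ : L →+ B) : L →+ ℝ[X] ⊗[ℝ] B :=
  ((TensorProduct.mk ℝ ℝ[X] B 1).toAddMonoidHom).comp θ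

theorem conTheta_apply (θ : L →+ B) (a : L) : conTheta θ a = 1 ⊗ₜ θ a := rfl

/-- The family of curvatures `R + t dθ + t² θ²`. -/
def famCurv (δ : L → B →ₗ[ℝ] B) (R : L → L → B) (θ : L →+ B) : Cochain L (ℝ[X] ⊗[ℝ] B) :=
  twCurv (famOp δ) (fun a b => (1 : ℝ[X]) ⊗ₜ[ℝ] R a b) (famTheta θ)

theorem bar_famCurv (δ : L → B →ₗ[ℝ] B) (R : L → L → B) (θ : L →+ B) :
    bar (famCurv δ R θ) = famCurv δ R θ := bar_twCurv _ _ _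

/-- This is ∂_t R_t = d_{∇_t} θ: the t-derivative of the family t • θ is the constant family θ. -/
theorem famDeriv_famCurv {δ : L → B →ₗ[ℝ] B} {R : L → L → B} (θ : L →+ B) :
    mapCo (famDeriv B).toAddMonoidHom (famCurv δ R θ) =
      d (fun a => famOp δ a + ad (famTheta θ a)) (form1 (conTheta θ)) :=
  mapCo_twCurv _ famDeriv_mul (fun a x => famDeriv_lTensor (δ a) x) (fun a b => by simp)
    (fun a => by simp [famTheta_apply, conTheta_apply])

/-- The Chern-Simons cochain `∫ (n + 1) τ(θ (R + t dθ + t² θ²) ^ n)` over the unit interval. -/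
def csCo (δ : L → B →ₗ[ℝ] B) (R : L → L → B) (θ : L →+ B) (τ : B →ₗ[ℝ] C) (n : ℕ) :
    Cochain L C :=
  (n + 1) • mapCo ((famInt C).toAddMonoidHom.comp (τ.lTensor ℝ[X]).toAddMonoidHom)
    (form1 (conTheta θ) * famCurv δ R θ ^ n)

/-- The transgression formula. -/
theorem d_csCo {δ : L → B →ₗ[ℝ] B} {R : L → L → B}
    (h : IsCurved (fun a => (δ a).toAddMonoidHom) R) (θ : L →+ B) (τ : B →ₗ[ℝ] C)
    (hτ : ∀ x y, τ (x * y) = τ (y * x)) {ρ : L → C →ₗ[ℝ] C} (hρ : ∀ a x, τ (δ a x) = ρ a (τ x))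
    (n : ℕ) (l : List L) :
    d (fun a => (ρ a).toAddMonoidHom) (csCo δ R θ τ n) l =
      τ (famEval B 1 ((famCurv δ R θ ^ (n + 1)) l)) -
        τ (famEval B 0 ((famCurv δ R θ ^ (n + 1)) l)) := by
  set τX : ℝ[X] ⊗[ℝ] B →+ ℝ[X] ⊗[ℝ] C := (τ.lTensor ℝ[X]).toAddMonoidHom with hτX
  have hcyc : ∀ x y, τX (x * y) = τX (y * x) := lTensor_trace τ hτ
  -- The commutator with t • θ is invisible to the trace, so the trace is parallel for every ∇_t and
  -- not only at t = 0.
  have hcomp : ∀ a x, τX ((famOp δ a + ad (famTheta θ a)) x) = famOp ρ a (τX x) := by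
    intro a x
    rw [AddMonoidHom.add_apply, ad_apply, map_add, map_sub, hcyc, sub_self, add_zero, famOp_apply,
      famOp_apply]
    simp only [hτX, LinearMap.toAddMonoidHom_coe, ← LinearMap.comp_apply, ← LinearMap.lTensor_comp]
    congr 2
    exact LinearMap.ext (hρ a)
  have htr : d (famOp ρ) (mapCo τX (form1 (conTheta θ) * famCurv δ R θ ^ n)) = mapCo τX
      (d (fun a => famOp δ a + ad (famTheta θ a)) (form1 (conTheta θ)) * famCurv δ R θ ^ n) :=
    d_trace_mul_pow (fun a => h.fam.leibniz_add_ad _ a) (h.fam.d_twCurv (famTheta θ)) τX hcomp _ n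
  -- Combine (n + 1) τ(d_{∇_t} θ R_t ^ n) = ∂_t τ(R_t ^ (n + 1)) with the fact that the integral
  -- commutes with `d`. The fundamental theorem of calculus for polynomials then yields the two
  -- endpoint values.
  have hd : d (fun a => (ρ a).toAddMonoidHom) (csCo δ R θ τ n) =
      mapCo (famInt C).toAddMonoidHom (mapCo τX (mapCo (famDeriv B).toAddMonoidHom
        (famCurv δ R θ ^ (n + 1)))) := by
    rw [trace_derivation_pow _ (fun f g _ => mapCo_mul_of_derivation _ famDeriv_mul f g) τX hcyc
        (bar_famCurv δ R θ), famDeriv_famCurv,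
      ← htr, map_nsmul, csCo, map_nsmul,
      mapCo_d (famInt C).toAddMonoidHom (famOp ρ) (fun a => (ρ a).toAddMonoidHom)
        (fun a x => famInt_lTensor (ρ a) x)]
    rfl
  rw [hd]
  simp only [mapCo_apply, hτX, LinearMap.toAddMonoidHom_coe]
  rw [← famDeriv_lTensor, famInt_famDeriv, famEval_lTensor, famEval_lTensor]

theorem mapHom_famEval_famCurv (δ : L → B →ₗ[ℝ] B) (R : L → L → B) (θ : L →+ B) (t : ℝ) :
    mapHom (famEval B t).toRingHom (famCurv δ R θ) = form2 fun a b =>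
      R a b + t • (δ a (θ b) - δ b (θ a) - θ ⁅a, b⁆) + t ^ 2 • (θ a * θ b - θ b * θ a) := by
  rw [famCurv, twCurv, map_add, map_add, map_mul, mapHom_form2, d_form1, mapHom_form2, mapHom_form1,
    form1_mul_form1]
  refine ext_ins (by simp) fun a => ?_
  rw [map_add, map_add, ins_form2, ins_form2, ins_form2, ins_form2]
  refine ext_ins (by simp) fun b => ?_
  rw [map_add, map_add, ins_form1, ins_form1, ins_form1, ins_form1]
  refine ext_ins ?_ fun c => by simp
  simp only [add_apply, form0_nil, AlgHom.toRingHom_eq_coe, RingHom.coe_coe, famEval_tmul,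
    famTheta_apply, famOp_apply, LinearMap.lTensor_tmul, map_sub, eval_X, eval_one, one_smul,
    smul_mul_smul_comm, smul_sub, pow_two]

theorem famEval_famCurv_pow (δ : L → B →ₗ[ℝ] B) (R : L → L → B) (θ : L →+ B) (t : ℝ) (n : ℕ)
    (l : List L) : famEval B t ((famCurv δ R θ ^ n) l) = ((form2 fun a b => R a b +
      t • (δ a (θ b) - δ b (θ a) - θ ⁅a, b⁆) + t ^ 2 • (θ a * θ b - θ b * θ a)) ^ n :
        Cochain L B) l := by
  rw [← mapHom_famEval_famCurv, ← map_pow]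
  rfl

theorem csCo_eq_integral (δ : L → B →ₗ[ℝ] B) (R : L → L → B) (θ : L →+ B) (τ : B →ₗ[ℝ] C) (n : ℕ)
    (φ : C →ₗ[ℝ] ℝ) (l : List L) : φ (csCo δ R θ τ n l) = ∫ t in (0 : ℝ)..1,
      (n + 1) • φ (τ ((form1 θ * (form2 fun a b => R a b +
        t • (δ a (θ b) - δ b (θ a) - θ ⁅a, b⁆) + t ^ 2 • (θ a * θ b - θ b * θ a)) ^ n :
          Cochain L B) l)) := by
  have h1 : csCo δ R θ τ n l = (n + 1) • famInt C (τ.lTensor ℝ[X]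
      ((form1 (conTheta θ) * famCurv δ R θ ^ n) l)) := rfl
  rw [h1, map_nsmul, (famInt_eq_integral φ _).2]
  simp only [nsmul_eq_mul]
  rw [← intervalIntegral.integral_const_mul]
  congr 1
  funext t
  rw [famEval_lTensor, ← mapHom_famEval_famCurv]
  have h2 : (form1 θ : Cochain L B) =
      mapHom (famEval B t).toRingHom (form1 (conTheta θ)) := by
    rw [mapHom_form1]
    congr 1
    funext a
    simp [conTheta_apply]
  rw [h2, ← map_pow, ← map_mul]
  rfl

end Families

end Cochain

/-! ### Cochains and alternating maps -/

namespace Cochain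

/-! ### Comparison of Cartan's recursion with the Koszul formula -/

section Koszul

variable {L : Type*} [LieRing L] {C : Type*} [Ring C]

theorem lieD_ofFn (δ : L → C →+ C) (x : L) {n : ℕ} (f : Cochain L C) (a : Fin n → L) :
    lieD δ x f (List.ofFn a) = δ x (f (List.ofFn a)) -
      ∑ j, f (List.ofFn (Function.update a j ⁅x, a j⁆)) := by
  induction n generalizing f with
  | zero => simp
  | succ n ih =>
    have h : lieD δ x f (List.ofFn a) = lieD δ x (ins (a 0) f) (List.ofFn (Fin.tail a)) -
        f (⁅x, a 0⁆ :: List.ofFn (Fin.tail a)) := by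
      rw [List.ofFn_succ]
      rfl
    rw [h, ih, Fin.sum_univ_succ]
    have h1 : List.ofFn (Function.update a 0 ⁅x, a 0⁆) = ⁅x, a 0⁆ :: List.ofFn (Fin.tail a) := by
      rw [List.ofFn_succ, Function.update_self]
      rfl
    have h2 : ∀ j : Fin n, List.ofFn (Function.update a j.succ ⁅x, a j.succ⁆) =
        a 0 :: List.ofFn (Function.update (Fin.tail a) j ⁅x, Fin.tail a j⁆) := by
      intro j
      rw [List.ofFn_succ, Function.update_of_ne (Fin.succ_ne_zero j).symm]
      congr 2
      exact Fin.tail_update_succ a j _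
    simp only [h1, h2, ins_apply]
    rw [List.ofFn_succ]
    change _ = δ x (f (a 0 :: List.ofFn (Fin.tail a))) - _
    abel

theorem removeNth_succ_cons {α : Type*} {n : ℕ} (k : Fin (n + 1)) (x : α) (v : Fin (n + 1) → α) :
    k.succ.removeNth (Fin.cons x v : Fin (n + 2) → α) = Fin.cons x (k.removeNth v) := by
  funext i
  refine Fin.cases ?_ (fun i => ?_) i
  · simp [Fin.removeNth]
  · simp [Fin.removeNth]

end Koszul

section ExtD

variable {EN : Type*} [NormedAddCommGroup EN] [NormedSpace ℝ EN]
  {H : Type*} [TopologicalSpace H] {I : ModelWithCorners ℝ EN H}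
  {N : Type*} [TopologicalSpace N] [ChartedSpace H N]
  {L : Type*} [LieRing L] [LieAlgebra ℝ L]

theorem map_cons_cons {n : ℕ} (η : L [⋀^Fin (n + 2)]→ₗ[ℝ] C^∞⟮I, N; ℝ⟯) (x y : L) (v : Fin n → L) :
    η (Fin.cons x (Fin.cons y v)) = -η (Fin.cons y (Fin.cons x v)) := by
  have h := η.map_swap (Fin.cons y (Fin.cons x v)) (i := 0) (j := 1) (by simp)
  rw [← h]
  congr 1
  funext i
  refine Fin.cases ?_ (fun i => Fin.cases ?_ (fun i => ?_) i) i
  · simp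
  · rw [Function.comp_apply, Fin.succ_zero_eq_one, Equiv.swap_apply_right]
    rfl
  · rw [Function.comp_apply, Equiv.swap_apply_of_ne_of_ne]
    · rfl
    · exact Fin.succ_ne_zero _
    · rw [← Fin.succ_zero_eq_one]
      exact fun h => Fin.succ_ne_zero i (Fin.succ_injective _ h)

/-- The pairs containing the first index assemble to the bracket part of the Lie derivative along
`x`, the other pairs to the bracket sum of the contraction by `x`. This is the bracket part of
Cartan's formula. -/
theorem bracketSum_cons {n : ℕ} (η : L [⋀^Fin (n + 1)]→ₗ[ℝ] C^∞⟮I, N; ℝ⟯) (x : L)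
    (v : Fin (n + 1) → L) :
    bracketSum η (Fin.cons x v) = -(∑ j, η (Function.update v j ⁅x, v j⁆)) -
      bracketSum (η.curryLeft x) v := by
  -- Moving the bracket from the front to slot k costs (-1)^k; the remaining sign is that of the
  -- pair (0, k + 1).
  have h1 : ∀ k : Fin (n + 1), ((-1 : ℝ) ^ ((k : ℕ) + 1) • η (Fin.cons ⁅x, v k⁆ (k.removeNth v))) =
      -η (Function.update v k ⁅x, v k⁆) := by
    intro k
    have := η.neg_one_pow_smul_map_insertNth k ⁅x, v k⁆ (k.removeNth v)
    rw [Fin.insertNth_removeNth] at this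
    change _ = η (Fin.cons ⁅x, v k⁆ (k.removeNth v)) at this
    rw [← this]
    rcases Nat.even_or_odd (k : ℕ) with h | h <;> simp [h.neg_one_pow, pow_succ]
  simp only [bracketSum]
  rw [Fin.sum_univ_succ]
  have h0 : (∑ i : Fin (n + 1), if i.castSucc < 0 then
      (-1 : ℝ) ^ ((i : ℕ) + ((0 : Fin (n + 2)) : ℕ)) •
        η (Fin.cons ⁅(Fin.cons x v : Fin (n + 2) → L) i.castSucc, (Fin.cons x v : Fin (n + 2) → L) 0⁆
          (i.removeNth ((0 : Fin (n + 2)).removeNth (Fin.cons x v : Fin (n + 2) → L)))) else 0) = 0 :=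
    Finset.sum_eq_zero fun i _ => if_neg (Fin.not_lt_zero _)
  rw [h0, zero_add]
  cases n with
  | zero => simpa [bracketSum, removeNth_succ_cons] using h1 0
  | succ n =>
    simp only [← Finset.sum_neg_distrib]
    rw [← Finset.sum_sub_distrib]
    refine Finset.sum_congr rfl fun k _ => ?_
    rw [Fin.sum_univ_succ, if_pos (by simp), sub_eq_add_neg, ← Finset.sum_neg_distrib]
    congr 1
    · rw [← h1 k, removeNth_succ_cons]
      simp [Fin.tail_cons]
    · refine Finset.sum_congr rfl fun i _ => ?_
      have h2 : (i.succ.castSucc < k.succ) ↔ (i.castSucc < k) := by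
        rw [← Fin.succ_castSucc, Fin.succ_lt_succ_iff]
      simp only [h2]
      split_ifs
      -- The bracket stands before `x`, whereas the contraction expects `x` first: exchanging them
      -- gives the minus sign, while shifting both indices by one leaves the parity of their sum
      -- unchanged.
      · rw [removeNth_succ_cons, removeNth_succ_cons, map_cons_cons, ← Fin.succ_castSucc,
          Fin.cons_succ, Fin.cons_succ, smul_neg]
        have h3 : (-1 : ℝ) ^ ((i.succ : ℕ) + (k.succ : ℕ)) = (-1) ^ ((i : ℕ) + (k : ℕ)) := by
          simp only [Fin.val_succ]
          ring
        rw [h3]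
        rfl
      · simp

theorem extD_apply (ρ : L →ₗ⁅ℝ⁆ Derivation ℝ C^∞⟮I, N; ℝ⟯ C^∞⟮I, N; ℝ⟯) {n : ℕ}
    (η : L [⋀^Fin n]→ₗ[ℝ] C^∞⟮I, N; ℝ⟯) (a : Fin (n + 1) → L) : extD ρ n η a =
      (∑ i : Fin (n + 1), (-1 : ℝ) ^ (i : ℕ) • ρ (a i) (η (i.removeNth a))) + bracketSum η a := rfl

/-- The Koszul formula for the differential agrees with the recursive Cartan formula. -/
theorem d_ofFn_eq_extD (ρ : L →ₗ⁅ℝ⁆ Derivation ℝ C^∞⟮I, N; ℝ⟯ C^∞⟮I, N; ℝ⟯) {n : ℕ}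
    (f : Cochain L C^∞⟮I, N; ℝ⟯) (η : L [⋀^Fin n]→ₗ[ℝ] C^∞⟮I, N; ℝ⟯)
    (h : ∀ a, f (List.ofFn a) = η a) (a : Fin (n + 1) → L) :
    d (fun a => (ρ a).toLinearMap.toAddMonoidHom) f (List.ofFn a) = extD ρ n η a := by
  induction n generalizing f with
  | zero =>
    have h0 : f [] = η (Fin.removeNth 0 a) := by
      rw [← h]
      rfl
    have h1 : d (fun a => (ρ a).toLinearMap.toAddMonoidHom) f (List.ofFn a) = ρ (a 0) (f []) := by
      rw [List.ofFn_succ, List.ofFn_zero]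
      exact sub_zero _
    rw [h1, extD_apply, Fin.sum_univ_one, h0, Fin.val_zero, pow_zero, one_smul, bracketSum,
      add_zero]
  | succ n ih =>
    rw [← Fin.cons_self_tail a]
    generalize a 0 = x
    generalize Fin.tail a = v
    have h1 : d (fun a => (ρ a).toLinearMap.toAddMonoidHom) f (List.ofFn (Fin.cons x v)) =
        lieD (fun a => (ρ a).toLinearMap.toAddMonoidHom) x f (List.ofFn v) -
          d (fun a => (ρ a).toLinearMap.toAddMonoidHom) (ins x f) (List.ofFn v) := by
      rw [List.ofFn_succ]
      rfl
    have h2 : ∀ b : Fin n → L, ins x f (List.ofFn b) = η.curryLeft x b := by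
      intro b
      have := h (Fin.cons x b)
      rw [List.ofFn_succ] at this
      exact this
    -- Both sides now consist of the derivative of `η v` along `x`, the brackets with `x`, and the
    -- differential of the contraction.
    rw [h1, lieD_ofFn, ih (ins x f) (η.curryLeft x) h2, extD_apply, extD_apply, bracketSum_cons,
      Fin.sum_univ_succ (n := n + 1)]
    simp only [h, removeNth_succ_cons, Fin.cons_zero, Fin.cons_succ, Fin.removeNth_zero,
      Fin.tail_cons, Fin.val_zero, pow_zero, one_smul, Fin.val_succ]
    have h4 : (∑ i : Fin (n + 1), (-1 : ℝ) ^ ((i : ℕ) + 1) •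
        ρ (v i) (η (Fin.cons x (i.removeNth v)))) =
        -∑ i : Fin (n + 1), (-1 : ℝ) ^ (i : ℕ) • ρ (v i) (η.curryLeft x (i.removeNth v)) := by
      rw [← Finset.sum_neg_distrib]
      refine Finset.sum_congr rfl fun i _ => ?_
      rw [pow_succ, mul_neg_one, neg_smul]
      rfl
    have h5 : ((ρ x).toLinearMap.toAddMonoidHom : C^∞⟮I, N; ℝ⟯ →+ C^∞⟮I, N; ℝ⟯) (η v) =
      ρ x (η v) := rfl
    rw [h4, h5]
    abel

end ExtD

/-! ### Alternatization of a multilinear map, one argument at a time -/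

section Alternatization

variable {L : Type*} {B : Type*} [Ring B]

/-- The alternating sum over the arguments of a cochain which depends on a vector. -/
def altSumList : List L → (L → Cochain L B) → B
  | [], _ => 0
  | b :: l, F => F b l - altSumList l fun a => ins b (F a)

/-- The alternating sum `∑ i, (-1) ^ i • F (a i) (a 0, …, omit i, …)`. -/
def altSum (F : L → Cochain L B) : Cochain L B := ⟨fun l => altSumList l F⟩

@[simp] theorem altSum_nil (F : L → Cochain L B) : altSum F [] = 0 := rfl

theorem ins_altSum (b : L) (F : L → Cochain L B) :
    ins b (altSum F) = F b - altSum fun a => ins b (F a) := rfl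

theorem altSum_add (F G : L → Cochain L B) :
    altSum (fun a => F a + G a) = altSum F + altSum G := by
  refine ext_apply fun l => ?_
  induction l generalizing F G with
  | nil => simp
  | cons b l ih =>
    change ins b (altSum fun a => F a + G a) l = ins b (altSum F + altSum G) l
    rw [map_add, ins_altSum, ins_altSum, ins_altSum]
    simp only [map_add, sub_apply, add_apply, ih]
    abel

theorem altSum_form0_mul (θ : L → B) (g : Cochain L B) :
    altSum (fun a => form0 (θ a) * g) = form1 θ * g := by
  refine ext_apply fun l => ?_
  induction l generalizing g with
  | nil => simp
  | cons b l ih =>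
    change ins b (altSum fun a => form0 (θ a) * g) l = ins b (form1 θ * g) l
    rw [ins_altSum, ins_mul]
    simp only [ins_mul, ins_form0, zero_mul, zero_add, bar_form0, sub_apply, ih, ins_form1,
      bar_form1, neg_mul, add_apply, neg_apply]
    abel

theorem altSum_neg (F : L → Cochain L B) : altSum (fun a => -F a) = -altSum F := by
  have h0 : altSum (fun _ : L => (0 : Cochain L B)) = 0 := by
    have h := altSum_add (fun _ : L => (0 : Cochain L B)) (fun _ => 0)
    simpa using h
  have h := altSum_add F fun a => -F a
  simp only [add_neg_cancel, h0] at h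
  exact (neg_eq_of_add_eq_zero_right h.symm).symm

/-- Every pair of arguments of `R` occurs in both orders, and skew-symmetry makes the two
contributions equal. This doubling is the source of the factor 2 ^ p in the power of the curvature.
-/
theorem altSum_form1_mul {R : L → L → B} (hR : ∀ a b, R a b = -R b a) (g : Cochain L B) :
    altSum (fun a => form1 (R a) * g) = form2 R * g + form2 R * g := by
  refine ext_apply fun l => ?_
  induction l generalizing g with
  | nil => simp
  | cons b l ih =>
    change ins b (altSum fun a => form1 (R a) * g) l = ins b (form2 R * g + form2 R * g) l
    have h1 : altSum (fun a => form0 (R a b) * g) = -(form1 (R b) * g) := by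
      rw [← altSum_form0_mul, ← altSum_neg]
      congr 1
      funext a
      rw [hR a b]
      refine ext_apply fun m => ?_
      rw [neg_apply, form0_mul_apply, form0_mul_apply, neg_mul]
    rw [ins_altSum, map_add, ins_mul]
    simp only [ins_mul, ins_form1, bar_form1, neg_mul, ins_form2, bar_form2]
    rw [altSum_add, altSum_neg, h1, sub_apply, add_apply, neg_apply, neg_apply, ih]
    simp only [add_apply]
    abel

theorem altSum_ofFn {n : ℕ} (F : L → Cochain L B) (a : Fin (n + 1) → L) :
    altSum F (List.ofFn a) = ∑ i : Fin (n + 1), (-1) ^ (i : ℕ) * F (a i) (List.ofFn (i.removeNth a)) := by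
  induction n generalizing F with
  | zero => simp [altSum, altSumList]
  | succ n ih =>
    rw [← Fin.cons_self_tail a]
    generalize a 0 = x
    generalize Fin.tail a = v
    have h1 : altSum F (List.ofFn (Fin.cons x v : Fin (n + 2) → L)) = F x (List.ofFn v) -
        altSum (fun a => ins x (F a)) (List.ofFn v) := by
      rw [List.ofFn_succ]
      rfl
    rw [h1, ih, Fin.sum_univ_succ (n := n + 1), sub_eq_add_neg, ← Finset.sum_neg_distrib]
    congr 1
    · simp
    · refine Finset.sum_congr rfl fun i _ => ?_
      rw [removeNth_succ_cons, List.ofFn_succ]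
      simp [pow_succ, ins_apply]

variable [Algebra ℝ B] [AddCommGroup L] [Module ℝ L]

/-- Permutations are sorted by the image of 0, as in the Laplace expansion along the first argument.
-/
theorem alternatization_succ {n : ℕ} (f : MultilinearMap ℝ (fun _ : Fin (n + 1) => L) B)
    (a : Fin (n + 1) → L) : MultilinearMap.alternatization f a = ∑ i : Fin (n + 1),
      (-1) ^ (i : ℕ) * MultilinearMap.alternatization (f.curryLeft (a i)) (i.removeNth a) := by
  rw [MultilinearMap.alternatization_apply, ← Equiv.Perm.decomposeFin.symm.sum_comp,
    Fintype.sum_prod_type]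
  refine Finset.sum_congr rfl fun p _ => ?_
  have h1 : (∑ e : Equiv.Perm (Fin n), Equiv.Perm.sign (Equiv.Perm.decomposeFin.symm (p, e)) •
      f.domDomCongr (Equiv.Perm.decomposeFin.symm (p, e)) a) =
      (if p = 0 then 1 else -1 : ℤˣ) • MultilinearMap.alternatization (f.curryLeft (a p))
        fun x => a (Equiv.swap 0 p x.succ) := by
    rw [MultilinearMap.alternatization_apply, Finset.smul_sum]
    refine Finset.sum_congr rfl fun e _ => ?_
    rw [Equiv.Perm.decomposeFin.symm_sign, mul_smul]
    congr 2
    rw [MultilinearMap.domDomCongr_apply, MultilinearMap.domDomCongr_apply,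
      MultilinearMap.curryLeft_apply]
    congr 1
    funext i
    refine Fin.cases ?_ (fun i => ?_) i
    · simp
    · simp
  rw [h1]
  rcases Fin.eq_zero_or_eq_succ p with rfl | ⟨q, rfl⟩
  · simp
    rfl
  · obtain ⟨m, rfl⟩ : ∃ m, n = m + 1 := ⟨n - 1, by have := q.pos; omega⟩
    -- The transposition of 0 and q + 1 puts `a 0` in slot q of the remaining arguments. Its sign -1
    -- and the (-1)^q for bringing `a 0` back to the front give (-1)^(q + 1).
    have h2 : (fun x : Fin (m + 1) => a (Equiv.swap 0 q.succ x.succ)) =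
        q.insertNth (a 0) (q.removeNth (Fin.tail a)) := by
      rw [Fin.insertNth_removeNth]
      funext x
      by_cases hx : x = q
      · subst hx
        simp
      · rw [Function.update_of_ne hx, Equiv.swap_apply_of_ne_of_ne (Fin.succ_ne_zero x)
          fun h => hx (Fin.succ_injective _ h)]
        rfl
    rw [h2, AlternatingMap.map_insertNth, if_neg (Fin.succ_ne_zero q)]
    have h3 : q.succ.removeNth a = Matrix.vecCons (a 0) (q.removeNth (Fin.tail a)) := by
      conv_lhs => rw [← Fin.cons_self_tail a, removeNth_succ_cons]
      rfl
    rw [h3]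
    rcases Nat.even_or_odd (q : ℕ) with h | h <;> simp [h.neg_one_pow, pow_succ]

theorem alternatization_eq_altSum {n : ℕ} (f : MultilinearMap ℝ (fun _ : Fin (n + 1) => L) B)
    (F : L → Cochain L B)
    (h : ∀ x b, F x (List.ofFn b) = MultilinearMap.alternatization (f.curryLeft x) b)
    (a : Fin (n + 1) → L) : MultilinearMap.alternatization f a = altSum F (List.ofFn a) := by
  rw [alternatization_succ, altSum_ofFn]
  simp only [h]

end Alternatization

/-! ### Alternating multilinear cochains -/

section Multilinear

variable {L : Type*} [AddCommGroup L] [Module ℝ L] {B : Type*} [Ring B] [Algebra ℝ B]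
  {C : Type*} [Ring C] [Algebra ℝ C]

instance : SMul ℝ (Cochain L B) := ⟨fun c f => ⟨fun l => c • f l⟩⟩

@[simp] theorem smul_apply (c : ℝ) (f : Cochain L B) (l : List L) : (c • f) l = c • f l := rfl

theorem ins_smul (c : ℝ) (f : Cochain L B) (a : L) : ins a (c • f) = c • ins a f := rfl

theorem bar_smul (c : ℝ) (f : Cochain L B) : bar (c • f) = c • bar f :=
  ext_apply fun _ => mul_smul_comm _ _ _

theorem smul_mul' (c : ℝ) (f g : Cochain L B) : (c • f) * g = c • (f * g) := by
  refine ext_apply fun l => ?_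
  induction l generalizing f g with
  | nil => exact smul_mul_assoc _ _ _
  | cons a l ih =>
    rw [mul_cons, ins_smul, bar_smul, ih, ih, smul_apply, smul_apply, smul_apply, mul_cons,
      smul_add]

theorem mul_smul' (c : ℝ) (f g : Cochain L B) : f * (c • g) = c • (f * g) := by
  refine ext_apply fun l => ?_
  induction l generalizing f g with
  | nil => exact mul_smul_comm _ _ _
  | cons a l ih =>
    rw [mul_cons, ins_smul, ih, ih, smul_apply, smul_apply, smul_apply, mul_cons, smul_add]

/-- The cochain is linear in the first argument, and vanishes if the first two arguments agree. -/
structure IsAltHead (f : Cochain L B) : Prop where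
  add : ∀ a b, ins (a + b) f = ins a f + ins b f
  smul : ∀ (c : ℝ) a, ins (c • a) f = c • ins a f
  self : ∀ a, ins a (ins a f) = 0

/-- Insertion of a list of vectors. -/
def insList : List L → Cochain L B → Cochain L B
  | [], f => f
  | a :: l, f => insList l (ins a f)

/-- The cochain is multilinear and alternating. -/
def IsAlt (f : Cochain L B) : Prop := ∀ l, IsAltHead (insList l f)

theorem IsAlt.head {f : Cochain L B} (h : IsAlt f) : IsAltHead f := h []

theorem IsAlt.ins {f : Cochain L B} (h : IsAlt f) (a : L) : IsAlt (ins a f) := fun l => h (a :: l)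

theorem isAlt_of {f : Cochain L B} (h : IsAltHead f) (h' : ∀ a, IsAlt (Cochain.ins a f)) :
    IsAlt f := by
  intro l
  rcases l with _ | ⟨a, l⟩
  · exact h
  · exact h' a l

theorem insList_add (l : List L) (f g : Cochain L B) :
    insList l (f + g) = insList l f + insList l g := by
  induction l generalizing f g with
  | nil => rfl
  | cons a l ih => rw [insList, map_add, ih, insList, insList]

theorem insList_neg (l : List L) (f : Cochain L B) : insList l (-f) = -insList l f := by
  induction l generalizing f with
  | nil => rfl
  | cons a l ih => rw [insList, map_neg, ih, insList]

theorem IsAltHead.add' {f g : Cochain L B} (hf : IsAltHead f) (hg : IsAltHead g) :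
    IsAltHead (f + g) where
  add a b := by
    rw [map_add, hf.add, hg.add, map_add, map_add]
    abel
  smul c a := by
    rw [map_add, hf.smul, hg.smul, map_add]
    exact ext_apply fun l => (smul_add c _ _).symm
  self a := by rw [map_add, map_add, hf.self, hg.self, add_zero]

theorem IsAltHead.neg {f : Cochain L B} (hf : IsAltHead f) : IsAltHead (-f) where
  add a b := by
    rw [map_neg, hf.add, map_neg, map_neg]
    abel
  smul c a := by
    rw [map_neg, hf.smul, map_neg]
    exact ext_apply fun l => (smul_neg c _).symm
  self a := by rw [map_neg, map_neg, hf.self, neg_zero]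

theorem IsAlt.add {f g : Cochain L B} (hf : IsAlt f) (hg : IsAlt g) : IsAlt (f + g) := fun l => by
  rw [insList_add]
  exact (hf l).add' (hg l)

theorem IsAlt.neg {f : Cochain L B} (hf : IsAlt f) : IsAlt (-f) := fun l => by
  rw [insList_neg]
  exact (hf l).neg

theorem isAlt_zero : IsAlt (0 : Cochain L B) := by
  have h : ∀ l : List L, insList l (0 : Cochain L B) = 0 := fun l => by
    induction l with
    | nil => rfl
    | cons a l ih => exact ih
  intro l
  rw [h]
  exact ⟨fun a b => by simp, fun c _ => ext_apply fun _ => (smul_zero c).symm, fun _ => rfl⟩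

theorem IsAlt.nsmul {f : Cochain L B} (hf : IsAlt f) (n : ℕ) : IsAlt (n • f) := by
  induction n with
  | zero =>
    rw [zero_nsmul]
    exact isAlt_zero
  | succ n ih =>
    rw [succ_nsmul]
    exact ih.add hf

theorem IsAlt.bar {f : Cochain L B} (hf : IsAlt f) : IsAlt (bar f) := by
  intro l
  induction l generalizing f with
  | nil =>
    refine ⟨fun a b => ?_, fun c a => ?_, fun a => ?_⟩
    · rw [insList, ins_bar, hf.head.add, ins_bar, ins_bar, map_add, neg_add]
    · rw [insList, ins_bar, hf.head.smul, ins_bar, bar_smul]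
      exact ext_apply fun l => (smul_neg c _).symm
    · rw [insList, ins_bar, map_neg, ins_bar, hf.head.self, map_zero, neg_zero, neg_zero]
  | cons a l ih =>
    rw [insList, ins_bar, insList_neg]
    exact (ih (hf.ins a)).neg

theorem IsAlt.mul {f g : Cochain L B} (hf : IsAlt f) (hg : IsAlt g) : IsAlt (f * g) := by
  intro l
  induction l generalizing f g with
  | nil =>
    refine ⟨fun a b => ?_, fun c a => ?_, fun a => ?_⟩
    · simp only [insList, ins_mul, hf.head.add, hg.head.add, add_mul, mul_add]
      abel
    · simp only [insList, ins_mul, hf.head.smul, hg.head.smul, smul_mul', mul_smul']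
      exact ext_apply fun l => (smul_add c _ _).symm
    · simp only [insList, ins_mul, map_add, hf.head.self, hg.head.self, ins_bar, mul_zero, zero_mul,
        neg_mul]
      abel
  | cons a l ih =>
    rw [insList, ins_mul, insList_add]
    exact (ih (hf.ins a) hg).add' (ih hf.bar (hg.ins a))

theorem isAlt_form0 (b : B) : IsAlt (form0 b : Cochain L B) :=
  isAlt_of ⟨fun a b => by simp, fun c _ => ext_apply fun _ => (smul_zero c).symm, fun _ => rfl⟩
    fun _ => isAlt_zero

theorem isAlt_one : IsAlt (1 : Cochain L B) := by
  have h : (1 : Cochain L B) = form0 1 := ext_ins rfl fun _ => rfl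
  rw [h]
  exact isAlt_form0 1

theorem IsAlt.pow {f : Cochain L B} (hf : IsAlt f) (n : ℕ) : IsAlt (f ^ n) := by
  induction n with
  | zero =>
    rw [pow_zero]
    exact isAlt_one
  | succ n ih =>
    rw [pow_succ]
    exact ih.mul hf

theorem form0_add (b c : B) : (form0 (b + c) : Cochain L B) = form0 b + form0 c :=
  ext_ins rfl fun a => by simp

theorem form0_smul (r : ℝ) (c : B) : (form0 (r • c) : Cochain L B) = r • form0 c :=
  ext_ins rfl fun _ => ext_apply fun _ => (smul_zero r).symm

theorem isAlt_form1 (θ : L →ₗ[ℝ] B) : IsAlt (form1 θ) :=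
  isAlt_of ⟨fun a b => by simp [form0_add], fun c a => by simp [form0_smul], fun a => by simp⟩
    fun a => by
      rw [ins_form1]
      exact isAlt_form0 _

theorem isAlt_form2 (R : L →ₗ[ℝ] L →ₗ[ℝ] B) (hR : ∀ a, R a a = 0) :
    IsAlt (form2 fun a b => R a b) := by
  refine isAlt_of ⟨fun a b => ?_, fun c a => ?_, fun a => ?_⟩ fun a => ?_
  · simp only [ins_form2]
    exact ext_ins (by simp) fun c => by simp [form0_add]
  · simp only [ins_form2]
    exact ext_ins (smul_zero c).symm fun c => by simp [form0_smul, ins_smul]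
  · simp [hR]
  · rw [ins_form2]
    exact isAlt_form1 (R a)

theorem IsAlt.mapCo {f : Cochain L B} (hf : IsAlt f) (φ : B →ₗ[ℝ] C) :
    IsAlt (mapCo φ.toAddMonoidHom f) := by
  intro l
  induction l generalizing f with
  | nil =>
    refine ⟨fun a b => ?_, fun c a => ?_, fun a => ?_⟩
    · rw [insList, ins_mapCo, hf.head.add, map_add]
      rfl
    · rw [insList, ins_mapCo, hf.head.smul]
      exact ext_apply fun l => map_smul φ c _
    · rw [insList, ins_mapCo, ins_mapCo, hf.head.self, map_zero]
  | cons a l ih => exact ih (hf.ins a)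

theorem IsAlt.exists_multilinear (n : ℕ) {f : Cochain L B} (hf : IsAlt f) :
    ∃ F : MultilinearMap ℝ (fun _ : Fin n => L) B, ∀ a, F a = f (List.ofFn a) := by
  induction n generalizing f with
  | zero => exact ⟨MultilinearMap.constOfIsEmpty ℝ _ (f []), fun a => rfl⟩
  | succ n ih =>
    choose G hG using fun x => ih (hf.ins x)
    refine ⟨LinearMap.uncurryLeft (M := fun _ : Fin (n + 1) => L)
      { toFun := G, map_add' := fun x y => ?_, map_smul' := fun c x => ?_ }, fun a => ?_⟩
    · ext a
      rw [_root_.add_apply, hG, hG, hG, hf.head.add]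
      rfl
    · ext a
      rw [_root_.smul_apply, hG, RingHom.id_apply, hG, hf.head.smul]
      rfl
    · rw [LinearMap.uncurryLeft_apply, List.ofFn_succ]
      exact hG _ _

/-- Only the coincidence of the first two arguments is controlled directly. Polarisation gives
antisymmetry in those two, which moves `x` inwards until it meets its equal. -/
theorem IsAlt.apply_eq_zero {n : ℕ} {f : Cochain L B} (hf : IsAlt f) (x : L) (v : Fin n → L)
    (j : Fin n) (hj : v j = x) : f (x :: List.ofFn v) = 0 := by
  induction n generalizing f with
  | zero => exact j.elim0
  | succ n ih =>
    rw [List.ofFn_succ]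
    rcases Fin.eq_zero_or_eq_succ j with rfl | ⟨k, rfl⟩
    · rw [hj]
      exact congrArg (fun u : Cochain L B => u (List.ofFn fun i : Fin n => v i.succ))
        (hf.head.self x)
    · have h1 : Cochain.ins (v 0) (Cochain.ins x f) + Cochain.ins x (Cochain.ins (v 0) f) = 0 := by
        -- Expand the vanishing at the pair of equal arguments x + v 0.
        have h := hf.head.self (x + v 0)
        simp only [hf.head.add, (hf.ins x).head.add, (hf.ins (v 0)).head.add, map_add,
          hf.head.self, zero_add, add_zero] at h
        exact h
      have h2 := congrArg (fun u : Cochain L B => u (List.ofFn fun i : Fin n => v i.succ)) h1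
      have h3 := ih (hf.ins (v 0)) (fun i : Fin n => v i.succ) k hj
      simp only [add_apply, ins_apply, zero_apply] at h2 h3
      rwa [h3, add_zero] at h2

theorem IsAlt.ofFn_eq_zero {n : ℕ} {f : Cochain L B} (hf : IsAlt f) (v : Fin n → L)
    {i j : Fin n} (hij : i < j) (h : v i = v j) : f (List.ofFn v) = 0 := by
  induction n generalizing f with
  | zero => exact j.elim0
  | succ n ih =>
    rw [List.ofFn_succ]
    obtain ⟨j, rfl⟩ := Fin.exists_succ_eq.2 (Fin.ne_zero_of_lt hij)
    rcases Fin.eq_zero_or_eq_succ i with rfl | ⟨k, rfl⟩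
    · exact hf.apply_eq_zero _ _ j h.symm
    · exact ih (hf.ins (v 0)) _ (Fin.succ_lt_succ_iff.1 hij) h

/-- Extracts the component of degree `n` as a genuine alternating map. Exactness is defined by such
maps, so a primitive found as a cochain has to be converted. -/
theorem IsAlt.exists_alternating (n : ℕ) {f : Cochain L B} (hf : IsAlt f) :
    ∃ F : L [⋀^Fin n]→ₗ[ℝ] B, ∀ a, F a = f (List.ofFn a) := by
  obtain ⟨F, hF⟩ := hf.exists_multilinear n
  refine ⟨{ F with map_eq_zero_of_eq' := fun v i j h hij => ?_ }, hF⟩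
  refine (hF v).trans ?_
  rcases lt_or_gt_of_ne hij with hlt | hlt
  · exact hf.ofFn_eq_zero v hlt h
  · exact hf.ofFn_eq_zero v hlt h.symm

section Families

open TensorProduct Polynomial

variable {L : Type*} [LieRing L] [LieAlgebra ℝ L]

theorem isAlt_famCurv (δ : L →ₗ[ℝ] B →ₗ[ℝ] B) (R : L →ₗ[ℝ] L →ₗ[ℝ] B) (hR : ∀ a, R a a = 0)
    (θ : L →ₗ[ℝ] B) :
    IsAlt (famCurv (fun a => δ a) (fun a b => R a b) θ.toAddMonoidHom) := by
  have h1 : IsAlt (form1 (famTheta θ.toAddMonoidHom)) :=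
    isAlt_form1 ((TensorProduct.mk ℝ ℝ[X] B X).comp θ)
  have h2 : IsAlt (form2 fun a b => (1 : ℝ[X]) ⊗ₜ[ℝ] R a b) :=
    isAlt_form2 (R.compr₂ (TensorProduct.mk ℝ ℝ[X] B 1)) fun a => by simp [hR]
  have h3 : IsAlt (form2 fun a b => (X : ℝ[X]) ⊗ₜ[ℝ] (δ a (θ b) - δ b (θ a) - θ ⁅a, b⁆)) :=
    isAlt_form2 ((LinearMap.mk₂ ℝ (fun a b => δ a (θ b) - δ b (θ a) - θ ⁅a, b⁆)
      (fun a b c => by simp; abel) (fun r a b => by simp [smul_sub])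
      (fun a b c => by simp; abel) (fun r a b => by simp [smul_sub])).compr₂
        (TensorProduct.mk ℝ ℝ[X] B X)) fun a => by simp
  -- Written out as a form of degree two, dθ is visibly bilinear and vanishes on equal arguments.
  have h4 : d (famOp fun a => δ a) (form1 (famTheta θ.toAddMonoidHom)) =
      form2 fun a b => (X : ℝ[X]) ⊗ₜ[ℝ] (δ a (θ b) - δ b (θ a) - θ ⁅a, b⁆) := by
    rw [d_form1]
    simp [famOp_apply, famTheta_apply, tmul_sub]
  rw [famCurv, twCurv, h4]
  exact (h2.add h3).add (h1.mul h1)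

theorem isAlt_csCo (δ : L →ₗ[ℝ] B →ₗ[ℝ] B) (R : L →ₗ[ℝ] L →ₗ[ℝ] B) (hR : ∀ a, R a a = 0)
    (θ : L →ₗ[ℝ] B) (τ : B →ₗ[ℝ] C) (n : ℕ) :
    IsAlt (csCo (fun a => δ a) (fun a b => R a b) θ.toAddMonoidHom τ n) := by
  have h1 : IsAlt (form1 (conTheta θ.toAddMonoidHom)) :=
    isAlt_form1 ((TensorProduct.mk ℝ ℝ[X] B 1).comp θ)
  exact ((h1.mul ((isAlt_famCurv δ R hR θ).pow n)).mapCo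
    ((famInt C).comp (τ.lTensor ℝ[X]))).nsmul (n + 1)

end Families

end Multilinear

end Cochain

/-! ### The endomorphism algebra and the trace -/

section EndAlgebra

variable {EN : Type*} [NormedAddCommGroup EN] [NormedSpace ℝ EN]
  {H : Type*} [TopologicalSpace H] {I : ModelWithCorners ℝ EN H}
  {N : Type*} [TopologicalSpace N] [ChartedSpace H N]
  {F : Type*} [NormedAddCommGroup F] [NormedSpace ℝ F]
  {E : N → Type*} [TopologicalSpace (TotalSpace F E)] [∀ x, TopologicalSpace (E x)]
  [∀ x, AddCommGroup (E x)] [∀ x, Module ℝ (E x)] [FiberBundle F E] [VectorBundle ℝ F E]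
  {L : Type*} [LieRing L] [LieAlgebra ℝ L]
  {ρ : L →ₗ⁅ℝ⁆ Derivation ℝ C^∞⟮I, N; ℝ⟯ C^∞⟮I, N; ℝ⟯}

variable (I F E) in
/-- The algebra `Γ(End E)`. -/
abbrev EndSec : Type _ := Module.End C^∞⟮I, N; ℝ⟯ Cₛ^∞⟮I; F, E⟯

namespace RConn

/-- The connection on `End E` induced by a connection on `E`: the commutator with `∇ a`. -/
def adOp (D : RConn ρ F E) (a : L) : EndSec I F E →ₗ[ℝ] EndSec I F E where
  toFun φ :=
    { toFun := fun s => D.op a (φ s) - φ (D.op a s)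
      map_add' := fun s t => by
        simp only [map_add]
        abel
      map_smul' := fun f s => by
        simp only [map_smul, D.isCDO _ _ _, map_add, RingHom.id_apply, smul_sub]
        abel }
  map_add' φ ψ := by
    ext1 s
    simp only [LinearMap.coe_mk, AddHom.coe_mk, LinearMap.add_apply, map_add]
    abel
  map_smul' c φ := by
    ext1 s
    simp only [LinearMap.coe_mk, AddHom.coe_mk, LinearMap.smul_apply, map_smul, smul_sub,
      RingHom.id_apply]

theorem adOp_apply (D : RConn ρ F E) (a : L) (φ : EndSec I F E) (s : Cₛ^∞⟮I; F, E⟯) :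
    D.adOp a φ s = D.op a (φ s) - φ (D.op a s) := rfl

/-- All three laws are identities between operators on sections; the Bianchi identity is the Jacobi
identity for commutators together with that of `L`. No linearity over functions in the arguments is
involved. -/
theorem isCurved (D : RConn ρ F E) :
    Cochain.IsCurved (fun a => (D.adOp a).toAddMonoidHom) fun a b => D.curv a b where
  leibniz a φ ψ := by
    ext1 s
    simp only [LinearMap.toAddMonoidHom_coe, adOp_apply, Module.End.mul_apply, LinearMap.add_apply,
      map_sub]
    abel
  comm a b φ := by
    ext1 s
    simp only [LinearMap.toAddMonoidHom_coe, adOp_apply, Module.End.mul_apply, LinearMap.sub_apply,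
      map_sub, curv_apply]
    abel
  bianchi := by
    refine Cochain.d_form2_eq_zero _ _ fun a b c => ?_
    ext1 s
    simp only [LinearMap.toAddMonoidHom_coe, adOp_apply, LinearMap.sub_apply, LinearMap.zero_apply,
      map_sub, curv_apply, lie_lie]
    abel

/-- The difference of two connections, a form of degree one with values in `End E`. -/
def diff (D₀ D₁ : RConn ρ F E) : L →ₗ[ℝ] EndSec I F E where
  toFun a :=
    { toFun := fun s => D₁.op a s - D₀.op a s
      map_add' := fun s t => by
        simp only [map_add]
        abel
      map_smul' := fun f s => by
        simp only [D₁.isCDO _ _ _, D₀.isCDO _ _ _, RingHom.id_apply, smul_sub]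
        abel }
  map_add' a b := by
    ext1 s
    simp only [LinearMap.coe_mk, AddHom.coe_mk, LinearMap.add_apply, map_add]
    abel
  map_smul' c a := by
    ext1 s
    simp only [LinearMap.coe_mk, AddHom.coe_mk, LinearMap.smul_apply, map_smul, smul_sub,
      RingHom.id_apply]

theorem diff_apply (D₀ D₁ : RConn ρ F E) (a : L) (s : Cₛ^∞⟮I; F, E⟯) :
    diff D₀ D₁ a s = D₁.op a s - D₀.op a s := rfl

/-- The connection `(1 - t) ∇⁰ + t ∇¹`. -/
def line (D₀ D₁ : RConn ρ F E) (t : ℝ) : RConn ρ F E where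
  op := (1 - t) • D₀.op + t • D₁.op
  isCDO a f s := by
    simp only [LinearMap.add_apply, LinearMap.smul_apply, D₀.isCDO _ _ _, D₁.isCDO _ _ _, smul_add]
    rw [smul_comm t f, smul_comm (1 - t) f]
    have h : ρ a f • s = (1 - t) • ρ a f • s + t • ρ a f • s := by
      rw [← add_smul, sub_add_cancel, one_smul]
    conv_rhs => rw [h]
    abel

theorem line_apply (D₀ D₁ : RConn ρ F E) (t : ℝ) (a : L) (s : Cₛ^∞⟮I; F, E⟯) :
    (line D₀ D₁ t).op a s = (1 - t) • D₀.op a s + t • D₁.op a s := rfl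

theorem ext_op {D₀ D₁ : RConn ρ F E} (h : ∀ a s, D₀.op a s = D₁.op a s) : D₀ = D₁ := by
  obtain ⟨op₀, h₀⟩ := D₀
  obtain ⟨op₁, h₁⟩ := D₁
  obtain rfl : op₀ = op₁ := LinearMap.ext fun a => LinearMap.ext (h a)
  rfl

theorem line_zero (D₀ D₁ : RConn ρ F E) : line D₀ D₁ 0 = D₀ :=
  ext_op fun a s => by simp [line_apply]

theorem line_one (D₀ D₁ : RConn ρ F E) : line D₀ D₁ 1 = D₁ :=
  ext_op fun a s => by simp [line_apply]

theorem line_symm (D₀ D₁ : RConn ρ F E) (t : ℝ) : line D₁ D₀ (1 - t) = line D₀ D₁ t :=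
  ext_op fun a s => by simp [line_apply, add_comm]

/-- R_t = R_0 + t dθ + t² θ², the polynomial family to which the algebraic theory is applied. -/
theorem curv_line (D₀ D₁ : RConn ρ F E) (t : ℝ) (a b : L) : (line D₀ D₁ t).curv a b =
    D₀.curv a b + t • (D₀.adOp a (diff D₀ D₁ b) - D₀.adOp b (diff D₀ D₁ a) - diff D₀ D₁ ⁅a, b⁆) +
      t ^ 2 • (diff D₀ D₁ a * diff D₀ D₁ b - diff D₀ D₁ b * diff D₀ D₁ a) := by
  ext1 s
  simp only [LinearMap.add_apply, LinearMap.smul_apply, LinearMap.sub_apply, curv_apply,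
    line_apply, adOp_apply, diff_apply, Module.End.mul_apply, map_add, map_sub, map_smul]
  module

theorem curv_skew (D : RConn ρ F E) (a b : L) : D.curv a b = -D.curv b a := by
  ext1 s
  simp only [LinearMap.neg_apply, curv_apply]
  rw [← lie_skew a b, map_neg, LinearMap.neg_apply]
  abel

/-- The curvature, as a cochain. -/
def curvCo (D : RConn ρ F E) : Cochain L (EndSec I F E) := Cochain.form2 fun a b => D.curv a b

theorem bar_curvCo (D : RConn ρ F E) : Cochain.bar D.curvCo = D.curvCo := Cochain.bar_form2 _

/-- Identifies the normalised sum over permutations with the power in the ring of cochains. Two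
arguments are split off at a time: summing over the second turns R x y into the one-form R x,
summing over the first produces twice the two-form R. -/
theorem alternatization_curvProd (D : RConn ρ F E) (p : ℕ) (a : Fin (2 * p) → L) :
    MultilinearMap.alternatization (D.curvProd p) a =
      (2 : ℝ) ^ p • (D.curvCo ^ p) (List.ofFn a) := by
  induction p with
  | zero =>
    rw [MultilinearMap.alternatization_apply]
    simp [curvProd]
  | succ p ih =>
    have h2 : ∀ x y : L, ∀ b : Fin (2 * p) → L, (Cochain.form0 (D.curv x y) *
        (2 : ℝ) ^ p • D.curvCo ^ p : Cochain L (EndSec I F E)) (List.ofFn b) =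
          MultilinearMap.alternatization (MultilinearMap.curryLeft (n := 2 * p)
            (MultilinearMap.curryLeft (n := 2 * p + 1) (D.curvProd (p + 1)) x) y) b := by
      intro x y b
      have h3 : MultilinearMap.curryLeft (n := 2 * p)
            (MultilinearMap.curryLeft (n := 2 * p + 1) (D.curvProd (p + 1)) x) y =
          (LinearMap.mulLeft ℝ (D.curv x y)).compMultilinearMap (D.curvProd p) := by
        ext1 c
        change (List.ofFn _).prod = D.curv x y * (List.ofFn _).prod
        rw [List.ofFn_succ, List.prod_cons]
        rfl
      rw [Cochain.form0_mul_apply, h3, LinearMap.compMultilinearMap_alternatization,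
        LinearMap.compAlternatingMap_apply, ih]
      rfl
    have h1 : ∀ x : L, ∀ b : Fin (2 * p + 1) → L, (Cochain.form1 (D.curv x) *
        (2 : ℝ) ^ p • D.curvCo ^ p : Cochain L (EndSec I F E)) (List.ofFn b) =
          MultilinearMap.alternatization
            (MultilinearMap.curryLeft (n := 2 * p + 1) (D.curvProd (p + 1)) x) b := by
      intro x b
      rw [Cochain.alternatization_eq_altSum _ _ (h2 x), Cochain.altSum_form0_mul]
    have h0 := Cochain.alternatization_eq_altSum (n := 2 * p + 1) (D.curvProd (p + 1)) _ h1 a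
    refine h0.trans ?_
    rw [Cochain.altSum_form1_mul D.curv_skew, Cochain.mul_smul', pow_succ' D.curvCo, pow_succ,
      mul_smul, two_smul, Cochain.add_apply, Cochain.smul_apply, ← smul_add]
    rfl

theorem curvPow_eq (D : RConn ρ F E) (p : ℕ) (a : Fin (2 * p) → L) :
    D.curvPow p a = (D.curvCo ^ p) (List.ofFn a) := by
  have h : D.curvPow p a =
      ((1 / 2 ^ p : ℝ)) • MultilinearMap.alternatization (D.curvProd p) a := rfl
  rw [h, alternatization_curvProd, smul_smul, one_div, inv_mul_cancel₀ (by positivity), one_smul]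

end RConn

end EndAlgebra

/-! ### The fibrewise trace and the Chern-Simons cochain -/

section TraceEnd

variable {EN : Type*} [NormedAddCommGroup EN] [NormedSpace ℝ EN] [FiniteDimensional ℝ EN]
  {H : Type*} [TopologicalSpace H] {I : ModelWithCorners ℝ EN H}
  {N : Type*} [TopologicalSpace N] [ChartedSpace H N] [IsManifold I ∞ N] [T2Space N]
  {F : Type*} [NormedAddCommGroup F] [NormedSpace ℝ F]
  {E : N → Type*} [TopologicalSpace (TotalSpace F E)] [∀ x, TopologicalSpace (E x)]
  [∀ x, AddCommGroup (E x)] [∀ x, Module ℝ (E x)] [FiberBundle F E] [VectorBundle ℝ F E]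
  [FiniteDimensional ℝ F] [ContMDiffVectorBundle ∞ F E I]

theorem fibreEnd_mul (φ ψ : EndSec I F E) (x : N) :
    fibreEnd (φ * ψ) x = fibreEnd φ x * fibreEnd ψ x := by
  ext v
  rw [← frameSec_surj (I := I) (F := F) x v, Module.End.mul_apply, fibreEnd_apply, fibreEnd_apply,
    fibreEnd_apply]
  rfl

theorem trEnd_mul_comm (φ ψ : EndSec I F E) : trEnd (φ * ψ) = trEnd (ψ * φ) := by
  ext x
  rw [trEnd_apply, trEnd_apply, fibreEnd_mul, fibreEnd_mul, LinearMap.trace_mul_comm]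

/-- With a cut-off function ψ supported where f = g, the product ψ(f - g) vanishes; apply the
Leibniz rule to it at the point. -/
theorem derivation_local (X : Derivation ℝ C^∞⟮I, N; ℝ⟯ C^∞⟮I, N; ℝ⟯) {f g : C^∞⟮I, N; ℝ⟯} {x : N}
    (h : ∀ᶠ y in 𝓝 x, f y = g y) : X f x = X g x := by
  obtain ⟨U, hU, hUo, hxU⟩ := eventually_nhds_iff.1 h
  obtain ⟨ψ, h1, h2⟩ := exists_cutoff (I := I) x (hUo.mem_nhds hxU)
  have h3 : ψ * (f - g) = 0 := by
    ext y
    change ψ y * (f y - g y) = 0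
    by_cases hy : y ∈ U
    · rw [hU y hy, sub_self, mul_zero]
    · rw [image_eq_zero_of_notMem_tsupport fun h => hy (h2 h), zero_mul]
  have h4 := congrArg (fun u : C^∞⟮I, N; ℝ⟯ => X u x) h3
  simp only [Derivation.leibniz, map_sub, map_zero] at h4
  change ψ x * (X f x - X g x) + (f x - g x) * X ψ x = 0 at h4
  rw [h1.self_of_nhds, h.self_of_nhds, sub_self, zero_mul, one_mul, add_zero] at h4
  exact sub_eq_zero.1 h4

theorem fn_sum_apply {ι : Type*} (T : Finset ι) (g : ι → C^∞⟮I, N; ℝ⟯) (x : N) :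
    (∑ i ∈ T, g i) x = ∑ i ∈ T, g i x := map_sum (ContMDiffMap.evalRingHom x) g T

/-- In a frame, a covariant differential operator is its symbol plus a connection matrix. The
cut-off in the frame expansion is harmless, being constant near the point. -/
theorem frameCoord_cdo {X : Derivation ℝ C^∞⟮I, N; ℝ⟯ C^∞⟮I, N; ℝ⟯}
    {ℓ : Module.End ℝ Cₛ^∞⟮I; F, E⟯} (hℓ : IsCDO X ℓ) (s : Cₛ^∞⟮I; F, E⟯) (x : N)
    (i : Fin (Module.finrank ℝ F)) :
    frameCoord I F E x ((Module.finBasis ℝ F).coord i) (ℓ s) x =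
      X (frameCoord I F E x ((Module.finBasis ℝ F).coord i) s) x +
      ∑ j, frameCoord I F E x ((Module.finBasis ℝ F).coord j) s x *
        frameCoord I F E x ((Module.finBasis ℝ F).coord i)
          (ℓ (frameSec I F E x (Module.finBasis ℝ F j))) x := by
  have hX : X (cutoff I F E x * cutoff I F E x) x = 0 := by
    rw [derivation_local X (g := 1)]
    · rw [Derivation.map_one_eq_zero]
      rfl
    · filter_upwards [cutoff_eventually (I := I) (F := F) (E := E) x] with y hy
      change cutoff I F E x y * cutoff I F E x y = 1
      rw [hy, one_mul]
  have h := congrArg (fun u => ℓ u x) (frame_expand x s)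
  simp only [map_sum, hℓ _ _, sec_sum_apply, ContMDiffSection.coe_add, Pi.add_apply,
    fn_smul_apply, hX, zero_smul, add_zero, ContMDiffMap.coe_mul, Pi.mul_apply,
    cutoff_self, one_mul, one_smul] at h
  have hsec : ∀ j, frameSec I F E x (Module.finBasis ℝ F j) x =
    (trivializationAt F E x).symmL ℝ x (Module.finBasis ℝ F j) := fun j => by
      rw [frameSec_apply, cutoff_self, one_smul]
  rw [frameCoord_apply, cutoff_self, one_smul, h]
  simp only [map_sum, map_add, map_smul, smul_eq_mul, Finset.sum_add_distrib]
  rw [add_comm]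
  congr 1
  · rw [Finset.sum_eq_single i]
    · rw [hsec, Trivialization.continuousLinearMapAt_symmL _ (mem_baseSet_trivializationAt F E x),
        Module.Basis.coord_apply, Module.Basis.repr_self, Finsupp.single_eq_same, mul_one]
    · intro j _ hj
      rw [hsec, Trivialization.continuousLinearMapAt_symmL _ (mem_baseSet_trivializationAt F E x),
        Module.Basis.coord_apply, Module.Basis.repr_self, Finsupp.single_eq_of_ne hj.symm, mul_zero]
    · simp
  · refine Finset.sum_congr rfl fun j _ => ?_
    congr 1
    rw [frameCoord_apply, cutoff_self, one_smul]

theorem frameCoord_end (φ : EndSec I F E) (s : Cₛ^∞⟮I; F, E⟯) (x : N)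
    (i : Fin (Module.finrank ℝ F)) :
    frameCoord I F E x ((Module.finBasis ℝ F).coord i) (φ s) x =
      ∑ j, frameCoord I F E x ((Module.finBasis ℝ F).coord j) s x *
        frameCoord I F E x ((Module.finBasis ℝ F).coord i)
          (φ (frameSec I F E x (Module.finBasis ℝ F j))) x := by
  have h := frameCoord_cdo (X := 0) (ℓ := φ.restrictScalars ℝ) (fun f s => by simp) s x i
  simpa using h

variable {L : Type*} [LieRing L] [LieAlgebra ℝ L]
  {ρ : L →ₗ⁅ℝ⁆ Derivation ℝ C^∞⟮I, N; ℝ⟯ C^∞⟮I, N; ℝ⟯}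

theorem frameCoord_sub (x y : N) (l : F →ₗ[ℝ] ℝ) (s t : Cₛ^∞⟮I; F, E⟯) :
    frameCoord I F E x l (s - t) y = frameCoord I F E x l s y - frameCoord I F E x l t y := by
  simp only [frameCoord_apply, ContMDiffSection.coe_sub, Pi.sub_apply, map_sub, smul_sub]

/-- The trace is parallel. -/
theorem RConn.trEnd_adOp (D : RConn ρ F E) (a : L) (φ : EndSec I F E) :
    trEnd (D.adOp a φ) = ρ a (trEnd φ) := by
  ext x
  have h1 : ∀ ψ : EndSec I F E, ∀ᶠ y in 𝓝 x, trEnd ψ y =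
      (∑ i, frameCoord I F E x ((Module.finBasis ℝ F).coord i)
        (ψ (frameSec I F E x (Module.finBasis ℝ F i)))) y := by
    intro ψ
    filter_upwards [cutoff_eventually (I := I) (F := F) (E := E) x,
      (trivializationAt F E x).open_baseSet.mem_nhds
        (mem_baseSet_trivializationAt F E x)] with y h1 hy
    rw [trEnd_apply, trace_fibreEnd_eq ψ x y hy h1, fn_sum_apply]
  rw [derivation_local (ρ a) (h1 φ), (h1 _).self_of_nhds, fn_sum_apply, map_sum, fn_sum_apply]
  have h2 : ∀ i, frameCoord I F E x ((Module.finBasis ℝ F).coord i)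
      (D.adOp a φ (frameSec I F E x (Module.finBasis ℝ F i))) x = _ := fun i => by
    rw [adOp_apply, frameCoord_sub, frameCoord_cdo (D.isCDO a),
      frameCoord_end φ (D.op a (frameSec I F E x (Module.finBasis ℝ F i)))]
  rw [Finset.sum_congr rfl fun i _ => h2 i, Finset.sum_sub_distrib, Finset.sum_add_distrib,
    add_sub_assoc, sub_eq_zero.2, add_zero]
  -- What remains is the trace of the commutator of the connection matrix with the matrix of φ,
  -- which is zero.
  rw [Finset.sum_comm]
  exact Finset.sum_congr rfl fun i _ => Finset.sum_congr rfl fun j _ => mul_comm _ _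

namespace RConn

theorem ch_eq (D : RConn ρ F E) (p : ℕ) (a : Fin (2 * p) → L) :
    D.ch p a = trEnd ((D.curvCo ^ p) (List.ofFn a)) := by
  rw [← curvPow_eq]
  rfl

/-- The Chern-Simons cochain of degree `2n + 1` of two connections. -/
def csCo (D₀ D₁ : RConn ρ F E) (n : ℕ) : Cochain L C^∞⟮I, N; ℝ⟯ :=
  Cochain.csCo D₀.adOp (fun a b => D₀.curv a b) (diff D₀ D₁).toAddMonoidHom trEnd n

/-- The transgression formula `d cs = ch(∇¹) - ch(∇⁰)`. -/
theorem d_csCo (D₀ D₁ : RConn ρ F E) (n : ℕ) (l : List L) :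
    Cochain.d (fun a => (ρ a).toLinearMap.toAddMonoidHom) (csCo D₀ D₁ n) l =
      trEnd ((D₁.curvCo ^ (n + 1)) l) - trEnd ((D₀.curvCo ^ (n + 1)) l) := by
  have h : ∀ t, Cochain.famEval _ t ((Cochain.famCurv D₀.adOp (fun a b => D₀.curv a b)
      (diff D₀ D₁).toAddMonoidHom ^ (n + 1)) l) = ((line D₀ D₁ t).curvCo ^ (n + 1)) l := by
    intro t
    rw [Cochain.famEval_famCurv_pow, curvCo]
    simp only [curv_line]
    rfl
  have h2 := Cochain.d_csCo D₀.isCurved (diff D₀ D₁).toAddMonoidHom trEnd trEnd_mul_comm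
    (ρ := fun a => (ρ a).toLinearMap) (D₀.trEnd_adOp) n l
  rw [h, h, line_zero, line_one] at h2
  exact h2

theorem csCo_apply (D₀ D₁ : RConn ρ F E) (n : ℕ) (l : List L) (x : N) :
    csCo D₀ D₁ n l x = ∫ t in (0 : ℝ)..1, (n + 1) •
      trEnd ((Cochain.form1 (diff D₀ D₁) * (line D₀ D₁ t).curvCo ^ n) l) x := by
  have h := Cochain.csCo_eq_integral D₀.adOp (fun a b => D₀.curv a b)
    (diff D₀ D₁).toAddMonoidHom trEnd n
    { toFun := fun f : C^∞⟮I, N; ℝ⟯ => f x, map_add' := fun _ _ => rfl, map_smul' := fun _ _ => rfl } l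
  refine h.trans ?_
  congr 1
  funext t
  rw [curvCo]
  simp only [curv_line]
  rfl

theorem curv_self (D : RConn ρ F E) (a : L) : D.curv a a = 0 := by
  ext1 s
  simp

/-- Stokes' theorem uses this to obtain a primitive that is again alternating and multilinear. -/
theorem isAlt_csCo (D₀ D₁ : RConn ρ F E) (n : ℕ) : Cochain.IsAlt (csCo D₀ D₁ n) := by
  let δ : L →ₗ[ℝ] EndSec I F E →ₗ[ℝ] EndSec I F E :=
    { toFun := D₀.adOp
      map_add' := fun a b => by
        ext φ s : 2
        simp only [LinearMap.add_apply, adOp_apply, map_add]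
        abel
      map_smul' := fun c a => by
        ext φ s : 2
        simp only [LinearMap.smul_apply, adOp_apply, map_smul, smul_sub, RingHom.id_apply]
        rw [LinearMap.map_smul_of_tower] }
  exact Cochain.isAlt_csCo δ D₀.curv D₀.curv_self (diff D₀ D₁) trEnd n

end RConn

end TraceEnd

/-! ### Adjoint connections -/

section AdjointConn

variable {EN : Type*} [NormedAddCommGroup EN] [NormedSpace ℝ EN] [FiniteDimensional ℝ EN]
  {H : Type*} [TopologicalSpace H] {I : ModelWithCorners ℝ EN H}
  {N : Type*} [TopologicalSpace N] [ChartedSpace H N] [IsManifold I ∞ N] [T2Space N]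
  {F : Type*} [NormedAddCommGroup F] [NormedSpace ℝ F]
  {E : N → Type*} [TopologicalSpace (TotalSpace F E)] [∀ x, TopologicalSpace (E x)]
  [∀ x, AddCommGroup (E x)] [∀ x, Module ℝ (E x)]
  [∀ x, IsTopologicalAddGroup (E x)] [∀ x, ContinuousConstSMul ℝ (E x)]
  [FiberBundle F E] [VectorBundle ℝ F E]
  [FiniteDimensional ℝ F] [ContMDiffVectorBundle ∞ F E I]

theorem metricFn_neg_left (h : ContMDiffRiemannianMetric I ∞ F E) (s t : Cₛ^∞⟮I; F, E⟯) :
    metricFn h (-s) t = -metricFn h s t := by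
  simpa using metricFn_const_smul_left h (-1) s t

theorem metricFn_neg_right (h : ContMDiffRiemannianMetric I ∞ F E) (s t : Cₛ^∞⟮I; F, E⟯) :
    metricFn h s (-t) = -metricFn h s t := by
  simpa using metricFn_const_smul_right h (-1) s t

theorem metricFn_sub_left (h : ContMDiffRiemannianMetric I ∞ F E) (s s' t : Cₛ^∞⟮I; F, E⟯) :
    metricFn h (s - s') t = metricFn h s t - metricFn h s' t := by
  rw [sub_eq_add_neg, metricFn_add_left, metricFn_neg_left, sub_eq_add_neg]

theorem metricFn_sub_right (h : ContMDiffRiemannianMetric I ∞ F E) (s t t' : Cₛ^∞⟮I; F, E⟯) :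
    metricFn h s (t - t') = metricFn h s t - metricFn h s t' := by
  rw [sub_eq_add_neg, metricFn_add_right, metricFn_neg_right, sub_eq_add_neg]

/-- The relation of being adjoint endomorphisms with respect to a metric. -/
def adjRel (h : ContMDiffRiemannianMetric I ∞ F E) : AddSubgroup (EndSec I F E × EndSec I F E) where
  carrier := {q | ∀ s t, metricFn h (q.1 s) t = metricFn h s (q.2 t)}
  zero_mem' s t := by
    change metricFn h 0 t = metricFn h s 0
    simpa using (metricFn_const_smul_left h 0 s t).trans (metricFn_const_smul_right h 0 s t).symm
  add_mem' {q q'} hq hq' s t := by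
    change metricFn h (q.1 s + q'.1 s) t = metricFn h s (q.2 t + q'.2 t)
    rw [metricFn_add_left, metricFn_add_right, hq, hq']
  neg_mem' {q} hq s t := by
    change metricFn h (-q.1 s) t = metricFn h s (-q.2 t)
    rw [metricFn_neg_left, metricFn_neg_right, hq]

theorem adjRel_mul (h : ContMDiffRiemannianMetric I ∞ F E) (φ φ' ψ ψ' : EndSec I F E)
    (h1 : (φ, φ') ∈ adjRel h) (h2 : (ψ, ψ') ∈ adjRel h) : (φ * ψ, ψ' * φ') ∈ adjRel h :=
  fun s t => (h1 (ψ s) t).trans (h2 s (φ' t))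

theorem adjRel_one (h : ContMDiffRiemannianMetric I ∞ F E) : (1, 1) ∈ adjRel h := fun _ _ => rfl

/-- Adjoint endomorphisms have the same trace. -/
theorem trEnd_eq_of_adjRel (h : ContMDiffRiemannianMetric I ∞ F E) {φ ψ : EndSec I F E}
    (hφ : (φ, ψ) ∈ adjRel h) : trEnd φ = trEnd ψ := by
  ext x
  rw [trEnd_apply, trEnd_apply]
  have hfd : FiniteDimensional ℝ (E x) := VectorBundle.finiteDimensional ℝ F E x
  let b : E x →ₗ[ℝ] Module.Dual ℝ (E x) :=
    LinearMap.mk₂ ℝ (fun w v => h.inner x v w) (fun w w' v => map_add _ _ _)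
      (fun c w v => map_smul _ _ _) (fun w v v' => by simp) (fun c w v => by simp)
  have hinj : Function.Injective b := by
    rw [← LinearMap.ker_eq_bot, LinearMap.ker_eq_bot']
    intro w hw
    by_contra hne
    have h1 := h.pos x w hne
    have h2 : b w w = 0 := by rw [hw]; rfl
    exact h1.ne' h2
  let e : E x ≃ₗ[ℝ] Module.Dual ℝ (E x) := LinearEquiv.ofInjectiveOfFinrankEq b hinj
    (Subspace.dual_finrank_eq (K := ℝ) (V := E x)).symm
  have h1 : ∀ v w, h.inner x (fibreEnd φ x v) w = h.inner x v (fibreEnd ψ x w) := by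
    intro v w
    rw [← frameSec_surj (I := I) (F := F) x v, ← frameSec_surj (I := I) (F := F) x w,
      fibreEnd_apply, fibreEnd_apply]
    exact congrArg (fun f : C^∞⟮I, N; ℝ⟯ => f x) (hφ _ _)
  -- The metric, as an isomorphism from the fibre to its dual, conjugates ψ into the transpose of φ.
  have h2 : Module.Dual.transpose (R := ℝ) (fibreEnd φ x) = e.conj (fibreEnd ψ x) := by
    refine LinearMap.ext fun l => ?_
    obtain ⟨w, rfl⟩ := e.surjective l
    rw [LinearEquiv.conj_apply_apply, e.symm_apply_apply]
    exact LinearMap.ext fun v => h1 v w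
  rw [← LinearMap.trace_transpose', h2, LinearMap.trace_conj']

variable {L : Type*} [LieRing L] [LieAlgebra ℝ L]
  {ρ : L →ₗ⁅ℝ⁆ Derivation ℝ C^∞⟮I, N; ℝ⟯ C^∞⟮I, N; ℝ⟯}

namespace RConn

/-- The adjoint is determined by its defining identity since the metric is nondegenerate; the other
formulas for adjoint connections are verified through this. -/
theorem eq_adjoint (D D' : RConn ρ F E) (h : ContMDiffRiemannianMetric I ∞ F E)
    (hD : ∀ a s t, ρ a (metricFn h s t) = metricFn h (D.op a s) t + metricFn h s (D'.op a t)) :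
    D' = D.adjoint h :=
  ext_op fun a t => metricFn_nondeg h fun s => by
    have h1 := hD a s t
    rw [adjoint_spec D h a s t, add_left_cancel_iff] at h1
    exact h1.symm

theorem IsMetricFor.adjoint_eq {D : RConn ρ F E} {h : ContMDiffRiemannianMetric I ∞ F E}
    (hD : D.IsMetricFor h) : D.adjoint h = D := (eq_adjoint D D h hD).symm

theorem adjoint_adjoint (D : RConn ρ F E) (h : ContMDiffRiemannianMetric I ∞ F E) :
    (D.adjoint h).adjoint h = D :=
  (eq_adjoint _ D h fun a s t => by
    rw [metricFn_symm h s t, adjoint_spec D h a t s, add_comm, metricFn_symm h t,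
      metricFn_symm h _ s]).symm

theorem line_adjoint (D₀ D₁ : RConn ρ F E) (h : ContMDiffRiemannianMetric I ∞ F E) (t : ℝ) :
    line (D₀.adjoint h) (D₁.adjoint h) t = (line D₀ D₁ t).adjoint h :=
  eq_adjoint _ _ h fun a s u => by
    have h0 := adjoint_spec D₀ h a s u
    have h1 := adjoint_spec D₁ h a s u
    rw [line_apply, line_apply, metricFn_add_left, metricFn_add_right]
    simp only [metricFn_const_smul_left, metricFn_const_smul_right]
    have h2 : ρ a (metricFn h s u) =
        (1 - t) • ρ a (metricFn h s u) + t • ρ a (metricFn h s u) := by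
      rw [← add_smul, sub_add_cancel, one_smul]
    rw [h2]
    conv_lhs => rw [h0, smul_add]
    rw [← h0, h1, smul_add]
    abel

/-- Differentiating h(s, t) along a, b and their bracket leaves no derivative terms, because the
anchor preserves brackets. Moving the commutator across the metric reverses it, which gives the
sign. -/
theorem curv_adjRel (D : RConn ρ F E) (h : ContMDiffRiemannianMetric I ∞ F E) (a b : L) :
    (D.curv a b, -(D.adjoint h).curv a b) ∈ adjRel h := by
  intro s t
  change metricFn h (D.curv a b s) t = metricFn h s (-(D.adjoint h).curv a b t)
  have h1 : ∀ (c : L) (u v : Cₛ^∞⟮I; F, E⟯), metricFn h (D.op c u) v =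
      ρ c (metricFn h u v) - metricFn h u ((D.adjoint h).op c v) := fun c u v =>
    eq_sub_of_add_eq (adjoint_spec D h c u v).symm
  rw [curv_apply, curv_apply, metricFn_neg_right]
  simp only [metricFn_sub_left, metricFn_sub_right, h1, map_sub, LieHom.map_lie,
    Derivation.commutator_apply]
  abel

theorem diff_adjRel (D₀ D₁ : RConn ρ F E) (h : ContMDiffRiemannianMetric I ∞ F E) (a : L) :
    (diff D₀ D₁ a, -diff (D₀.adjoint h) (D₁.adjoint h) a) ∈ adjRel h := by
  intro s t
  change metricFn h (diff D₀ D₁ a s) t = metricFn h s (-diff (D₀.adjoint h) (D₁.adjoint h) a t)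
  have h0 := adjoint_spec D₀ h a s t
  have h1 := adjoint_spec D₁ h a s t
  rw [diff_apply, diff_apply, metricFn_neg_right, metricFn_sub_left, metricFn_sub_right,
    eq_sub_of_add_eq h0.symm, eq_sub_of_add_eq h1.symm]
  abel

theorem IsFlat.adjoint {D : RConn ρ F E} (hD : D.IsFlat) (h : ContMDiffRiemannianMetric I ∞ F E) :
    (D.adjoint h).IsFlat := by
  refine LinearMap.ext fun a => LinearMap.ext fun b => LinearMap.ext fun t => ?_
  refine metricFn_nondeg h fun s => ?_
  have h1 := curv_adjRel D h a b s t
  have h2 : D.curv a b = 0 := by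
    rw [hD]
    rfl
  have h0 : metricFn h (0 : Cₛ^∞⟮I; F, E⟯) t = metricFn h s 0 := (adjRel h).zero_mem s t
  change metricFn h (D.curv a b s) t = metricFn h s (-(D.adjoint h).curv a b t) at h1
  rw [h2, LinearMap.zero_apply, metricFn_neg_right, h0] at h1
  have h3 : metricFn h s (0 : Cₛ^∞⟮I; F, E⟯) = 0 := by
    simpa using metricFn_const_smul_right h 0 s (0 : Cₛ^∞⟮I; F, E⟯)
  change metricFn h s ((D.adjoint h).curv a b t) = metricFn h s 0
  rw [h3] at h1 ⊢
  exact neg_eq_zero.1 h1.symm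

theorem curvCo_adjRel (D : RConn ρ F E) (h : ContMDiffRiemannianMetric I ∞ F E) (l : List L) :
    (D.curvCo l, (-(D.adjoint h).curvCo) l) ∈ adjRel h := by
  rcases l with _ | ⟨a, _ | ⟨b, _ | ⟨c, l⟩⟩⟩
  · simp [curvCo]
    exact (adjRel h).zero_mem
  · simp [curvCo, Cochain.form2]
    exact (adjRel h).zero_mem
  · exact curv_adjRel D h a b
  · simp [curvCo, Cochain.form2]
    exact (adjRel h).zero_mem

theorem diffCo_adjRel (D₀ D₁ : RConn ρ F E) (h : ContMDiffRiemannianMetric I ∞ F E) (l : List L) :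
    (Cochain.form1 (diff D₀ D₁) l,
      (-Cochain.form1 (diff (D₀.adjoint h) (D₁.adjoint h))) l) ∈ adjRel h := by
  rcases l with _ | ⟨a, _ | ⟨b, l⟩⟩
  · simp
    exact (adjRel h).zero_mem
  · exact diff_adjRel D₀ D₁ h a
  · simp [Cochain.form1]
    exact (adjRel h).zero_mem

theorem bar_neg_curvCo (D : RConn ρ F E) : Cochain.bar (-D.curvCo) = -D.curvCo := by
  rw [map_neg, bar_curvCo]

theorem trEnd_neg_pow_mul (f g : Cochain L (EndSec I F E)) (n : ℕ) (l : List L) :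
    trEnd ((f * (-g) ^ n) l) = (-1 : ℝ) ^ n • trEnd ((f * g ^ n) l) := by
  rcases Nat.even_or_odd n with hn | hn
  · rw [hn.neg_pow, hn.neg_one_pow, one_smul]
  · rw [hn.neg_pow, hn.neg_one_pow, mul_neg, Cochain.neg_apply, map_neg, neg_one_smul]

/-- Each of the n curvature factors contributes a sign; the transpose of a power is the power of the
transposes, because two-forms keep the reversal free of signs. -/
theorem trEnd_curvCo_adjoint (D : RConn ρ F E) (h : ContMDiffRiemannianMetric I ∞ F E) (n : ℕ)
    (l : List L) : trEnd ((D.curvCo ^ n) l) =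
      (-1 : ℝ) ^ n • trEnd (((D.adjoint h).curvCo ^ n) l) := by
  have h1 := trEnd_eq_of_adjRel h (Cochain.rel_pow (adjRel h) (adjRel_mul h) (adjRel_one h)
    (curvCo_adjRel D h) D.bar_curvCo (D.adjoint h).bar_neg_curvCo n l)
  have h2 := trEnd_neg_pow_mul 1 (D.adjoint h).curvCo n l
  rw [one_mul, one_mul] at h2
  rw [h1, h2]

/-- The sign (-1)^(n + 1) comes from n curvature factors and one factor θ, and the line of adjoint
connections is the adjoint of the line. -/
theorem csCo_adjoint (D₀ D₁ : RConn ρ F E) (h : ContMDiffRiemannianMetric I ∞ F E) (n : ℕ)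
    (l : List L) : csCo D₀ D₁ n l =
      (-1 : ℝ) ^ (n + 1) • csCo (D₀.adjoint h) (D₁.adjoint h) n l := by
  have key : ∀ t : ℝ, trEnd ((Cochain.form1 (diff D₀ D₁) * (line D₀ D₁ t).curvCo ^ n) l) =
      (-1 : ℝ) ^ (n + 1) • trEnd ((Cochain.form1 (diff (D₀.adjoint h) (D₁.adjoint h)) *
        (line (D₀.adjoint h) (D₁.adjoint h) t).curvCo ^ n) l) := by
    intro t
    -- The factor θ is first moved behind the curvatures by cyclicity, so that the reversal under
    -- transposition brings it back to the front.
    have h1 := Cochain.trace_mul_comm trEnd.toAddMonoidHom trEnd_mul_comm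
      (Cochain.bar_pow_of_even (line D₀ D₁ t).bar_curvCo n) (Cochain.form1 (diff D₀ D₁)) l
    have h2 := trEnd_eq_of_adjRel h (Cochain.rel_mul (adjRel h) (adjRel_mul h)
      (Cochain.rel_pow (adjRel h) (adjRel_mul h) (adjRel_one h) (curvCo_adjRel (line D₀ D₁ t) h)
        (line D₀ D₁ t).bar_curvCo ((line D₀ D₁ t).adjoint h).bar_neg_curvCo n)
      (diffCo_adjRel D₀ D₁ h) (Cochain.bar_pow_of_even (line D₀ D₁ t).bar_curvCo n)
      (Cochain.bar_pow_of_even ((line D₀ D₁ t).adjoint h).bar_neg_curvCo n) l)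
    refine h1.symm.trans (h2.trans ?_)
    rw [trEnd_neg_pow_mul, neg_mul, Cochain.neg_apply, map_neg, line_adjoint, pow_succ,
      mul_neg_one, neg_smul, smul_neg]
  ext x
  rw [csCo_apply]
  simp only [key]
  change _ = (-1 : ℝ) ^ (n + 1) • (csCo (D₀.adjoint h) (D₁.adjoint h) n l x)
  rw [csCo_apply, ← intervalIntegral.integral_smul]
  congr 1
  funext t
  exact smul_comm (n + 1) ((-1 : ℝ) ^ (n + 1)) (_ : ℝ)

/-- Substitute 1 - t for t: the line is the same one traversed backwards, and θ changes sign. -/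
theorem csCo_symm (D₀ D₁ : RConn ρ F E) (n : ℕ) (l : List L) :
    csCo D₁ D₀ n l = -csCo D₀ D₁ n l := by
  have hd : Cochain.form1 (diff D₁ D₀) = -Cochain.form1 (diff D₀ D₁) := by
    refine Cochain.ext_apply fun l => ?_
    rcases l with _ | ⟨a, _ | ⟨b, l⟩⟩
    · simp
    · refine LinearMap.ext fun s => ?_
      exact (neg_sub _ _).symm
    · simp [Cochain.form1]
  ext x
  change _ = -(csCo D₀ D₁ n l x)
  rw [csCo_apply, csCo_apply, ← intervalIntegral.integral_neg]
  have h1 := intervalIntegral.integral_comp_sub_left (a := (0 : ℝ)) (b := 1) (fun t => (n + 1) •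
    trEnd ((Cochain.form1 (diff D₁ D₀) * (line D₁ D₀ t).curvCo ^ n) l) x) 1
  rw [sub_self, sub_zero] at h1
  rw [← h1]
  congr 1
  funext t
  rw [line_symm, hd, neg_mul, Cochain.neg_apply, map_neg]
  exact smul_neg _ _

theorem csCo_self (D : RConn ρ F E) (n : ℕ) (l : List L) : csCo D D n l = 0 := by
  have h := csCo_symm D D n l
  ext x
  have h2 := congrArg (fun f : C^∞⟮I, N; ℝ⟯ => f x) h
  change csCo D D n l x = -(csCo D D n l x) at h2
  change csCo D D n l x = 0
  linarith

theorem IsFlat.trEnd_curvCo_pow {D : RConn ρ F E} (hD : D.IsFlat) (n : ℕ) (l : List L) :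
    trEnd ((D.curvCo ^ (n + 1)) l) = 0 := by
  have h : D.curvCo = 0 := by
    refine Cochain.ext_ins rfl fun a => ?_
    rw [curvCo, hD, Cochain.ins_form2]
    exact Cochain.form1_zero
  rw [h, pow_succ, mul_zero, Cochain.zero_apply, map_zero]

end RConn

end AdjointConn

/-! ### Restriction to the slices `{t} × M` -/

section Slices

variable {EM : Type*} [NormedAddCommGroup EM] [NormedSpace ℝ EM] [FiniteDimensional ℝ EM]
  {H : Type*} [TopologicalSpace H] {I : ModelWithCorners ℝ EM H} [I.Boundaryless]
  {M : Type*} [TopologicalSpace M] [ChartedSpace H M] [IsManifold I ∞ M] [T2Space M]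
  {FA : Type*} [NormedAddCommGroup FA] [NormedSpace ℝ FA]
  {A : M → Type*} [TopologicalSpace (TotalSpace FA A)] [∀ x, TopologicalSpace (A x)]
  [∀ x, AddCommGroup (A x)] [∀ x, Module ℝ (A x)] [FiberBundle FA A] [VectorBundle ℝ FA A]
  [ContMDiffVectorBundle ∞ FA A I]
  {F : Type*} [NormedAddCommGroup F] [NormedSpace ℝ F] [FiniteDimensional ℝ F]
  {E : M → Type*} [TopologicalSpace (TotalSpace F E)] [∀ x, TopologicalSpace (E x)]
  [∀ x, AddCommGroup (E x)] [∀ x, Module ℝ (E x)] [FiberBundle F E] [VectorBundle ℝ F E]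
  [ContMDiffVectorBundle ∞ F E I]
  {𝒜 : LieAlgebroid I FA A}

/-- The function `(t, x) ↦ f x`. -/
def pullFn (f : C^∞⟮I, M; ℝ⟯) : C^∞⟮𝓘(ℝ, ℝ).prod I, ℝ × M; ℝ⟯ :=
  ⟨fun p => f p.2, f.contMDiff.comp contMDiff_snd⟩

theorem sliceFn_pullFn (t : ℝ) (f : C^∞⟮I, M; ℝ⟯) : sliceFn t (pullFn f) = f := rfl

theorem slice_pullSec (t : ℝ) (s : Cₛ^∞⟮I; F, E⟯) : slice t (pullSec s) = s := rfl

theorem pullSec_add (s s' : Cₛ^∞⟮I; F, E⟯) : pullSec (s + s') = pullSec s + pullSec s' := rfl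

theorem pullSec_smul (c : ℝ) (s : Cₛ^∞⟮I; F, E⟯) : pullSec (c • s) = c • pullSec s := rfl

theorem pullSec_fn_smul (f : C^∞⟮I, M; ℝ⟯) (s : Cₛ^∞⟮I; F, E⟯) :
    pullSec (f • s) = pullFn f • pullSec s := rfl

theorem slice_sub (t : ℝ) (σ τ : Cₛ^∞⟮𝓘(ℝ, ℝ).prod I; F, PullE I E⟯) :
    slice t (σ - τ) = slice t σ - slice t τ := rfl

/-- By tensoriality only the values of σ on the slice matter. This makes restriction to a slice
multiplicative. -/
theorem slice_end (φ : EndSec (𝓘(ℝ, ℝ).prod I) F (PullE I E)) (t : ℝ)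
    (σ : Cₛ^∞⟮𝓘(ℝ, ℝ).prod I; F, PullE I E⟯) :
    slice t (φ (pullSec (slice t σ))) = slice t (φ σ) := by
  ext1 x
  have h0 : (σ - pullSec (slice t σ)) (t, x) = 0 := sub_self (pullVal σ t x)
  have h := tensorial_zero φ (σ - pullSec (slice t σ)) (t, x) h0
  rw [map_sub] at h
  exact (sub_eq_zero.1 h).symm

/-- The restriction of an endomorphism of the pull-back bundle to `{t} × M`. -/
def sliceHom (t : ℝ) : EndSec (𝓘(ℝ, ℝ).prod I) F (PullE I E) →+* EndSec I F E where
  toFun φ :=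
    { toFun := fun s => slice t (φ (pullSec s))
      map_add' := fun s s' => by rw [pullSec_add, map_add, slice_add]
      map_smul' := fun f s => by
        rw [pullSec_fn_smul, map_smul, slice_fn_smul, sliceFn_pullFn, RingHom.id_apply] }
  map_one' := rfl
  map_mul' φ ψ := by
    ext1 s
    exact (slice_end φ t (ψ (pullSec s))).symm
  map_zero' := rfl
  map_add' _ _ := rfl

theorem sliceHom_apply (t : ℝ) (φ : EndSec (𝓘(ℝ, ℝ).prod I) F (PullE I E)) (s : Cₛ^∞⟮I; F, E⟯) :
    sliceHom t φ s = slice t (φ (pullSec s)) := rfl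

theorem sliceFn_trEnd (t : ℝ) (φ : EndSec (𝓘(ℝ, ℝ).prod I) F (PullE I E)) :
    sliceFn t (trEnd φ) = trEnd (sliceHom t φ) := by
  ext x
  have h : ∀ v : E x, (fibreEnd φ (t, x) : E x →ₗ[ℝ] E x) v = fibreEnd (sliceHom t φ) x v := by
    intro v
    rw [← frameSec_surj (I := I) (F := F) x v, fibreEnd_apply]
    exact fibreEnd_apply φ (t, x) (pullSec (frameSec I F E x
      ((trivializationAt F E x).continuousLinearMapAt ℝ x v)))
  exact congrArg (LinearMap.trace ℝ (E x)) (LinearMap.ext h)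

theorem trEnd_slice_apply (φ : EndSec (𝓘(ℝ, ℝ).prod I) F (PullE I E)) (t : ℝ) (x : M) :
    trEnd φ (t, x) = trEnd (sliceHom t φ) x := by
  rw [← sliceFn_trEnd]
  rfl

theorem sliceFn_rhoProd (t : ℝ) (a : 𝒜.Sec) (f : C^∞⟮𝓘(ℝ, ℝ).prod I, ℝ × M; ℝ⟯) :
    sliceFn t (𝒜.rhoProd (0, a) f) = 𝒜.rho a (sliceFn t f) := by
  ext x
  rw [sliceFn_apply, LieAlgebroid.rhoProd_apply, zero_mul, zero_add]

theorem prod_lie_eq (a b : 𝒜.Sec) : ⁅((0 : ℝ), a), ((0 : ℝ), b)⁆ = ((0 : ℝ), ⁅a, b⁆) :=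
  Prod.ext (lie_self (0 : ℝ)) rfl

theorem dt_lie_eq_zero (a : 𝒜.Sec) : ⁅((1 : ℝ), (0 : 𝒜.Sec)), ((0 : ℝ), a)⁆ = 0 :=
  Prod.ext (lie_zero (1 : ℝ)) (zero_lie a)

namespace RConn

/-- The symbol of the operator is tangent to the slice. In a frame at the point, the coefficients of
σ vanish on the slice, and so do their derivatives along it. -/
theorem slice_op_eq_zero (D : RConn 𝒜.rhoProd F (PullE I E)) (t : ℝ) (a : 𝒜.Sec)
    {σ : Cₛ^∞⟮𝓘(ℝ, ℝ).prod I; F, PullE I E⟯} (hσ : slice t σ = 0) :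
    slice t (D.op (0, a) σ) = 0 := by
  ext1 x
  have h0 : ∀ y, σ (t, y) = 0 := fun y => congrArg (fun s => s y) hσ
  have h1 : ∀ i, sliceFn t (frameCoord (𝓘(ℝ, ℝ).prod I) F (PullE I E) (t, x)
      ((Module.finBasis ℝ F).coord i) σ) = 0 := by
    intro i
    ext y
    rw [sliceFn_apply, frameCoord_apply, h0]
    simp
  have h2 : ∀ i, frameCoord (𝓘(ℝ, ℝ).prod I) F (PullE I E) (t, x)
      ((Module.finBasis ℝ F).coord i) σ (t, x) = 0 := fun i =>
    congrArg (fun f : C^∞⟮I, M; ℝ⟯ => f x) (h1 i)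
  have h3 : ∀ i, 𝒜.rhoProd (0, a) (frameCoord (𝓘(ℝ, ℝ).prod I) F (PullE I E) (t, x)
      ((Module.finBasis ℝ F).coord i) σ) (t, x) = 0 := by
    intro i
    rw [← sliceFn_apply, sliceFn_rhoProd, h1, map_zero]
    rfl
  have h := congrArg (fun s => D.op (0, a) s (t, x)) (frame_expand (t, x) σ)
  simp only [map_sum, D.isCDO _ _ _, sec_sum_apply, ContMDiffSection.coe_add, Pi.add_apply,
    fn_smul_apply, h0, h2, h3, zero_smul, smul_zero, add_zero, ContMDiffMap.coe_mul, Pi.mul_apply,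
    cutoff_self, one_mul, one_smul, Finset.sum_const_zero] at h
  exact h

/-- The restriction of a connection on the pull-back bundle to `{t} × M`. -/
def slice (D : RConn 𝒜.rhoProd F (PullE I E)) (t : ℝ) : RConn 𝒜.rho F E where
  op := LinearMap.mk₂ ℝ (fun a s => LieAlgd.slice t (D.op (0, a) (pullSec s)))
    (fun a b s => by
      have h : ((0 : ℝ), a + b) = (0, a) + (0, b) := by simp
      rw [h, map_add]
      rfl)
    (fun c a s => by
      have h : ((0 : ℝ), c • a) = c • (0, a) := by simp
      rw [h, map_smul]
      rfl)
    (fun a s s' => by rw [pullSec_add, map_add, slice_add])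
    (fun c a s => by rw [pullSec_smul, map_smul, slice_smul])
  isCDO a f s := by
    simp only [LinearMap.mk₂_apply]
    rw [pullSec_fn_smul, D.isCDO, slice_add, slice_fn_smul, slice_fn_smul, sliceFn_rhoProd]
    rfl

/-- The restricted connection, defined through time-independent extensions, may be computed with any
extension of the section. -/
theorem op_slice (D : RConn 𝒜.rhoProd F (PullE I E)) (t : ℝ) (a : 𝒜.Sec)
    (σ : Cₛ^∞⟮𝓘(ℝ, ℝ).prod I; F, PullE I E⟯) :
    (D.slice t).op a (LieAlgd.slice t σ) = LieAlgd.slice t (D.op (0, a) σ) := by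
  have h := slice_op_eq_zero D t a (σ := pullSec (LieAlgd.slice t σ) - σ)
    (by rw [slice_sub, slice_pullSec, sub_self])
  rw [map_sub, slice_sub] at h
  exact sub_eq_zero.1 h

theorem sliceHom_curv (D : RConn 𝒜.rhoProd F (PullE I E)) (t : ℝ) (a b : 𝒜.Sec) :
    sliceHom t (D.curv (0, a) (0, b)) = (D.slice t).curv a b := by
  ext1 s
  rw [sliceHom_apply, curv_apply, curv_apply, slice_sub, slice_sub,
    ← op_slice D t a (D.op (0, b) (pullSec s)), ← op_slice D t b (D.op (0, a) (pullSec s)),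
    prod_lie_eq]
  rfl

theorem slice_line (D₀ D₁ : RConn 𝒜.rhoProd F (PullE I E)) (s t : ℝ) :
    (line D₀ D₁ s).slice t = line (D₀.slice t) (D₁.slice t) s := rfl

theorem mapHom_curvCo (D : RConn 𝒜.rhoProd F (PullE I E)) (t : ℝ) :
    Cochain.mapHom (sliceHom t) (Cochain.pull (fun a : 𝒜.Sec => ((0 : ℝ), a)) D.curvCo) =
      (D.slice t).curvCo := by
  rw [curvCo, Cochain.pull_form2, Cochain.mapHom_form2]
  simp only [sliceHom_curv]
  rfl

/-- The restriction of a Chern-Simons cochain to `{t} × M`. -/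
theorem sliceFn_csCo (D₀ D₁ : RConn 𝒜.rhoProd F (PullE I E)) (n : ℕ) (t : ℝ) (l : List 𝒜.Sec) :
    sliceFn t (csCo D₀ D₁ n (l.map fun a => ((0 : ℝ), a))) =
      csCo (D₀.slice t) (D₁.slice t) n l := by
  ext x
  rw [sliceFn_apply, csCo_apply, csCo_apply]
  congr 1
  funext s
  congr 1
  rw [trEnd_slice_apply, ← Cochain.pull_apply (fun a : 𝒜.Sec => ((0 : ℝ), a)),
    ← Cochain.mapHom_apply, Cochain.pull_mul, Cochain.pull_pow, map_mul, map_pow, mapHom_curvCo,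
    Cochain.pull_form1, Cochain.mapHom_form1, slice_line]
  rfl

theorem slice_affConn (D₀ D₁ : RConn 𝒜.rho F E) (t : ℝ) :
    (affConn D₀ D₁).slice t = line D₀ D₁ t := by
  refine ext_op fun a s => ?_
  ext1 x
  refine (affConn_apply D₀ D₁ 0 a (pullSec s) t x).trans ?_
  rw [zero_smul, add_zero, slice_pullSec]
  rfl

theorem affConn_op_dt (D₀ D₁ : RConn 𝒜.rho F E) (σ : Cₛ^∞⟮𝓘(ℝ, ℝ).prod I; F, PullE I E⟯) :
    (affConn D₀ D₁).op (1, 0) σ = dtSec σ := by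
  refine pullVal_ext fun t x => ?_
  rw [affConn_apply]
  simp

theorem affConn_op_pullSec (D₀ D₁ : RConn 𝒜.rho F E) (a : 𝒜.Sec) (s : Cₛ^∞⟮I; F, E⟯) :
    (affConn D₀ D₁).op (0, a) (pullSec s) = (1 - timeFn (I := I) (M := M)) • pullSec (D₀.op a s) +
      timeFn (I := I) (M := M) • pullSec (D₁.op a s) := by
  refine pullVal_ext fun t x => ?_
  rw [affConn_apply, zero_smul, add_zero]
  rfl

/-- Since ∂_t commutes with the time-independent sections, this curvature component is the
t-derivative of (1 - t)∇⁰ + t∇¹. -/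
theorem sliceHom_curv_dt (D₀ D₁ : RConn 𝒜.rho F E) (t : ℝ) (a : 𝒜.Sec) :
    sliceHom t ((affConn D₀ D₁).curv (1, 0) (0, a)) = diff D₀ D₁ a := by
  ext s x
  rw [sliceHom_apply, curv_apply, affConn_op_dt, affConn_op_dt, dt_lie_eq_zero, map_zero,
    dtSec_pullSec, map_zero, LinearMap.zero_apply, sub_zero, sub_zero, slice_apply,
    affConn_op_pullSec, map_add, pullVal_add, dtSec_smul, dtSec_smul, dtSec_pullSec, dtSec_pullSec]
  have h1 : deriv (fun s : ℝ => (1 - timeFn (I := I) (M := M)) (s, x)) t = -1 := by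
    change deriv (fun s : ℝ => 1 - s) t = -1
    simp
  have h2 : deriv (fun s : ℝ => timeFn (I := I) (M := M) (s, x)) t = 1 := deriv_id t
  rw [h1, h2, pullVal_pullSec, pullVal_pullSec, diff_apply]
  have h3 : pullVal (0 : Cₛ^∞⟮𝓘(ℝ, ℝ).prod I; F, PullE I E⟯) t x = 0 := rfl
  rw [h3, smul_zero, smul_zero, zero_add, zero_add, one_smul, neg_one_smul, neg_add_eq_sub]
  rfl

/-- The component of the Chern character of `∇^aff` in the direction of `t`. -/
theorem trEnd_affConn_dt (D₀ D₁ : RConn 𝒜.rho F E) (n : ℕ) (l : List 𝒜.Sec) (t : ℝ) (x : M) :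
    trEnd (((affConn D₀ D₁).curvCo ^ (n + 1))
        (((1 : ℝ), (0 : 𝒜.Sec)) :: l.map fun a => ((0 : ℝ), a))) (t, x) =
      (n + 1) • trEnd ((Cochain.form1 (diff D₀ D₁) * (line D₀ D₁ t).curvCo ^ n) l) x := by
  have h := congrArg (fun f => f (l.map fun a => ((0 : ℝ), a)))
    -- Contraction with ∂_t acts as an ungraded derivation on powers of the curvature, which has
    -- even degree; this produces the factor n + 1.
    (Cochain.trace_derivation_pow (Cochain.ins ((1 : ℝ), (0 : 𝒜.Sec)))
      (fun f g hf => by rw [Cochain.ins_mul, hf])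
      (trEnd (I := 𝓘(ℝ, ℝ).prod I) (F := F) (E := PullE I E)).toAddMonoidHom trEnd_mul_comm
      (affConn D₀ D₁).bar_curvCo n)
  have h2 := congrArg (fun f : C^∞⟮𝓘(ℝ, ℝ).prod I, ℝ × M; ℝ⟯ => f (t, x)) h
  refine h2.trans ?_
  change (n + 1) • (trEnd ((Cochain.ins ((1 : ℝ), (0 : 𝒜.Sec)) (affConn D₀ D₁).curvCo *
    (affConn D₀ D₁).curvCo ^ n) (l.map fun a => ((0 : ℝ), a))) (t, x)) = _
  congr 1
  rw [trEnd_slice_apply, ← Cochain.pull_apply (fun a : 𝒜.Sec => ((0 : ℝ), a)),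
    ← Cochain.mapHom_apply, Cochain.pull_mul, Cochain.pull_pow, map_mul, map_pow, mapHom_curvCo,
    slice_affConn, curvCo, Cochain.ins_form2, Cochain.pull_form1, Cochain.mapHom_form1]
  simp only [sliceHom_curv_dt]

theorem cs_eq_csCo (D₀ D₁ : RConn 𝒜.rho F E) (n : ℕ) (hp : 0 < n + 1)
    (a : Fin (2 * (n + 1) - 1) → 𝒜.Sec) :
    cs (n + 1) hp D₀ D₁ a = csCo D₀ D₁ n (List.ofFn a) := by
  ext x
  rw [cs, simplexInt_apply, csCo_apply]
  congr 1
  funext t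
  rw [← trEnd_affConn_dt, AlternatingMap.domDomCongr_apply, ch_eq]
  congr 3
  rw [List.map_ofFn]
  exact List.ofFn_succ (f := (Fin.cons ((1 : ℝ), (0 : 𝒜.Sec)) fun i => ((0 : ℝ), a i) :
    Fin (2 * (n + 1) - 1 + 1) → ℝ × 𝒜.Sec))

end RConn

end Slices

/-! ### Paths of metrics -/

section MetricPath

variable {EM : Type*} [NormedAddCommGroup EM] [NormedSpace ℝ EM]
  {H : Type*} [TopologicalSpace H] {I : ModelWithCorners ℝ EM H}
  {M : Type*} [TopologicalSpace M] [ChartedSpace H M]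
  {F : Type*} [NormedAddCommGroup F] [NormedSpace ℝ F]
  {E : M → Type*} [TopologicalSpace (TotalSpace F E)] [∀ x, TopologicalSpace (E x)]
  [∀ x, AddCommGroup (E x)] [∀ x, Module ℝ (E x)]
  [∀ x, IsTopologicalAddGroup (E x)] [∀ x, ContinuousConstSMul ℝ (E x)]
  [FiberBundle F E] [VectorBundle ℝ F E]

instance instIsTopologicalAddGroupPullE (p : ℝ × M) : IsTopologicalAddGroup (PullE I E p) :=
  inferInstanceAs (IsTopologicalAddGroup (E p.2))

instance instContinuousConstSMulPullE (p : ℝ × M) : ContinuousConstSMul ℝ (PullE I E p) :=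
  inferInstanceAs (ContinuousConstSMul ℝ (E p.2))

/-- The pull-back of a metric to `ℝ × M`, as a family of bilinear forms. -/
def pullInner (h : ContMDiffRiemannianMetric I ∞ F E) (p : ℝ × M) :
    PullE I E p →L[ℝ] PullE I E p →L[ℝ] ℝ := h.inner p.2

theorem pull_symm_apply (p₀ p : ℝ × M) (hp : p.2 ∈ (trivializationAt F E p₀.2).baseSet) (v : F) :
    (trivializationAt F (PullE I E) p₀).symm p v = (trivializationAt F E p₀.2).symm p.2 v :=
  Trivialization.symm_apply (trivializationAt F (PullE I E) p₀) (b := p) hp v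

/-- In the trivializations, the coordinate expression of the pull-back is that of the metric
composed with the projection. -/
theorem contMDiff_pullInner (h : ContMDiffRiemannianMetric I ∞ F E) :
    ContMDiff (𝓘(ℝ, ℝ).prod I) ((𝓘(ℝ, ℝ).prod I).prod 𝓘(ℝ, F →L[ℝ] F →L[ℝ] ℝ)) ∞
      fun p : ℝ × M => TotalSpace.mk' (F →L[ℝ] F →L[ℝ] ℝ)
        (E := fun p => PullE I E p →L[ℝ] PullE I E p →L[ℝ] ℝ) p (pullInner h p) := by
  intro p₀
  have h1 := ((contMDiffAt_hom_bundle _).1 (h.contMDiff p₀.2)).2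
  refine (contMDiffAt_hom_bundle _).2 ⟨contMDiffAt_id, ?_⟩
  refine (ContMDiffAt.comp (f := fun p : ℝ × M => p.2) p₀ h1
    (contMDiff_snd (I := 𝓘(ℝ, ℝ)) (J := I) (M := ℝ) (N := M)).contMDiffAt).congr_of_eventuallyEq ?_
  have hev := (continuous_snd.tendsto p₀).eventually ((trivializationAt F E p₀.2).open_baseSet.mem_nhds
      (mem_baseSet_trivializationAt F E p₀.2))
  filter_upwards [hev] with p hp
  ext v w
  have hp' : p ∈ (trivializationAt F (PullE I E) p₀).baseSet := hp
  refine (inCoordinates_apply_eq₂ hp' hp' (mem_univ _)).trans ?_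
  refine Eq.trans ?_ (inCoordinates_apply_eq₂ hp hp (mem_univ _)).symm
  rw [pull_symm_apply p₀ p hp, pull_symm_apply p₀ p hp]
  rfl

/-- This set is the image of the unit ball of the metric under multiplication by 2. -/
theorem isVonNBounded_metric_lt {x : M} (h : ContMDiffRiemannianMetric I ∞ F E) :
    Bornology.IsVonNBounded ℝ {v : E x | h.inner x v v < 4} := by
  refine ((h.isVonNBounded x).image
    ((2 : ℝ) • ContinuousLinearMap.id ℝ (E x) : E x →L[ℝ] E x)).subset fun v hv => ?_
  refine ⟨(2 : ℝ)⁻¹ • v, ?_, ?_⟩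
  · change h.inner x v v < 4 at hv
    change h.inner x ((2 : ℝ)⁻¹ • v) ((2 : ℝ)⁻¹ • v) < 1
    simp only [map_smul, smul_apply, smul_eq_mul]
    linarith
  · change (2 : ℝ) • (2 : ℝ)⁻¹ • v = v
    rw [smul_smul, mul_inv_cancel₀ two_ne_zero, one_smul]

theorem metric_nonneg (h : ContMDiffRiemannianMetric I ∞ F E) (x : M) (v : E x) :
    0 ≤ h.inner x v v := by
  by_cases hv : v = 0
  · rw [hv, map_zero]
  · exact (h.pos x v hv).le

/-- A smooth path of metrics from `h` to `h'`, as a metric on the pull-back bundle. -/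
def metricPath (h h' : ContMDiffRiemannianMetric I ∞ F E) :
    ContMDiffRiemannianMetric (𝓘(ℝ, ℝ).prod I) ∞ F (PullE I E) where
  -- The affine path would lose positivity outside [0, 1], but the pull-back bundle lives over all
  -- of ℝ; the smooth transition stays in [0, 1] and has the right values at 0 and 1.
  inner p := (1 - Real.smoothTransition p.1) • pullInner h p +
    Real.smoothTransition p.1 • pullInner h' p
  symm p v w := by
    have h1 : pullInner h p v w = pullInner h p w v := h.symm p.2 v w
    have h2 : pullInner h' p v w = pullInner h' p w v := h'.symm p.2 v w
    simp only [add_apply, smul_apply, h1, h2]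
  pos p v hv := by
    have h1 : 0 < pullInner h p v v := h.pos p.2 v hv
    have h2 : 0 < pullInner h' p v v := h'.pos p.2 v hv
    have h3 := Real.smoothTransition.nonneg p.1
    have h4 := Real.smoothTransition.le_one p.1
    simp only [add_apply, smul_apply, smul_eq_mul]
    rcases h3.eq_or_lt with h5 | h5
    · rw [← h5]
      linarith
    · have := mul_pos h5 h2
      have := mul_nonneg (sub_nonneg.2 h4) h1.le
      linarith
  isVonNBounded p := by
    -- If both metrics were at least 4 at v, so would be their convex combination, which is less
    -- than 1. Any bound of at least 1 in place of 4 would serve.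
    refine ((isVonNBounded_metric_lt (x := p.2) h).union
      (isVonNBounded_metric_lt (x := p.2) h')).subset fun v hv => ?_
    have h1 : 0 ≤ pullInner h p v v := metric_nonneg h p.2 v
    have h2 : 0 ≤ pullInner h' p v v := metric_nonneg h' p.2 v
    have h3 := Real.smoothTransition.nonneg p.1
    have h4 := Real.smoothTransition.le_one p.1
    change (1 - Real.smoothTransition p.1) * pullInner h p v v +
      Real.smoothTransition p.1 * pullInner h' p v v < 1 at hv
    by_contra hcon
    have h5 : 4 ≤ pullInner h p v v := not_lt.1 fun h => hcon (Or.inl h)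
    have h6 : 4 ≤ pullInner h' p v v := not_lt.1 fun h => hcon (Or.inr h)
    nlinarith
  contMDiff := by
    have hs : ContMDiff (𝓘(ℝ, ℝ).prod I) 𝓘(ℝ, ℝ) ∞
        fun p : ℝ × M => Real.smoothTransition p.1 :=
      Real.smoothTransition.contDiff.contMDiff.comp contMDiff_fst
    exact ((contMDiff_const.sub hs).smul_section (contMDiff_pullInner h)).add_section
      (hs.smul_section (contMDiff_pullInner h'))

end MetricPath

/-! ### The homotopy formula -/

namespace Cochain

section Pull

variable {L L' B : Type*} [LieRing L] [LieRing L'] [Ring B]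

theorem pull_lieD (j : L' → L) (hj : ∀ a b, j ⁅a, b⁆ = ⁅j a, j b⁆) (δ : L → B →+ B) (a : L')
    (f : Cochain L B) : pull j (lieD δ (j a) f) = lieD (fun b => δ (j b)) a (pull j f) := by
  refine ext_apply fun l => ?_
  induction l generalizing f with
  | nil => rfl
  | cons b l ih =>
    rw [← ins_apply, ← ins_apply, ins_pull, ins_lieD, ins_lieD, map_sub, sub_apply, sub_apply, ih,
      ins_pull, ins_pull, hj]

theorem pull_d (j : L' → L) (hj : ∀ a b, j ⁅a, b⁆ = ⁅j a, j b⁆) (δ : L → B →+ B)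
    (f : Cochain L B) : pull j (d δ f) = d (fun b => δ (j b)) (pull j f) := by
  refine ext_apply fun l => ?_
  induction l generalizing f with
  | nil => rfl
  | cons b l ih =>
    rw [← ins_apply, ← ins_apply, ins_pull, ins_d, ins_d, map_sub, sub_apply, sub_apply, ih,
      pull_lieD j hj, ins_pull]

end Pull

section Alternating

variable {L L' B : Type*} [AddCommGroup L] [Module ℝ L] [AddCommGroup L'] [Module ℝ L']
  [Ring B] [Algebra ℝ B]

theorem IsAlt.pull {f : Cochain L B} (hf : IsAlt f) (j : L' →ₗ[ℝ] L) : IsAlt (pull j f) := by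
  intro l
  induction l generalizing f with
  | nil =>
    refine ⟨fun a b => ?_, fun c a => ?_, fun a => ?_⟩
    · simp only [insList, ins_pull, map_add, hf.head.add]
    · simp only [insList, ins_pull, map_smul, hf.head.smul]
      rfl
    · simp only [insList, ins_pull, hf.head.self, map_zero]
  | cons a l ih => exact ih (hf.ins (j a))

end Alternating

/-- The Lie derivative along an element which commutes with the arguments. -/
theorem lieD_apply_of_comm {L L' B : Type*} [LieRing L] [LieAlgebra ℝ L] [Ring B] [Algebra ℝ B]
    (δ : L → B →+ B) {a : L} {j : L' → L} (hj : ∀ b, ⁅a, j b⁆ = 0) {f : Cochain L B}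
    (hf : IsAlt f) (l : List L') : lieD δ a f (l.map j) = δ a (f (l.map j)) := by
  induction l generalizing f with
  | nil => rfl
  | cons b l ih =>
    have h0 : ins (0 : L) f = 0 := by simpa using hf.head.add 0 0
    rw [List.map_cons, ← ins_apply, ins_lieD, hj, h0, sub_zero, ih (hf.ins (j b)), ins_apply]

/-! ### Exact cochains and the cohomology of alternating forms -/

section Exact

variable {EN : Type*} [NormedAddCommGroup EN] [NormedSpace ℝ EN]
  {H : Type*} [TopologicalSpace H] {I : ModelWithCorners ℝ EN H}
  {N : Type*} [TopologicalSpace N] [ChartedSpace H N]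
  {L : Type*} [LieRing L] [LieAlgebra ℝ L]

/-- The cochains which are differentials of alternating multilinear cochains. -/
def exactCo (ρ : L →ₗ⁅ℝ⁆ Derivation ℝ C^∞⟮I, N; ℝ⟯ C^∞⟮I, N; ℝ⟯) :
    AddSubgroup (Cochain L C^∞⟮I, N; ℝ⟯) where
  carrier := {f | ∃ K, IsAlt K ∧ d (fun a => (ρ a).toLinearMap.toAddMonoidHom) K = f}
  zero_mem' := ⟨0, isAlt_zero, map_zero _⟩
  add_mem' := by
    rintro f g ⟨K, hK, rfl⟩ ⟨K', hK', rfl⟩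
    exact ⟨K + K', hK.add hK', map_add _ _ _⟩
  neg_mem' := by
    rintro f ⟨K, hK, rfl⟩
    exact ⟨-K, hK.neg, map_neg _ _⟩

/-- On lists of length n + 1 the differential sees only the degree-n part of the primitive, so the
other components of `K` are irrelevant. -/
theorem mem_boundaries_of_exactCo {ρ : L →ₗ⁅ℝ⁆ Derivation ℝ C^∞⟮I, N; ℝ⟯ C^∞⟮I, N; ℝ⟯}
    {f : Cochain L C^∞⟮I, N; ℝ⟯} (hf : f ∈ exactCo ρ) {n : ℕ}
    (θ : L [⋀^Fin (n + 1)]→ₗ[ℝ] C^∞⟮I, N; ℝ⟯) (hθ : ∀ a, θ a = f (List.ofFn a)) :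
    θ ∈ boundaries ρ (n + 1) := by
  obtain ⟨K, hK, rfl⟩ := hf
  obtain ⟨η, hη⟩ := hK.exists_alternating n
  exact ⟨η, fun a => by rw [hθ, d_ofFn_eq_extD ρ K η fun b => (hη b).symm]⟩

theorem mem_cocycles_of_d_eq_zero {ρ : L →ₗ⁅ℝ⁆ Derivation ℝ C^∞⟮I, N; ℝ⟯ C^∞⟮I, N; ℝ⟯}
    {f : Cochain L C^∞⟮I, N; ℝ⟯} (hf : d (fun a => (ρ a).toLinearMap.toAddMonoidHom) f = 0) {n : ℕ}
    (θ : L [⋀^Fin n]→ₗ[ℝ] C^∞⟮I, N; ℝ⟯) (hθ : ∀ a, θ a = f (List.ofFn a)) :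
    θ ∈ cocycles ρ n := by
  refine LinearMap.mem_ker.2 (funext fun a => ?_)
  rw [← d_ofFn_eq_extD ρ f θ fun b => (hθ b).symm, hf]
  rfl

end Exact

end Cochain

section Homotopy

variable {EM : Type*} [NormedAddCommGroup EM] [NormedSpace ℝ EM] [FiniteDimensional ℝ EM]
  {H : Type*} [TopologicalSpace H] {I : ModelWithCorners ℝ EM H} [I.Boundaryless]
  {M : Type*} [TopologicalSpace M] [ChartedSpace H M] [IsManifold I ∞ M] [T2Space M]
  {FA : Type*} [NormedAddCommGroup FA] [NormedSpace ℝ FA]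
  {A : M → Type*} [TopologicalSpace (TotalSpace FA A)] [∀ x, TopologicalSpace (A x)]
  [∀ x, AddCommGroup (A x)] [∀ x, Module ℝ (A x)] [FiberBundle FA A] [VectorBundle ℝ FA A]
  [ContMDiffVectorBundle ∞ FA A I]
  {𝒜 : LieAlgebroid I FA A}

theorem rhoProd_dt (f : C^∞⟮𝓘(ℝ, ℝ).prod I, ℝ × M; ℝ⟯) (t : ℝ) (x : M) :
    𝒜.rhoProd (1, 0) f (t, x) = deriv (fun s => f (s, x)) t := by
  rw [LieAlgebroid.rhoProd_apply, one_mul, map_zero]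
  exact add_zero _

theorem intFn_rhoProd_dt (f : C^∞⟮𝓘(ℝ, ℝ).prod I, ℝ × M; ℝ⟯) :
    intFn (𝒜.rhoProd (1, 0) f) = sliceFn 1 f - sliceFn 0 f := by
  ext x
  rw [intFn_apply]
  simp only [rhoProd_dt]
  have h := contDiff_line f x
  exact intervalIntegral.integral_eq_sub_of_hasDerivAt
    (fun t _ => ((h.differentiable (by simp)) t).hasDerivAt)
    ((h.continuous_deriv (by simp)).intervalIntegrable 0 1)

/-- Rescaling writes the primitive as t ∫ f(ts, x) ds over [0, 1]; its smoothness is then that of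
the integral over a fixed interval, for the manifold ℝ × M of parameters. -/
theorem exists_primitive (f : C^∞⟮𝓘(ℝ, ℝ).prod I, ℝ × M; ℝ⟯) :
    ∃ g : C^∞⟮𝓘(ℝ, ℝ).prod I, ℝ × M; ℝ⟯, ∀ t x, g (t, x) = ∫ s in (0 : ℝ)..t, f (s, x) := by
  let f' : C^∞⟮𝓘(ℝ, ℝ).prod (𝓘(ℝ, ℝ).prod I), ℝ × (ℝ × M); ℝ⟯ :=
    ⟨fun q => f (q.2.1 * q.1, q.2.2), by
      refine f.contMDiff.comp (ContMDiff.prodMk ?_ (contMDiff_snd.comp contMDiff_snd))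
      exact (contMDiff_fst.comp contMDiff_snd).mul contMDiff_fst⟩
  refine ⟨timeFn * intFn f', fun t x => ?_⟩
  change t * ∫ s in (0 : ℝ)..1, f (t * s, x) = _
  rw [intervalIntegral.mul_integral_comp_mul_left (f := fun s => f (s, x)), mul_zero, mul_one]

/-- Integration over `[0, 1]` commutes with the action of the sections of the algebroid. -/
theorem intFn_rhoProd (a : 𝒜.Sec) (f : C^∞⟮𝓘(ℝ, ℝ).prod I, ℝ × M; ℝ⟯) :
    intFn (𝒜.rhoProd (0, a) f) = 𝒜.rho a (intFn f) := by
  -- Writing f = ∂_t g replaces differentiation under the integral sign by the fact that ∂_t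
  -- commutes with the action of a; both integrals become boundary terms.
  obtain ⟨g, hg⟩ := exists_primitive f
  have h1 : 𝒜.rhoProd (1, 0) g = f := by
    ext ⟨t, x⟩
    rw [rhoProd_dt]
    simp only [hg]
    exact (contDiff_line f x).continuous.deriv_integral _ 0 t
  have h2 : sliceFn 0 g = 0 := by
    ext x
    rw [sliceFn_apply, hg, intervalIntegral.integral_same]
    rfl
  have h3 : sliceFn 1 g = intFn f := by
    ext x
    rw [sliceFn_apply, hg, intFn_apply]
  have h4 : 𝒜.rhoProd (0, a) (𝒜.rhoProd (1, 0) g) = 𝒜.rhoProd (1, 0) (𝒜.rhoProd (0, a) g) := by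
    have h := congrArg (fun X => X g)
      (LieHom.map_lie 𝒜.rhoProd ((1 : ℝ), (0 : 𝒜.Sec)) ((0 : ℝ), a))
    simp only [dt_lie_eq_zero, map_zero, Derivation.commutator_apply] at h
    exact (sub_eq_zero.1 h.symm).symm
  conv_lhs => rw [← h1]
  rw [h4, intFn_rhoProd_dt, sliceFn_rhoProd, sliceFn_rhoProd, h2, h3, map_zero, sub_zero]

/-- Integration of a cochain over the `1`-simplex. -/
def simplexCo : Cochain (ℝ × 𝒜.Sec) C^∞⟮𝓘(ℝ, ℝ).prod I, ℝ × M; ℝ⟯ →+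
    Cochain 𝒜.Sec C^∞⟮I, M; ℝ⟯ :=
  ((Cochain.mapCo (intFn (I := I) (M := M)).toAddMonoidHom).comp
    (Cochain.pull (LinearMap.inr ℝ ℝ 𝒜.Sec))).comp (Cochain.ins ((1 : ℝ), (0 : 𝒜.Sec)))

/-- The restriction of a cochain to `{t} × M`. -/
def sliceCo (t : ℝ) (f : Cochain (ℝ × 𝒜.Sec) C^∞⟮𝓘(ℝ, ℝ).prod I, ℝ × M; ℝ⟯) :
    Cochain 𝒜.Sec C^∞⟮I, M; ℝ⟯ := ⟨fun l => sliceFn t (f (l.map fun a => ((0 : ℝ), a)))⟩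

/-- Stokes' theorem for the `1`-simplex. -/
theorem simplexCo_d {f : Cochain (ℝ × 𝒜.Sec) C^∞⟮𝓘(ℝ, ℝ).prod I, ℝ × M; ℝ⟯}
    (hf : Cochain.IsAlt f) :
    simplexCo (Cochain.d (fun a => (𝒜.rhoProd a).toLinearMap.toAddMonoidHom) f) -
      (sliceCo 1 f - sliceCo 0 f) ∈ Cochain.exactCo 𝒜.rho := by
  -- Cartan's formula for ∂_t reads ι d = L - d ι. Integrated, L gives the two boundary terms,
  -- because ∂_t commutes with the arguments, and d ι gives the differential of the integral with a
  -- minus sign.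
  refine ⟨-simplexCo f, (((hf.ins _).pull _).mapCo intFn).neg, ?_⟩
  have h1 : Cochain.mapCo (intFn (I := I) (M := M)).toAddMonoidHom
      (Cochain.pull (LinearMap.inr ℝ ℝ 𝒜.Sec)
        (Cochain.d (fun a => (𝒜.rhoProd a).toLinearMap.toAddMonoidHom)
          (Cochain.ins ((1 : ℝ), (0 : 𝒜.Sec)) f))) =
      Cochain.d (fun a => (𝒜.rho a).toLinearMap.toAddMonoidHom) (simplexCo f) := by
    rw [Cochain.pull_d (LinearMap.inr ℝ ℝ 𝒜.Sec) fun a b => (prod_lie_eq a b).symm]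
    exact Cochain.mapCo_d _ _ _ (fun a g => intFn_rhoProd a g) _
  rw [map_neg, ← h1]
  refine Cochain.ext_apply fun l => ?_
  have h2 := Cochain.lieD_apply_of_comm
    (fun a => (𝒜.rhoProd a).toLinearMap.toAddMonoidHom) dt_lie_eq_zero hf l
  have h3 := intFn_rhoProd_dt (𝒜 := 𝒜) (f (l.map fun a => ((0 : ℝ), a)))
  rw [simplexCo, AddMonoidHom.comp_apply, Cochain.ins_d, map_sub]
  have h4 : ((Cochain.mapCo (intFn (I := I) (M := M)).toAddMonoidHom).comp
      (Cochain.pull (LinearMap.inr ℝ ℝ 𝒜.Sec)))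
        (Cochain.lieD (fun a => (𝒜.rhoProd a).toLinearMap.toAddMonoidHom)
          ((1 : ℝ), (0 : 𝒜.Sec)) f) l = sliceCo 1 f l - sliceCo 0 f l :=
    (congrArg intFn h2).trans h3
  simp only [Cochain.neg_apply, Cochain.sub_apply, h4]
  rw [AddMonoidHom.comp_apply]
  abel

variable {F : Type*} [NormedAddCommGroup F] [NormedSpace ℝ F] [FiniteDimensional ℝ F]
  {E : M → Type*} [TopologicalSpace (TotalSpace F E)] [∀ x, TopologicalSpace (E x)]
  [∀ x, AddCommGroup (E x)] [∀ x, Module ℝ (E x)]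
  [∀ x, IsTopologicalAddGroup (E x)] [∀ x, ContinuousConstSMul ℝ (E x)]
  [FiberBundle F E] [VectorBundle ℝ F E] [ContMDiffVectorBundle ∞ F E I]

namespace RConn

/-- The integral over the `1`-simplex of the Chern character of a connection on the pull-back
bundle. -/
def chInt (D : RConn 𝒜.rhoProd F (PullE I E)) (n : ℕ) : Cochain 𝒜.Sec C^∞⟮I, M; ℝ⟯ :=
  simplexCo (Cochain.mapCo trEnd.toAddMonoidHom (D.curvCo ^ (n + 1)))

theorem chInt_affConn (D₀ D₁ : RConn 𝒜.rho F E) (n : ℕ) :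
    (affConn D₀ D₁).chInt n = csCo D₀ D₁ n := by
  refine Cochain.ext_apply fun l => ?_
  ext x
  rw [csCo_apply]
  simp only [← trEnd_affConn_dt]
  rfl

theorem IsFlat.chInt_eq_zero {D : RConn 𝒜.rhoProd F (PullE I E)} (hD : D.IsFlat) (n : ℕ) :
    D.chInt n = 0 := by
  have h : Cochain.mapCo trEnd.toAddMonoidHom (D.curvCo ^ (n + 1)) = 0 :=
    Cochain.ext_apply fun l => hD.trEnd_curvCo_pow n l
  rw [chInt, h, map_zero]

/-- Stokes' theorem for the Chern-Simons cochain on ℝ × M, whose differential is the difference of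
the two Chern characters. Both the triangle relation and the independence of the metric are
instances. -/
theorem chInt_sub_mem (D₀ D₁ : RConn 𝒜.rhoProd F (PullE I E)) (n : ℕ) :
    D₁.chInt n - D₀.chInt n - (csCo (D₀.slice 1) (D₁.slice 1) n -
      csCo (D₀.slice 0) (D₁.slice 0) n) ∈ Cochain.exactCo 𝒜.rho := by
  have h1 := simplexCo_d (isAlt_csCo D₀ D₁ n)
  have h2 : ∀ t, sliceCo t (csCo D₀ D₁ n) = csCo (D₀.slice t) (D₁.slice t) n := fun t =>
    Cochain.ext_apply fun l => sliceFn_csCo D₀ D₁ n t l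
  have h3 : Cochain.d (fun a => (𝒜.rhoProd a).toLinearMap.toAddMonoidHom) (csCo D₀ D₁ n) =
      Cochain.mapCo trEnd.toAddMonoidHom (D₁.curvCo ^ (n + 1)) -
        Cochain.mapCo trEnd.toAddMonoidHom (D₀.curvCo ^ (n + 1)) :=
    Cochain.ext_apply fun l => d_csCo D₀ D₁ n l
  rwa [h2, h2, h3, map_sub] at h1

/-- The triangle relation for Chern-Simons cochains, modulo exact ones. -/
theorem csCo_triangle (D₀ D₁ D₂ : RConn 𝒜.rho F E) (n : ℕ) :
    csCo D₁ D₂ n - (csCo D₀ D₂ n - csCo D₀ D₁ n) ∈ Cochain.exactCo 𝒜.rho := by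
  -- Compare the constant connection D₀ with the path from D₁ to D₂: the integrals are cs(D₀, D₀) =
  -- 0 and cs(D₁, D₂), the ends are cs(D₀, D₁) and cs(D₀, D₂).
  have h := chInt_sub_mem (affConn D₀ D₀) (affConn D₁ D₂) n
  have h0 : csCo D₀ D₀ n = 0 := Cochain.ext_apply fun l => csCo_self D₀ n l
  simp only [chInt_affConn, slice_affConn, line_zero, line_one, h0, sub_zero] at h
  exact h

end RConn

end Homotopy

/-! ### Independence of the metric -/

section MetricIndependence

variable {EM : Type*} [NormedAddCommGroup EM] [NormedSpace ℝ EM] [FiniteDimensional ℝ EM]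
  {H : Type*} [TopologicalSpace H] {I : ModelWithCorners ℝ EM H} [I.Boundaryless]
  {M : Type*} [TopologicalSpace M] [ChartedSpace H M] [IsManifold I ∞ M] [T2Space M]
  {FA : Type*} [NormedAddCommGroup FA] [NormedSpace ℝ FA]
  {A : M → Type*} [TopologicalSpace (TotalSpace FA A)] [∀ x, TopologicalSpace (A x)]
  [∀ x, AddCommGroup (A x)] [∀ x, Module ℝ (A x)] [FiberBundle FA A] [VectorBundle ℝ FA A]
  [ContMDiffVectorBundle ∞ FA A I]
  {F : Type*} [NormedAddCommGroup F] [NormedSpace ℝ F] [FiniteDimensional ℝ F]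
  {E : M → Type*} [TopologicalSpace (TotalSpace F E)] [∀ x, TopologicalSpace (E x)]
  [∀ x, AddCommGroup (E x)] [∀ x, Module ℝ (E x)]
  [∀ x, IsTopologicalAddGroup (E x)] [∀ x, ContinuousConstSMul ℝ (E x)]
  [FiberBundle F E] [VectorBundle ℝ F E] [ContMDiffVectorBundle ∞ F E I]
  {𝒜 : LieAlgebroid I FA A}

namespace RConn

/-- Restrict the defining identity of the adjoint to the slice; the anchor of (0, a) is compatible
with restriction. -/
theorem slice_adjoint (D : RConn 𝒜.rhoProd F (PullE I E))
    (k : ContMDiffRiemannianMetric (𝓘(ℝ, ℝ).prod I) ∞ F (PullE I E))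
    (h : ContMDiffRiemannianMetric I ∞ F E) (t : ℝ)
    (hk : ∀ σ τ, sliceFn t (metricFn k σ τ) = metricFn h (LieAlgd.slice t σ) (LieAlgd.slice t τ)) :
    (D.adjoint k).slice t = (D.slice t).adjoint h :=
  eq_adjoint _ _ h fun a s u => by
    have h1 := congrArg (sliceFn t) (adjoint_spec D k (0, a) (pullSec s) (pullSec u))
    have h2 : ∀ f g : C^∞⟮𝓘(ℝ, ℝ).prod I, ℝ × M; ℝ⟯,
      sliceFn t (f + g) = sliceFn t f + sliceFn t g := fun _ _ => rfl
    rw [sliceFn_rhoProd, h2, hk, hk, hk] at h1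
    exact h1

theorem sliceFn_metricPath_zero (h h' : ContMDiffRiemannianMetric I ∞ F E)
    (σ τ : Cₛ^∞⟮𝓘(ℝ, ℝ).prod I; F, PullE I E⟯) :
    sliceFn 0 (metricFn (metricPath h h') σ τ) = metricFn h (LieAlgd.slice 0 σ)
      (LieAlgd.slice 0 τ) := by
  ext x
  change (1 - Real.smoothTransition 0) * h.inner x (pullVal σ 0 x) (pullVal τ 0 x) +
    Real.smoothTransition 0 * h'.inner x (pullVal σ 0 x) (pullVal τ 0 x) = _
  rw [Real.smoothTransition.zero, sub_zero, one_mul, zero_mul, add_zero]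
  rfl

theorem sliceFn_metricPath_one (h h' : ContMDiffRiemannianMetric I ∞ F E)
    (σ τ : Cₛ^∞⟮𝓘(ℝ, ℝ).prod I; F, PullE I E⟯) :
    sliceFn 1 (metricFn (metricPath h h') σ τ) = metricFn h' (LieAlgd.slice 1 σ)
      (LieAlgd.slice 1 τ) := by
  ext x
  change (1 - Real.smoothTransition 1) * h.inner x (pullVal σ 1 x) (pullVal τ 1 x) +
    Real.smoothTransition 1 * h'.inner x (pullVal σ 1 x) (pullVal τ 1 x) = _
  rw [Real.smoothTransition.one, sub_self, zero_mul, one_mul, zero_add]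
  rfl

theorem end_eq_zero_of_slice {φ : EndSec (𝓘(ℝ, ℝ).prod I) F (PullE I E)}
    (h : ∀ t, sliceHom t φ = 0) : φ = 0 := by
  refine LinearMap.ext fun σ => pullVal_ext fun t x => ?_
  rw [← slice_apply, ← slice_end, ← sliceHom_apply, h]
  rfl

/-- The pull-back of a flat connection is flat. -/
theorem IsFlat.affConn {D : RConn 𝒜.rho F E} (hD : D.IsFlat) : (affConn D D).IsFlat := by
  have h1 : ∀ a, (LieAlgd.affConn D D).curv (1, 0) (0, a) = 0 := fun a =>
    end_eq_zero_of_slice fun t => by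
      rw [sliceHom_curv_dt]
      exact LinearMap.ext fun s => sub_self _
  have h2 : ∀ a b, (LieAlgd.affConn D D).curv (0, a) (0, b) = 0 := fun a b =>
    end_eq_zero_of_slice fun t => by
      have hl : line D D t = D := ext_op fun a s => by
        rw [line_apply, ← add_smul, sub_add_cancel, one_smul]
      rw [sliceHom_curv, slice_affConn, hl, hD]
      rfl
  refine LinearMap.ext fun u => LinearMap.ext fun w => ?_
  -- Split both arguments into a multiple of ∂_t and a section of the algebroid. The mixed
  -- curvatures vanish because the path is constant, the others because D is flat.
  have hu : ∀ v : ℝ × 𝒜.Sec, v = v.1 • ((1 : ℝ), (0 : 𝒜.Sec)) + ((0 : ℝ), v.2) := fun v => by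
    ext <;> simp
  rw [hu u, hu w]
  simp only [map_add, map_smul, LinearMap.add_apply, LinearMap.smul_apply, h1, h2, curv_self,
    curv_skew _ ((0 : ℝ), u.2) ((1 : ℝ), (0 : 𝒜.Sec)), neg_zero, smul_zero, add_zero,
    LinearMap.zero_apply]

/-- The path of metrics is a metric on the pull-back bundle, so the pulled-back connection has an
adjoint there, which is again flat. Both integrated Chern characters vanish, and the homotopy
formula leaves only the difference of the ends. -/
theorem csCo_adjoint_sub_mem {D : RConn 𝒜.rho F E} (hD : D.IsFlat)
    (h h' : ContMDiffRiemannianMetric I ∞ F E) (n : ℕ) :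
    csCo D (D.adjoint h') n - csCo D (D.adjoint h) n ∈ Cochain.exactCo 𝒜.rho := by
  have h1 := chInt_sub_mem (LieAlgd.affConn D D)
    ((LieAlgd.affConn D D).adjoint (metricPath h h')) n
  rw [(hD.affConn.adjoint _).chInt_eq_zero, hD.affConn.chInt_eq_zero, sub_zero, zero_sub,
    slice_adjoint _ _ _ _ (sliceFn_metricPath_zero h h'),
    slice_adjoint _ _ _ _ (sliceFn_metricPath_one h h'), slice_affConn, slice_affConn, line_zero,
    line_one] at h1
  exact (AddSubgroup.neg_mem_iff _).1 h1

/-- Adjunction exchanges the two connections with sign +1, exchanging them back gives sign -1. The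
cochain itself vanishes, not only its class. -/
theorem csCo_adjoint_eq_zero (D : RConn 𝒜.rho F E) (h : ContMDiffRiemannianMetric I ∞ F E) {n : ℕ}
    (hn : Even (n + 1)) : csCo D (D.adjoint h) n = 0 := by
  refine Cochain.ext_apply fun l => ?_
  have h1 := csCo_adjoint D (D.adjoint h) h n l
  rw [adjoint_adjoint, hn.neg_one_pow, one_smul, csCo_symm D (D.adjoint h)] at h1
  ext x
  have h2 := congrArg (fun f : C^∞⟮I, M; ℝ⟯ => f x) h1
  change csCo D (D.adjoint h) n l x = -(csCo D (D.adjoint h) n l x) at h2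
  change csCo D (D.adjoint h) n l x = 0
  linarith

/-- A metric connection is its own adjoint, so its curvature is skew and odd powers have a trace
equal to its own negative. -/
theorem trEnd_curvCo_eq_zero {D : RConn 𝒜.rho F E} {h : ContMDiffRiemannianMetric I ∞ F E}
    (hD : D.IsMetricFor h) {n : ℕ} (hn : Odd n) (l : List 𝒜.Sec) :
    trEnd ((D.curvCo ^ n) l) = 0 := by
  have h1 := trEnd_curvCo_adjoint D h n l
  rw [hD.adjoint_eq, hn.neg_one_pow, neg_one_smul] at h1
  ext x
  have h2 := congrArg (fun f : C^∞⟮I, M; ℝ⟯ => f x) h1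
  change trEnd ((D.curvCo ^ n) l) x = -(trEnd ((D.curvCo ^ n) l) x) at h2
  change trEnd ((D.curvCo ^ n) l) x = 0
  linarith

/-- For a flat connection, the Chern-Simons cochain of the adjoint connection is cohomologous to
twice the one of a metric connection. -/
theorem csCo_adjoint_sub_two_mem {D Dm : RConn 𝒜.rho F E} (hD : D.IsFlat)
    {h₀ : ContMDiffRiemannianMetric I ∞ F E} (hDm : Dm.IsMetricFor h₀)
    (h : ContMDiffRiemannianMetric I ∞ F E) {n : ℕ} (hn : Odd (n + 1)) :
    csCo D (D.adjoint h) n - (2 : ℝ) • csCo D Dm n ∈ Cochain.exactCo 𝒜.rho := by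
  have h1 := csCo_adjoint_sub_mem hD h₀ h n
  have h2 := csCo_triangle D Dm (D.adjoint h₀) n
  -- Adjunction with respect to h₀ fixes Dm and turns the adjoint of D back into D; as the degree is
  -- odd, its sign cancels that of exchanging the two connections.
  have h3 : csCo Dm (D.adjoint h₀) n = csCo D Dm n := by
    refine Cochain.ext_apply fun l => ?_
    rw [csCo_adjoint Dm (D.adjoint h₀) h₀ n l, hDm.adjoint_eq, adjoint_adjoint, hn.neg_one_pow,
      neg_one_smul, csCo_symm, neg_neg]
  rw [h3] at h2
  have h4 : csCo D (D.adjoint h) n - (2 : ℝ) • csCo D Dm n =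
      (csCo D (D.adjoint h) n - csCo D (D.adjoint h₀) n) -
        (csCo D Dm n - (csCo D (D.adjoint h₀) n - csCo D Dm n)) := by
    have h5 : (2 : ℝ) • csCo D Dm n = csCo D Dm n + csCo D Dm n :=
      Cochain.ext_apply fun l => two_smul ℝ _
    rw [h5]
    abel
  rw [h4]
  exact sub_mem h1 h2

end RConn

end MetricIndependence

end LieAlgd

end

/-- Secondary characteristic classes of an `ℝ`-linear connection `D` of a Lie algebroid `𝒜` on a
vector bundle `E`, and the Chern-Simons forms of `D` and a metric connection `Dm`. The class
`u (2p - 1)` is the class of `cs p (D, D^h)`; here `h` is an arbitrary metric on `E`. -/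
theorem mainTheorem4
    {EM : Type*} [NormedAddCommGroup EM] [NormedSpace ℝ EM] [FiniteDimensional ℝ EM]
    {H : Type*} [TopologicalSpace H] {I : ModelWithCorners ℝ EM H} [I.Boundaryless]
    {M : Type*} [TopologicalSpace M] [ChartedSpace H M] [IsManifold I ∞ M]
    [T2Space M] [SigmaCompactSpace M]
    {FA : Type*} [NormedAddCommGroup FA] [NormedSpace ℝ FA] [FiniteDimensional ℝ FA]
    {A : M → Type*} [TopologicalSpace (TotalSpace FA A)] [∀ x, TopologicalSpace (A x)]
    [∀ x, AddCommGroup (A x)] [∀ x, Module ℝ (A x)] [FiberBundle FA A] [VectorBundle ℝ FA A]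
    [ContMDiffVectorBundle ∞ FA A I]
    {F : Type*} [NormedAddCommGroup F] [NormedSpace ℝ F] [FiniteDimensional ℝ F]
    {E : M → Type*} [TopologicalSpace (TotalSpace F E)] [∀ x, TopologicalSpace (E x)]
    [∀ x, AddCommGroup (E x)] [∀ x, Module ℝ (E x)]
    [∀ x, IsTopologicalAddGroup (E x)] [∀ x, ContinuousConstSMul ℝ (E x)]
    [FiberBundle F E] [VectorBundle ℝ F E] [ContMDiffVectorBundle ∞ F E I]
    (𝒜 : LieAlgd.LieAlgebroid I FA A)
    (D Dm : LieAlgd.RConn 𝒜.rho F E)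
    (hDm : ∃ h₀ : ContMDiffRiemannianMetric I ∞ F E, Dm.IsMetricFor h₀)
    (p : ℕ) (hp : 0 < p)
    (h : ContMDiffRiemannianMetric I ∞ F E) :
    (Even p →
      ∃ hc : LieAlgd.cs p hp D (D.adjoint h) ∈ LieAlgd.cocycles 𝒜.rho (2 * p - 1),
        LieAlgd.cohomClass 𝒜.rho (LieAlgd.cs p hp D (D.adjoint h)) hc = 0) ∧
    (Odd p → D.IsFlat →
      ∃ (hc : LieAlgd.cs p hp D (D.adjoint h) ∈ LieAlgd.cocycles 𝒜.rho (2 * p - 1))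
        (hcm : LieAlgd.cs p hp D Dm ∈ LieAlgd.cocycles 𝒜.rho (2 * p - 1)),
        LieAlgd.cohomClass 𝒜.rho (LieAlgd.cs p hp D (D.adjoint h)) hc =
          LieAlgd.cohomClass 𝒜.rho ((2 : ℝ) • LieAlgd.cs p hp D Dm)
            (Submodule.smul_mem _ (2 : ℝ) hcm)) := by
  obtain ⟨n, rfl⟩ : ∃ n, p = n + 1 := ⟨p - 1, (Nat.succ_pred_eq_of_pos hp).symm⟩
  obtain ⟨h₀, hDm⟩ := hDm
  refine ⟨fun hn => ?_, fun hn hD => ?_⟩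
  · have h1 : LieAlgd.cs (n + 1) hp D (D.adjoint h) = 0 := by
      ext1 a
      rw [LieAlgd.RConn.cs_eq_csCo, D.csCo_adjoint_eq_zero h hn]
      rfl
    refine ⟨by rw [h1]; exact zero_mem _, Subtype.ext ?_⟩
    change (LieAlgd.boundaries 𝒜.rho _).mkQ (LieAlgd.cs (n + 1) hp D (D.adjoint h)) = 0
    rw [h1, map_zero]
  -- By transgression and the flatness of D, closedness only requires the Chern character of the
  -- other connection to vanish.
  · have hclosed : ∀ D' : LieAlgd.RConn 𝒜.rho F E,
        (∀ l, LieAlgd.trEnd ((D'.curvCo ^ (n + 1)) l) = 0) →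
          LieAlgd.cs (n + 1) hp D D' ∈ LieAlgd.cocycles 𝒜.rho (2 * (n + 1) - 1) := fun D' h' =>
      LieAlgd.Cochain.mem_cocycles_of_d_eq_zero (LieAlgd.Cochain.ext_apply fun l => by
        rw [LieAlgd.RConn.d_csCo, h', hD.trEnd_curvCo_pow, sub_zero]
        rfl) _ (LieAlgd.RConn.cs_eq_csCo D D' n hp)
    refine ⟨hclosed _ fun l => (hD.adjoint h).trEnd_curvCo_pow n l,
      hclosed _ fun l => LieAlgd.RConn.trEnd_curvCo_eq_zero hDm hn l,
      (LieAlgd.cohomClass_eq_iff _ _ _).2 ?_⟩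
    -- The degree 2(n + 1) - 1 unfolds to 2n + 1, so the primitive has degree 2n.
    refine LieAlgd.Cochain.mem_boundaries_of_exactCo (n := 2 * n)
      (LieAlgd.RConn.csCo_adjoint_sub_two_mem hD hDm h hn) _ fun a => ?_
    change LieAlgd.cs (n + 1) hp D (D.adjoint h) a -
      (2 : ℝ) • LieAlgd.cs (n + 1) hp D Dm a = _
    rw [LieAlgd.RConn.cs_eq_csCo, LieAlgd.RConn.cs_eq_csCo]
    rfl
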